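/- Let $G$ be a compact connected Lie group with simple Lie algebra $\mathfrak g$, $dh$ its Haar measure of total mass $1$. Let $\lambda$ run over the irreducible finite-dimensional representations $V_\lambda$ of $G$, with character $\chi_\lambda$ and value $c_2(\lambda)$ of the quadratic Casimir element defined by the Killing form. **Surfaces with open Wilson graphs.** Let $\Sigma$ be a compact oriented surface with a finite embedded graph which cuts it into regions $D$, each with one boundary circle, genus $g_D$ (after closing it by a disc) and area $A_D>0$; the boundary of $\Sigma$ is cut into intervals by vertices. Combinatorially, $\Sigma$ is given by the cyclic words of sides read counterclockwise around the regions, each side of an edge and each boundary interval occurring exactly once. Each oriented edge $e$ in $\Sigma$ is colored by a finite-dimensional representation $V_e$; there are also finitely many colored outer edges, which are attached to vertices and leave the surface. Each vertex carries a $G$-invariant vector in the tensor product, over the adjacent half-edges and outer edges, of $V_e$ (edge oriented outward) or $V_e^*$ (oriented inward). Denote these data by $\Gamma$. For holonomies $g_b\in G$ of the boundary intervals and $h_e\in G$ of the edges, let $hol_{\partial D}$ be the product of the holonomies around $D$ in counterclockwise order, and let $W_\Gamma(h)$ be the contraction of the vertex vectors along the edges $e$, by means of $\pi_{V_e}(h_e^{-1}):V_e\to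 V_e$ from the beginning to the end of $e$ (with holonomies multiplied from left to right along paths, so that $h_e\mapsto k_{\mathrm{begin}}h_ek_{\mathrm{end}}^{-1}$ under gauge transformations). It takes values in the tensor product of the representations of the outer edges. The partition function is $$Z(\Sigma,\Gamma;g)=\int_{G^{E}}\prod_D Z_{D}(hol_{\partial D})\,W_\Gamma(h)\prod_{e\in E}dh_e,\qquad Z_{D}(x)=\sum_\lambda\chi_\lambda(x)\dim(\lambda)^{1-2g_D}e^{-c_2(\lambda)A_D}.$$ **Theorem.** All these sums and integrals converge absolutely, and the following hold, the integrands on the left being integrable in $h$ (the remaining boundary holonomies are fixed and not written). (1) Let $e_1$ and $e_2$ be boundary intervals of $(\Sigma_1,\Gamma_1)$ and $(\Sigma_2,\Gamma_2)$, and $V_\mu$ a finite-dimensional representation. Let $\Sigma_1\cup_{e_1\simeq e_2}\Sigma_2$ be obtained by identifying $e_1$ with $e_2$ reversed, with graph $\Gamma_1\cup\Gamma_2$ together with an extra Wilson line colored by $V_\mu$ along the identified interval, whose two ends continue as outer edges (with representations $V_\mu$ and $V_\mu^*$); the vector at an identified vertex is the tensor product of the old vectors and of the canonical invariants of $V_\mu\otimes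 V_\mu^*$ for the ends of the new line. This is again a surface with an open Wilson graph with invariant vertex vectors, and, with $h$ the holonomy along $e_1$ (so $h^{-1}$ along $e_2$), $$\int_G Z(\Sigma_1;h)\otimes\pi_\mu(h)\otimes Z(\Sigma_2;h^{-1})\,dh=Z(\Sigma_1\cup_{e_1\simeq e_2}\Sigma_2).$$ (2) Likewise, for two distinct intervals $e,e'$ of the boundary of one surface $\Sigma$, in particular two neighboring ones, $\int_G\pi_\mu(h)\otimes Z(\Sigma;h,h^{-1})\,dh=Z(\Sigma/e\simeq e')$, where $h$ is the holonomy along $e$, $h^{-1}$ that along $e'$, and the glued surface carries an extra Wilson line colored by $V_\mu$ with two outer ends. (3) If, in (1), an outer edge of $\Gamma_2$ with representation $V_\mu$ is attached to the starting point of $e_2$, then $$\int_G Z(\Sigma_1;h)\otimes\bigl(\pi_\mu(h)Z(\Sigma_2;h^{-1})\bigr)\,dh=Z(\Sigma_1\cup_{e_1\simeq e_2}\Sigma_2),$$ where $\pi_\mu(h)$ acts on the factor $V_\mu$ of this outer edge and, on the right, the extra Wilson line colored by $V_\mu$ is the prolongation of this outer edge along the identified interval; it leaves the surface at the vertex where $e_1$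 starts. The same holds, with $\int_G\pi_\mu(h)Z(\Sigma;h,h^{-1})\,dh$, for two distinct intervals $e,e'$ (in particular two neighboring ones) of the boundary of one surface and an outer edge with representation $V_\mu$ attached to the starting point of $e'$. The glued graphs again have invariant vertex vectors. -/

import Mathlib

open MeasureTheory
open scoped Manifold ContDiff

namespace YangMills

/-! ### Representations of a Lie group, characters, the quadratic Casimir -/

section Representations

variable (d : ℕ) (G : Type*) [TopologicalSpace G] [ChartedSpace (EuclideanSpace ℝ (Fin d)) G]
  [Group G]

/-- A finite dimensional complex representation of the `d`-dimensional Lie group `G`, written in a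
basis: a smooth homomorphism to invertible complex matrices. -/
structure LieRep where
  /-- the dimension of the representation space `ℂ ^ dim` -/
  dim : ℕ
  /-- the representing matrices -/
  mat : G →* Matrix (Fin dim) (Fin dim) ℂ
  smooth : ∀ i j, ContMDiff (𝓡 d) 𝓘(ℝ, ℂ) ∞ (fun g => mat g i j)

namespace LieRep

variable {d G}

/-- The representation as a linear action on `ℂ ^ dim`. -/
noncomputable def toRepresentation (ρ : LieRep d G) : Representation ℂ G (Fin ρ.dim → ℂ) :=
  ((Matrix.toLinAlgEquiv' : Matrix (Fin ρ.dim) (Fin ρ.dim) ℂ ≃ₐ[ℂ] _) :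
    Matrix (Fin ρ.dim) (Fin ρ.dim) ℂ →* Module.End ℂ (Fin ρ.dim → ℂ)).comp ρ.mat

/-- The character `χ(g) = Tr ρ(g)`. -/
noncomputable def character (ρ : LieRep d G) (g : G) : ℂ := (ρ.mat g).trace

variable [LieGroup (𝓡 d) ∞ G]

/-- The dual (contragredient) representation, in the dual basis. -/
noncomputable def dual (ρ : LieRep d G) : LieRep d G where
  dim := ρ.dim
  mat :=
    { toFun := fun g => (ρ.mat g⁻¹).transpose
      map_one' := by simp
      map_mul' := fun a b => by simp [Matrix.transpose_mul] }
  smooth := fun i j => (ρ.smooth j i).comp (contMDiff_inv (𝓡 d) ∞)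

/-- `V ^ +` is `V` and `V ^ -` is the dual of `V`; the sign `+` is `true`. -/
noncomputable def signed (ρ : LieRep d G) : Bool → LieRep d G
  | true => ρ
  | false => ρ.dual

end LieRep

/-- Irreducible finite dimensional representations, up to isomorphism. -/
instance irrSetoid : Setoid {ρ : LieRep d G // ρ.toRepresentation.IsIrreducible} where
  r ρ σ := Nonempty (ρ.1.toRepresentation.Equiv σ.1.toRepresentation)
  iseqv :=
    { refl := fun ρ => ⟨Representation.Equiv.refl ρ.1.toRepresentation⟩
      symm := fun ⟨f⟩ => ⟨f.symm⟩
      trans := fun ⟨f⟩ ⟨f'⟩ => ⟨f.trans f'⟩ }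

/-- The set of isomorphism classes `λ` of irreducible representations (for compact connected
groups these are labelled by highest weights). -/
def Irr := Quotient (irrSetoid d G)

variable {d G}

/-- A chosen representation `V_λ` in the class `λ`. -/
noncomputable def Irr.rep (l : Irr d G) : LieRep d G := (Quotient.out l).1

variable [LieGroup (𝓡 d) ∞ G]

/-- A smooth Lie group has the regularity needed for the Lie bracket on its tangent space. -/
instance lieGroupMinSmoothness : LieGroup (𝓡 d) (minSmoothness ℝ 3) G :=
  LieGroup.of_le (n := ∞) (by
    rw [minSmoothness_of_isRCLikeNormedField]
    exact ENat.LEInfty.out)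

/-- The Lie algebra of `G` is finite dimensional. -/
instance lieAlgebraFinite : FiniteDimensional ℝ (GroupLieAlgebra (𝓡 d) G) :=
  inferInstanceAs (FiniteDimensional ℝ (EuclideanSpace ℝ (Fin d)))

/-- The derivative at the identity of a representation, as a map from the Lie algebra
to matrices. -/
noncomputable def LieRep.deriv (ρ : LieRep d G) (X : GroupLieAlgebra (𝓡 d) G) :
    Matrix (Fin ρ.dim) (Fin ρ.dim) ℂ :=
  fun i j => (mfderiv (𝓡 d) 𝓘(ℝ, ℂ) (fun g => ρ.mat g i j) (1 : G) X : ℂ)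

variable (d G) in
/-- The Gram matrix of the Killing form in a basis of the Lie algebra. -/
noncomputable def killingMatrix :
    Matrix (Fin (Module.finrank ℝ (GroupLieAlgebra (𝓡 d) G)))
      (Fin (Module.finrank ℝ (GroupLieAlgebra (𝓡 d) G))) ℝ :=
  fun a b => killingForm ℝ (GroupLieAlgebra (𝓡 d) G)
    (Module.finBasis ℝ (GroupLieAlgebra (𝓡 d) G) a)
    (Module.finBasis ℝ (GroupLieAlgebra (𝓡 d) G) b)

/-- The action on a representation of the quadratic Casimir element
`∑ a b, (K⁻¹)_{ab} X_a X_b`, where `X_a` is a basis of the Lie algebra and `K` is the Gram matrix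
of the Killing form in this basis. -/
noncomputable def LieRep.casimir (ρ : LieRep d G) : Matrix (Fin ρ.dim) (Fin ρ.dim) ℂ :=
  ∑ a, ∑ b, (((killingMatrix d G)⁻¹ a b : ℝ) : ℂ) •
    (ρ.deriv (Module.finBasis ℝ (GroupLieAlgebra (𝓡 d) G) a) *
      ρ.deriv (Module.finBasis ℝ (GroupLieAlgebra (𝓡 d) G) b))

/-- The value `c₂(λ)` of the quadratic Casimir element on `V_λ`: the Casimir acts on `V_λ` by
a real scalar, which is its trace divided by `dim V_λ`. -/
noncomputable def Irr.c₂ (l : Irr d G) : ℝ := (l.rep.casimir.trace / l.rep.dim).re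

/-- The `λ`-th term `χ_λ(x) (dim λ)^(1 - 2 genus) exp(- c₂(λ) A)` of a region's partition
function. -/
noncomputable def regionTerm (genus : ℕ) (A : ℝ) (x : G) (l : Irr d G) : ℂ :=
  l.rep.character x * (l.rep.dim : ℂ) ^ (1 - 2 * (genus : ℤ)) *
    (Real.exp (-(l.c₂ * A)) : ℂ)

variable (d) in
/-- The partition function of a region of area `A` with one boundary circle, of the given genus
(after closing it by a disc), with boundary holonomy `x`. -/
noncomputable def regionZ (genus : ℕ) (A : ℝ) (x : G) : ℂ :=
  ∑' l : Irr d G, regionTerm genus A x l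

end Representations

/-! ### Surfaces cut into regions by a graph -/

/-- A compact oriented surface, possibly with boundary and possibly disconnected, cut into
finitely many regions by an embedded graph.  Each region is a connected oriented surface with one
boundary circle, and this circle is a polygon: a cyclic word (up to rotation) of *sides*, read
counterclockwise.  A side is either a boundary interval `Sum.inr b` of the surface (oriented by
the orientation of the surface), or one of the two sides of an oriented graph edge `e`:
`Sum.inl (e, true)` runs along `e` and `Sum.inl (e, false)` runs against `e`.  Every side occurs
exactly once.  The surface is obtained from the regions by identifying the two sides of every
graph edge; an empty word stands for a closed component without graph.  Every region
carries an area. -/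
structure CellSurface where
  /-- the edges of the graph that lie in the surface -/
  Edge : Type
  /-- the intervals into which the boundary vertices cut the boundary of the surface -/
  Bdry : Type
  /-- the connected components of the complement of the graph -/
  Region : Type
  [fintypeEdge : Fintype Edge]
  [fintypeBdry : Fintype Bdry]
  [fintypeRegion : Fintype Region]
  /-- the boundary word of a region -/
  bd : Region → List ((Edge × Bool) ⊕ Bdry)
  bd_nodup : ∀ r, (bd r).Nodup
  bd_unique : ∀ s, ∃! r, s ∈ bd r
  /-- the genus of a region, after closing it by a disc -/
  genus : Region → ℕ
  /-- the area of a region -/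
  area : Region → ℝ
  area_pos : ∀ r, 0 < area r

namespace CellSurface

attribute [instance] fintypeEdge fintypeBdry fintypeRegion

/-- The sides of the regions. -/
abbrev Side (S : CellSurface) : Type := (S.Edge × Bool) ⊕ S.Bdry

/-- The side `t` comes directly after the side `s` in the cyclic boundary word of a region. -/
def Follows (S : CellSurface) (s t : S.Side) : Prop :=
  ∃ r l, (S.bd r).IsRotated (s :: l) ∧ (l ++ [s]).head? = some t

/-- `s` is the reverse of a side (of a graph edge) which is followed by `t`. -/
def SameStart (S : CellSurface) (s t : S.Side) : Prop :=
  ∃ (e : S.Edge) (b : Bool), s = Sum.inl (e, !b) ∧ S.Follows (Sum.inl (e, b)) t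

/-- The vertices: starting points of sides, where the end point of a side is the starting point of
the next side, and also the starting point of the reversed side if the side belongs to a graph
edge. -/
def Vertex (S : CellSurface) : Type := Quot S.SameStart

/-- The vertex at which a side starts. -/
def src (S : CellSurface) (s : S.Side) : S.Vertex := Quot.mk _ s

instance (S : CellSurface) : Finite S.Vertex := inferInstanceAs (Finite (Quot S.SameStart))

noncomputable instance (S : CellSurface) : Fintype S.Vertex := Fintype.ofFinite _

theorem Follows.map {S T : CellSurface} (f : S.Side → T.Side) (ρ : S.Region → T.Region)
    (hf : ∀ r, T.bd (ρ r) = (S.bd r).map f) {s t : S.Side} (h : S.Follows s t) :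
    T.Follows (f s) (f t) := by
  obtain ⟨r, l, h1, h2⟩ := h
  refine ⟨ρ r, l.map f, ?_, ?_⟩
  · rw [hf]
    simpa using h1.map f
  · have : l.map f ++ [f s] = (l ++ [s]).map f := by simp
    rw [this, List.head?_map, h2]
    rfl

/-! #### Disjoint union -/

/-- The sides of the first surface, in the disjoint union. -/
def inlSide (S T : CellSurface) : S.Side → ((S.Edge ⊕ T.Edge) × Bool) ⊕ (S.Bdry ⊕ T.Bdry)
  | Sum.inl p => Sum.inl (Sum.inl p.1, p.2)
  | Sum.inr b => Sum.inr (Sum.inl b)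

/-- The sides of the second surface, in the disjoint union. -/
def inrSide (S T : CellSurface) : T.Side → ((S.Edge ⊕ T.Edge) × Bool) ⊕ (S.Bdry ⊕ T.Bdry)
  | Sum.inl p => Sum.inl (Sum.inr p.1, p.2)
  | Sum.inr b => Sum.inr (Sum.inr b)

theorem inlSide_injective (S T : CellSurface) : Function.Injective (inlSide S T) := by
  rintro (⟨a, b⟩ | a) (⟨a', b'⟩ | a') h <;> simp_all [inlSide]

theorem inrSide_injective (S T : CellSurface) : Function.Injective (inrSide S T) := by
  rintro (⟨a, b⟩ | a) (⟨a', b'⟩ | a') h <;> simp_all [inrSide]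

theorem inlSide_ne_inrSide (S T : CellSurface) (s : S.Side) (t : T.Side) :
    inlSide S T s ≠ inrSide S T t := by
  rcases s with ⟨a, b⟩ | a <;> rcases t with ⟨a', b'⟩ | a' <;> simp [inlSide, inrSide]

theorem side_union_cases (S T : CellSurface)
    (s : ((S.Edge ⊕ T.Edge) × Bool) ⊕ (S.Bdry ⊕ T.Bdry)) :
    (∃ a, inlSide S T a = s) ∨ (∃ a, inrSide S T a = s) := by
  rcases s with ⟨e | e, b⟩ | b | b
  · exact Or.inl ⟨Sum.inl (e, b), rfl⟩
  · exact Or.inr ⟨Sum.inl (e, b), rfl⟩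
  · exact Or.inl ⟨Sum.inr b, rfl⟩
  · exact Or.inr ⟨Sum.inr b, rfl⟩

/-- The disjoint union of two surfaces. -/
def union (S T : CellSurface) : CellSurface where
  Edge := S.Edge ⊕ T.Edge
  Bdry := S.Bdry ⊕ T.Bdry
  Region := S.Region ⊕ T.Region
  bd := Sum.elim (fun r => (S.bd r).map (inlSide S T)) (fun r => (T.bd r).map (inrSide S T))
  bd_nodup := by
    rintro (r | r)
    · exact (S.bd_nodup r).map (inlSide_injective S T)
    · exact (T.bd_nodup r).map (inrSide_injective S T)
  bd_unique := by
    intro s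
    rcases side_union_cases S T s with ⟨a, rfl⟩ | ⟨a, rfl⟩
    · obtain ⟨r, hr, hu⟩ := S.bd_unique a
      refine ⟨Sum.inl r, List.mem_map_of_mem hr, ?_⟩
      rintro (r' | r') h
      · obtain ⟨a', h1, h2⟩ := List.mem_map.1 h
        rw [hu r' (inlSide_injective S T h2 ▸ h1)]
      · obtain ⟨a', h1, h2⟩ := List.mem_map.1 h
        exact absurd h2.symm (inlSide_ne_inrSide S T _ _)
    · obtain ⟨r, hr, hu⟩ := T.bd_unique a
      refine ⟨Sum.inr r, List.mem_map_of_mem hr, ?_⟩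
      rintro (r' | r') h
      · obtain ⟨a', h1, h2⟩ := List.mem_map.1 h
        exact absurd h2 (inlSide_ne_inrSide S T _ _)
      · obtain ⟨a', h1, h2⟩ := List.mem_map.1 h
        rw [hu r' (inrSide_injective S T h2 ▸ h1)]
  genus := Sum.elim S.genus T.genus
  area := Sum.elim S.area T.area
  area_pos := by
    rintro (r | r)
    · exact S.area_pos r
    · exact T.area_pos r

/-- A vertex of the first surface, in the disjoint union. -/
def inlVertex (S T : CellSurface) : S.Vertex → (S.union T).Vertex :=
  Quot.map (inlSide S T) (by
    rintro s t ⟨e, b, rfl, h⟩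
    exact ⟨Sum.inl e, b, rfl, h.map (T := S.union T) (inlSide S T) Sum.inl (fun _ => rfl)⟩)

/-- A vertex of the second surface, in the disjoint union. -/
def inrVertex (S T : CellSurface) : T.Vertex → (S.union T).Vertex :=
  Quot.map (inrSide S T) (by
    rintro s t ⟨e, b, rfl, h⟩
    exact ⟨Sum.inr e, b, rfl, h.map (T := S.union T) (inrSide S T) Sum.inr (fun _ => rfl)⟩)

/-! #### Gluing two boundary intervals -/

section Glue

variable (S : CellSurface) (e e' : S.Bdry)

open Classical in
/-- What becomes of a side when the boundary intervals `e` and `e'` are identified: they become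
the two sides of a new graph edge `none`, which is oriented along `e'` and against `e`. -/
noncomputable def glueSide :
    S.Side → (Option S.Edge × Bool) ⊕ {b : S.Bdry // b ≠ e ∧ b ≠ e'}
  | Sum.inl p => Sum.inl (some p.1, p.2)
  | Sum.inr b =>
    if h : b = e then Sum.inl (none, false)
    else if h' : b = e' then Sum.inl (none, true)
    else Sum.inr ⟨b, h, h'⟩

theorem glueSide_injective : Function.Injective (S.glueSide e e') := by
  rintro (⟨a, b⟩ | a) (⟨a', b'⟩ | a') h <;> simp only [glueSide] at h
  · simpa using h
  · split_ifs at h <;> simp at h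
  · split_ifs at h <;> simp at h
  · split_ifs at h <;> simp_all

theorem glueSide_left : S.glueSide e e' (Sum.inr e) = Sum.inl (none, false) := by
  simp [glueSide]

variable {e e'}

theorem glueSide_right (hne : e ≠ e') :
    S.glueSide e e' (Sum.inr e') = Sum.inl (none, true) := by
  simp [glueSide, hne.symm]

theorem glueSide_surjective (hne : e ≠ e') : Function.Surjective (S.glueSide e e') := by
  rintro (⟨_ | a, _ | _⟩ | ⟨b, h, h'⟩)
  · exact ⟨Sum.inr e, S.glueSide_left e e'⟩
  · exact ⟨Sum.inr e', S.glueSide_right hne⟩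
  · exact ⟨Sum.inl (a, false), rfl⟩
  · exact ⟨Sum.inl (a, true), rfl⟩
  · exact ⟨Sum.inr b, by simp [glueSide, h, h']⟩

/-- The surface obtained from `S` by identifying the boundary interval `e` with the boundary
interval `e'`, reversing orientation; the common image becomes a new edge of the graph. -/
noncomputable def glue (hne : e ≠ e') : CellSurface where
  Edge := Option S.Edge
  Bdry := {b : S.Bdry // b ≠ e ∧ b ≠ e'}
  Region := S.Region
  fintypeBdry := Fintype.ofFinite _
  bd := fun r => (S.bd r).map (S.glueSide e e')
  bd_nodup := fun r => (S.bd_nodup r).map (S.glueSide_injective e e')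
  bd_unique := by
    intro s
    obtain ⟨a, rfl⟩ := S.glueSide_surjective hne s
    obtain ⟨r, hr, hu⟩ := S.bd_unique a
    refine ⟨r, List.mem_map_of_mem hr, fun r' h => ?_⟩
    obtain ⟨a', h1, h2⟩ := List.mem_map.1 h
    exact hu r' (S.glueSide_injective e e' h2 ▸ h1)
  genus := S.genus
  area := S.area
  area_pos := S.area_pos

/-- The image of a vertex in the glued surface. -/
noncomputable def glueVertex (hne : e ≠ e') : S.Vertex → (S.glue hne).Vertex :=
  Quot.map (S.glueSide e e') (by
    rintro s t ⟨a, b, rfl, h⟩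
    exact ⟨some a, b, rfl, h.map (T := S.glue hne) (S.glueSide e e') id (fun _ => rfl)⟩)

theorem glueVertex_left (hne : e ≠ e') :
    S.glueVertex hne (S.src (Sum.inr e)) = (S.glue hne).src (Sum.inl (none, false)) :=
  congrArg (Quot.mk _) (S.glueSide_left e e')

theorem glueVertex_right (hne : e ≠ e') :
    S.glueVertex hne (S.src (Sum.inr e')) = (S.glue hne).src (Sum.inl (none, true)) :=
  congrArg (Quot.mk _) (S.glueSide_right hne)

open Classical in
/-- The boundary holonomies of the surface before gluing, when the boundary intervals which remain
have holonomies `g` and the identified interval has holonomy `h` along `e`, hence `h⁻¹`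
along `e'`. -/
noncomputable def cut {G : Type*} [Group G] (hne : e ≠ e') (g : (S.glue hne).Bdry → G) (h : G)
    (b : S.Bdry) : G :=
  if hb : b = e then h else if hb' : b = e' then h⁻¹ else g ⟨b, hb, hb'⟩

end Glue

end CellSurface

/-! ### Open Wilson graphs -/

section Wilson

variable (d : ℕ) (G : Type*) [TopologicalSpace G] [ChartedSpace (EuclideanSpace ℝ (Fin d)) G]
  [Group G]

/-- The edges of an open graph and their colors: the edges in the surface are those of `S`, and the
outer edges are attached to vertices of `S`. -/
structure Coloring (S : CellSurface) where
  /-- the outer edges -/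
  Leg : Type
  [fintypeLeg : Fintype Leg]
  /-- the vertex to which an outer edge is attached -/
  legVertex : Leg → S.Vertex
  /-- the representation which colors an edge in the surface -/
  color : S.Edge → LieRep d G
  /-- the representation of an outer edge as seen from its vertex: `V` for an outer edge colored
  by `V` and oriented outward, the dual of `V` for one oriented inward -/
  legRep : Leg → LieRep d G

attribute [instance] Coloring.fintypeLeg

namespace Coloring

variable {d G} {S : CellSurface}

/-- Half-edges of the graph: the beginning `(e, true)` and the end `(e, false)` of every edge `e`
in the surface, and the outer edges. -/
abbrev Half (C : Coloring d G S) : Type := (S.Edge × Bool) ⊕ C.Leg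

/-- The vertex to which a half-edge is attached. -/
def vertexOf (C : Coloring d G S) : C.Half → S.Vertex
  | Sum.inl p => S.src (Sum.inl p)
  | Sum.inr l => C.legVertex l

variable [LieGroup (𝓡 d) ∞ G]

/-- The representation attached to a half-edge: `V` at the beginning of an edge colored by `V`, the
dual of `V` at its end. -/
noncomputable def halfRep (C : Coloring d G S) : C.Half → LieRep d G
  | Sum.inl p => (C.color p.1).signed p.2
  | Sum.inr l => C.legRep l

/-- Multi-indices for the tensor product of the representations at all half-edges adjacent to the
vertex `v`. -/
abbrev VertexIndex (C : Coloring d G S) (v : S.Vertex) : Type :=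
  ∀ k : {k : C.Half // C.vertexOf k = v}, Fin (C.halfRep k.1).dim

/-- Multi-indices for the tensor product of the representations of all outer edges. -/
abbrev LegIndex (C : Coloring d G S) : Type := ∀ l : C.Leg, Fin (C.legRep l).dim

end Coloring

variable [LieGroup (𝓡 d) ∞ G]

/-- An open graph on `S`, with colored edges, and at every vertex `v` a vector in the tensor product
of the representations at the half-edges adjacent to `v`, given by its coordinates.  Invariance of
these vectors is the separate predicate `IsInvariant`. -/
structure OpenGraph (S : CellSurface) extends Coloring d G S where
  /-- the coordinates of the vector at the vertex `v` -/
  tensor : ∀ v : S.Vertex, toColoring.VertexIndex v → ℂ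

namespace OpenGraph

variable {d G} {S T : CellSurface}

noncomputable instance (Γ : OpenGraph d G S) (v : S.Vertex) :
    Fintype {k : Γ.Half // Γ.vertexOf k = v} := Fintype.ofFinite _

open Classical in
/-- The vectors at the vertices are `G`-invariant; then the open graph is an open Wilson
graph. -/
def IsInvariant (Γ : OpenGraph d G S) : Prop :=
  ∀ (v : S.Vertex) (g : G) (x : Γ.VertexIndex v),
    ∑ y : Γ.VertexIndex v,
      (∏ k, (Γ.halfRep k.1).mat g (x k) (y k)) * Γ.tensor v y = Γ.tensor v x

/-- A multi-index for all half-edges, from one for the edges in the surface and one for the outer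
edges. -/
def joinIndex (Γ : OpenGraph d G S) (x : ∀ p : S.Edge × Bool, Fin (Γ.halfRep (Sum.inl p)).dim)
    (y : Γ.LegIndex) : ∀ k : Γ.Half, Fin (Γ.halfRep k).dim
  | Sum.inl p => x p
  | Sum.inr l => y l

open Classical in
/-- The Wilson graph function: the contraction of the vectors at the vertices with the holonomies
along the edges in the surface.  Holonomies multiply from left to right along paths, so that under
gauge transformations the holonomy `h` of an edge becomes `k_beginning * h * k_end⁻¹`; hence `h⁻¹`
is the parallel transport from the beginning to the end of the edge, and the contraction along an
edge pairs the dual of `V` at the end with `V` at the beginning through `π_V(h⁻¹)`.  The indices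
at the outer edges stay free. -/
noncomputable def wilson (Γ : OpenGraph d G S) (h : S.Edge → G) (y : Γ.LegIndex) : ℂ :=
  ∑ x : ∀ p : S.Edge × Bool, Fin (Γ.halfRep (Sum.inl p)).dim,
    (∏ v : S.Vertex, Γ.tensor v (fun k => Γ.joinIndex x y k.1)) *
      ∏ e : S.Edge, (Γ.color e).mat (h e)⁻¹ (x (e, false)) (x (e, true))

end OpenGraph

/-- The holonomy along a side of a region: `h e` along the edge `e`, its inverse against `e`,
and `g b` along the boundary interval `b`. -/
def CellSurface.sideHol {G : Type*} [Group G] (S : CellSurface) (g : S.Bdry → G)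
    (h : S.Edge → G) : S.Side → G
  | Sum.inl (e, true) => h e
  | Sum.inl (e, false) => (h e)⁻¹
  | Sum.inr b => g b

/-- The holonomy around a region: the product over its boundary word. -/
def CellSurface.regionHol {G : Type*} [Group G] (S : CellSurface) (g : S.Bdry → G)
    (h : S.Edge → G) (r : S.Region) : G :=
  ((S.bd r).map (S.sideHol g h)).prod

/-- The Haar measure of total mass one on a compact group. -/
noncomputable def haarProb (G : Type*) [TopologicalSpace G] [Group G] [IsTopologicalGroup G]
    [CompactSpace G] [MeasurableSpace G] [BorelSpace G] : Measure G :=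
  Measure.haarMeasure ⊤

namespace OpenGraph

variable {d G} {S T : CellSurface}

/-- The integrand of the partition function: boundary holonomies `g`, holonomies `h` of the edges
in the surface, component `y` in the tensor product of the representations of the outer edges. -/
noncomputable def integrand (Γ : OpenGraph d G S) (g : S.Bdry → G) (y : Γ.LegIndex)
    (h : S.Edge → G) : ℂ :=
  (∏ r : S.Region, regionZ d (S.genus r) (S.area r) (S.regionHol g h r)) * Γ.wilson h y

/-- The partition function of two-dimensional Yang-Mills theory on the surface `S` with the open
Wilson graph `Γ`: a function of the boundary holonomies `g` with values in the tensor product of the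
representations of the outer edges; `y` selects a component. -/
noncomputable def Z [IsTopologicalGroup G] [CompactSpace G] [MeasurableSpace G] [BorelSpace G]
    (Γ : OpenGraph d G S) (g : S.Bdry → G) (y : Γ.LegIndex) : ℂ :=
  ∫ h : S.Edge → G, Γ.integrand g y h ∂(Measure.pi fun _ => haarProb G)

/-- The sums and integrals which define the partition function converge absolutely. -/
def Converges [IsTopologicalGroup G] [CompactSpace G] [MeasurableSpace G] [BorelSpace G]
    (Γ : OpenGraph d G S) : Prop :=
  (∀ (r : S.Region) (x : G),
    Summable fun l : Irr d G => regionTerm (S.genus r) (S.area r) x l) ∧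
  ∀ (g : S.Bdry → G) (y : Γ.LegIndex),
    Integrable (Γ.integrand g y) (Measure.pi fun _ => haarProb G)

/-! #### Disjoint union -/

/-- The disjoint union of two colorings. -/
def unionColoring (Γ : Coloring d G S) (Δ : Coloring d G T) : Coloring d G (S.union T) where
  Leg := Γ.Leg ⊕ Δ.Leg
  legVertex := Sum.elim (fun l => S.inlVertex T (Γ.legVertex l))
    (fun l => S.inrVertex T (Δ.legVertex l))
  color := Sum.elim Γ.color Δ.color
  legRep := Sum.elim Γ.legRep Δ.legRep

/-- The part of a multi-index which belongs to a vertex of the first graph. -/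
def unionIndexLeft (Γ : Coloring d G S) (Δ : Coloring d G T) (v : (S.union T).Vertex)
    (x : (unionColoring Γ Δ).VertexIndex v) (u : S.Vertex) (hu : S.inlVertex T u = v) :
    Γ.VertexIndex u
  | ⟨Sum.inl p, hp⟩ => x ⟨Sum.inl (Sum.inl p.1, p.2), by rw [← hu, ← hp]; rfl⟩
  | ⟨Sum.inr l, hl⟩ => x ⟨Sum.inr (Sum.inl l), by rw [← hu, ← hl]; rfl⟩

/-- The part of a multi-index which belongs to a vertex of the second graph. -/
def unionIndexRight (Γ : Coloring d G S) (Δ : Coloring d G T) (v : (S.union T).Vertex)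
    (x : (unionColoring Γ Δ).VertexIndex v) (u : T.Vertex) (hu : S.inrVertex T u = v) :
    Δ.VertexIndex u
  | ⟨Sum.inl p, hp⟩ => x ⟨Sum.inl (Sum.inr p.1, p.2), by rw [← hu, ← hp]; rfl⟩
  | ⟨Sum.inr l, hl⟩ => x ⟨Sum.inr (Sum.inr l), by rw [← hu, ← hl]; rfl⟩

open Classical in
/-- The disjoint union of two open graphs, on the disjoint union of the surfaces. -/
noncomputable def union (Γ : OpenGraph d G S) (Δ : OpenGraph d G T) :
    OpenGraph d G (S.union T) where
  toColoring := unionColoring Γ.toColoring Δ.toColoring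
  tensor := fun v x =>
    (∏ u : {u : S.Vertex // S.inlVertex T u = v},
      Γ.tensor u.1 (unionIndexLeft Γ.toColoring Δ.toColoring v x u.1 u.2)) *
    ∏ u : {u : T.Vertex // S.inrVertex T u = v},
      Δ.tensor u.1 (unionIndexRight Γ.toColoring Δ.toColoring v x u.1 u.2)

theorem union_legVertex_right (Γ : OpenGraph d G S) (Δ : OpenGraph d G T) {l : Δ.Leg} {b : T.Bdry}
    (hl : Δ.legVertex l = T.src (Sum.inr b)) :
    (Γ.union Δ).legVertex (Sum.inr l) = (S.union T).src (Sum.inr (Sum.inr b)) :=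
  congrArg (S.inrVertex T) hl

/-! #### Gluing along a new Wilson line with open ends -/

section Glue

variable {e e' : S.Bdry}

/-- The new edge `none` is colored by `μ`.  There are two new outer edges: `false`, with
representation `V_μ`, at the vertex where `e` starts, and `true`, with the dual representation, at
the vertex where `e'` starts. -/
noncomputable def glueColoring (Γ : Coloring d G S) (hne : e ≠ e') (μ : LieRep d G) :
    Coloring d G (S.glue hne) where
  Leg := Γ.Leg ⊕ Bool
  legVertex := Sum.elim (fun l => S.glueVertex hne (Γ.legVertex l))
    (fun b => (S.glue hne).src (Sum.inl (none, b)))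
  color := fun a => a.elim μ Γ.color
  legRep := Sum.elim Γ.legRep (fun b => μ.signed (!b))

/-- The part of a multi-index which belongs to a vertex of the graph before gluing. -/
def glueIndex (Γ : Coloring d G S) (hne : e ≠ e') (μ : LieRep d G) (v : (S.glue hne).Vertex)
    (x : (glueColoring Γ hne μ).VertexIndex v) (u : S.Vertex) (hu : S.glueVertex hne u = v) :
    Γ.VertexIndex u
  | ⟨Sum.inl p, hp⟩ => x ⟨Sum.inl (some p.1, p.2), by rw [← hu, ← hp]; rfl⟩
  | ⟨Sum.inr l, hl⟩ => x ⟨Sum.inr (Sum.inl l), by rw [← hu, ← hl]; rfl⟩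

open Classical in
/-- Gluing the boundary interval `e` to `e'` and inserting along the image a Wilson line colored by
`V_μ` whose two ends continue as outer edges.  The vector at a vertex of the glued surface is the
tensor product of the vectors at the vertices which are identified there, times, for each end of
the new line at this vertex, the canonical invariant vector in the tensor product of `V_μ` and its
dual. -/
noncomputable def glue (Γ : OpenGraph d G S) (hne : e ≠ e') (μ : LieRep d G) :
    OpenGraph d G (S.glue hne) where
  toColoring := glueColoring Γ.toColoring hne μ
  tensor := fun v x =>
    (∏ u : {u : S.Vertex // S.glueVertex hne u = v},
      Γ.tensor u.1 (glueIndex Γ.toColoring hne μ v x u.1 u.2)) *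
    ∏ b : Bool,
      if hv : (S.glue hne).src (Sum.inl (none, b)) = v then
        if (x ⟨Sum.inl (none, b), hv⟩).val = (x ⟨Sum.inr (Sum.inr b), hv⟩).val then 1 else 0
      else 1

/-! #### Gluing along a new Wilson line which prolongs an outer edge -/

open Classical in
/-- The outer edge `l₀` is moved from the vertex where `e'` starts to the vertex where `e` starts;
the new edge `none` gets the representation of `l₀`. -/
noncomputable def transportColoring (Γ : Coloring d G S) (hne : e ≠ e') (l₀ : Γ.Leg) :
    Coloring d G (S.glue hne) where
  Leg := Γ.Leg
  legVertex := fun l => if l = l₀ then (S.glue hne).src (Sum.inl (none, false))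
    else S.glueVertex hne (Γ.legVertex l)
  color := fun a => a.elim (Γ.legRep l₀) Γ.color
  legRep := Γ.legRep

open Classical in
/-- The part of a multi-index which belongs to a vertex of the graph before gluing; the beginning
of the new edge takes the place of the outer edge `l₀`. -/
noncomputable def transportIndex (Γ : Coloring d G S) (hne : e ≠ e') (l₀ : Γ.Leg)
    (hl₀ : Γ.legVertex l₀ = S.src (Sum.inr e')) (v : (S.glue hne).Vertex)
    (x : (transportColoring Γ hne l₀).VertexIndex v) (u : S.Vertex)
    (hu : S.glueVertex hne u = v) : Γ.VertexIndex u
  | ⟨Sum.inl p, hp⟩ => x ⟨Sum.inl (some p.1, p.2), by rw [← hu, ← hp]; rfl⟩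
  | ⟨Sum.inr l, hl⟩ =>
    if h : l = l₀ then
      Fin.cast (by subst h; rfl) (x ⟨Sum.inl (none, true), by
        subst h
        rw [← hu, ← hl]
        exact (S.glueVertex_right hne).symm.trans (congrArg _ hl₀.symm)⟩)
    else x ⟨Sum.inr l, by rw [← hu, ← hl]; exact if_neg h⟩

open Classical in
/-- Gluing the boundary interval `e` to `e'` and letting the outer edge `l₀`, attached to the
vertex where `e'` starts, run along the image to the vertex where `e` starts and leave the
surface there. -/
noncomputable def glueTransport (Γ : OpenGraph d G S) (hne : e ≠ e') (l₀ : Γ.Leg)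
    (hl₀ : Γ.legVertex l₀ = S.src (Sum.inr e')) : OpenGraph d G (S.glue hne) where
  toColoring := transportColoring Γ.toColoring hne l₀
  tensor := fun v x =>
    (∏ u : {u : S.Vertex // S.glueVertex hne u = v},
      Γ.tensor u.1 (transportIndex Γ.toColoring hne l₀ hl₀ v x u.1 u.2)) *
    if hv : (S.glue hne).src (Sum.inl (none, false)) = v then
      if (x ⟨Sum.inl (none, false), hv⟩).val =
        (x ⟨Sum.inr l₀, (if_pos rfl).trans hv⟩).val then 1 else 0
    else 1

end Glue

end OpenGraph

end Wilson

end YangMills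

open YangMills

namespace YangMills

/-! ### Haar measure of a compact group -/

section Haar

variable {G : Type*} [TopologicalSpace G] [Group G] [IsTopologicalGroup G] [CompactSpace G]
  [MeasurableSpace G] [BorelSpace G]

/-! Gluing is Fubini's theorem. Identifying two boundary intervals turns their common holonomy into
the holonomy of one more edge. The boundary words of the regions are only relabelled
(`CellSurface.regionHol_glue`), and the Wilson graph function acquires one matrix of `π_μ`, because
the canonical vectors at the ends of the new line are Kronecker deltas (`OpenGraph.glue_wilson`,
`OpenGraph.glueTransport_wilson`). The integral over all edges is then an iterated integral
(`integral_option`). The new edge runs against `e`, so its holonomy is the inverse of the gluing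
variable, which the inversion invariance of Haar measure absorbs. Two surfaces reduce to one by
disjoint union, where all factors split. The glued vertex vectors are invariant because they are
tensor products of invariant vectors (`TensorFixed.merge`).

Fubini needs an integrable integrand. The integrand is continuous on a compact space as soon as the
series `Z_D` converge uniformly, and since a character is bounded by its dimension it suffices to
sum `dim² exp(-c₂ A)`. This follows from a polynomial bound in `Λ` on `N = ∑ dim²` over irreducibles
with `c₂ ≤ Λ` (`exists_sum_dim_sq_le`), obtained without highest weights. Put `f = ∑ dim · χ` and
let `K` be the set where every `Re χ ≥ dim / 2`. Schur orthogonality gives `∫ |f|² = N`, while `|f|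
≥ N / 2` on `K`, so Chebyshev yields `N · vol K ≤ 4`. Conversely, `K` contains all quotients `g'⁻¹
g` of elements in one small cell of a chart; with `m ^ d` cells and `m²` at least a constant times
`Λ`, translates of `K` cover a fixed neighborhood, so `vol K` is at least a constant over `m ^ d`.

That small cells suffice rests on a Lipschitz bound for unitary models in which only the Casimir and
the dimension enter. Derivatives of unitary representations are skew-Hermitian. Applied to the
adjoint representation, made unitary by averaging, this shows that the Killing form is negative
semidefinite with central null vectors, hence negative definite for a simple Lie algebra. The
Casimir is then minus a sum of squares of a basis, and its trace is the sum of the squared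
Hilbert–Schmidt norms of the derivatives. -/

instance : IsProbabilityMeasure (haarProb G) :=
  ⟨by rw [haarProb]; exact Measure.haarMeasure_self⟩

instance : (haarProb G).IsHaarMeasure := by
  rw [haarProb]; infer_instance

instance : (haarProb G).Regular := by
  rw [haarProb]; infer_instance

/-- A right translate is again left invariant of total mass one, so uniqueness of the Haar
probability measure applies. For inversion the same argument works, since inversion turns right
invariance into left invariance. -/
instance : (haarProb G).IsMulRightInvariant := by
  refine ⟨fun g => ?_⟩
  have : IsProbabilityMeasure (Measure.map (fun x => x * g) (haarProb G)) :=
    Measure.isProbabilityMeasure_map (by fun_prop)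
  exact Measure.isHaarMeasure_eq_of_isProbabilityMeasure _ _

instance : (haarProb G).IsInvInvariant := by
  refine ⟨?_⟩
  have : IsProbabilityMeasure (haarProb G).inv :=
    Measure.isProbabilityMeasure_map (by fun_prop)
  have : (haarProb G).inv.IsHaarMeasure :=
    Measure.isHaarMeasure_of_isCompact_nonempty_interior _ Set.univ isCompact_univ
      (by simp) (by simp) (by simp)
  exact Measure.isHaarMeasure_eq_of_isProbabilityMeasure _ _

theorem _root_.Continuous.integrable_haarProb {E : Type*} [NormedAddCommGroup E] [T2Space G]
    {f : G → E} (hf : Continuous f) : Integrable f (haarProb G) :=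
  hf.integrable_of_hasCompactSupport (HasCompactSupport.of_compactSpace f)

end Haar

/-! ### Invariant Hermitian forms -/

section Unitary

open scoped Matrix ComplexOrder

variable {G : Type*} [TopologicalSpace G] [Group G] [IsTopologicalGroup G] [CompactSpace G]
  [T2Space G] [MeasurableSpace G] [BorelSpace G]

/-- A positive element of a C⋆-algebra is a star square, and the determinant shows that the factor
is invertible. This `S` is the change of basis which makes the Hermitian form `H` standard. -/
theorem _root_.Matrix.PosDef.exists_conjTranspose_mul_self {n : ℕ} {H : Matrix (Fin n) (Fin n) ℂ}
    (hH : H.PosDef) : ∃ S : Matrix (Fin n) (Fin n) ℂ, IsUnit S ∧ Sᴴ * S = H := by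
  open scoped MatrixOrder in
  obtain ⟨S, hS⟩ := CStarAlgebra.nonneg_iff_eq_star_mul_self.mp hH.posSemidef.nonneg
  refine ⟨S, ?_, hS.symm⟩
  have h1 := hH.isUnit
  rw [hS] at h1
  rw [Matrix.isUnit_iff_isUnit_det] at h1 ⊢
  rw [Matrix.det_mul] at h1
  exact isUnit_of_mul_isUnit_right h1

/-- Every continuous matrix representation of a compact group is conjugate to a unitary one. -/
theorem exists_unitary_conj {n : ℕ} (ρ : G →* Matrix (Fin n) (Fin n) ℂ) (hρ : Continuous ρ) :
    ∃ S : Matrix (Fin n) (Fin n) ℂ, IsUnit S ∧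
      ∀ g, S * ρ g * S⁻¹ ∈ Matrix.unitaryGroup (Fin n) ℂ := by
  -- Weyl's averaging trick: the Gram matrix of the standard inner product, averaged over the group.
  set I : Fin n → Fin n → ℂ := ∫ g, (fun i j => ((ρ g)ᴴ * ρ g) i j) ∂(haarProb G) with hI
  set H : Matrix (Fin n) (Fin n) ℂ := Matrix.of I with hH
  have hint : Integrable (fun g => (fun i j => ((ρ g)ᴴ * ρ g) i j : Fin n → Fin n → ℂ))
      (haarProb G) :=
    Continuous.integrable_haarProb <| continuous_pi fun i => continuous_pi fun j =>
      (by fun_prop : Continuous fun g => (ρ g)ᴴ * ρ g).matrix_elem i j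
  -- All properties of `H` are read off by moving a real-linear map under the integral: entries, `(ρ
  -- k)ᴴ * H * ρ k`, and the quadratic form.
  have key : ∀ {F : Type} [NormedAddCommGroup F] [NormedSpace ℝ F] [FiniteDimensional ℝ F]
      (L : Matrix (Fin n) (Fin n) ℂ →ₗ[ℝ] F), L H = ∫ g, L ((ρ g)ᴴ * ρ g) ∂(haarProb G) := by
    intro F _ _ _ L
    have : CompleteSpace F := FiniteDimensional.complete ℝ F
    exact (ContinuousLinearMap.integral_comp_comm (LinearMap.toContinuousLinearMap
      (L ∘ₗ (Matrix.ofLinearEquiv ℝ).toLinearMap)) hint).symm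
  have hent : ∀ i j, H i j = ∫ g, ((ρ g)ᴴ * ρ g) i j ∂(haarProb G) := fun i j =>
    key (Matrix.entryLinearMap ℝ ℂ i j)
  have hinv : ∀ k, (ρ k)ᴴ * H * ρ k = H := by
    intro k
    ext i j
    have h := key (F := ℂ) ((Matrix.entryLinearMap ℝ ℂ i j) ∘ₗ
      (LinearMap.mulLeftRight ℝ ((ρ k)ᴴ, ρ k)))
    simp only [LinearMap.comp_apply, LinearMap.mulLeftRight_apply,
      Matrix.entryLinearMap_apply] at h
    rw [h, hent, ← integral_mul_right_eq_self (fun g => ((ρ g)ᴴ * ρ g) i j) k]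
    refine integral_congr_ae (Filter.Eventually.of_forall fun g => ?_)
    simp [Matrix.mul_assoc, Matrix.conjTranspose_mul]
  have hpos : H.PosDef := by
    rw [Matrix.posDef_iff_dotProduct_mulVec]
    constructor
    · ext i j
      rw [Matrix.conjTranspose_apply, hent, hent, Complex.star_def, ← integral_conj]
      refine integral_congr_ae (Filter.Eventually.of_forall fun g => ?_)
      change star (((ρ g)ᴴ * ρ g) j i) = _
      rw [← Matrix.conjTranspose_apply, Matrix.conjTranspose_mul,
        Matrix.conjTranspose_conjTranspose]
    · intro x hx
      have h := key (F := ℂ)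
        ({ toFun := fun M => star x ⬝ᵥ (M *ᵥ x)
           map_add' := fun A B => by simp [Matrix.add_mulVec]
           map_smul' := fun c M => by simp [Matrix.smul_mulVec] } :
          Matrix (Fin n) (Fin n) ℂ →ₗ[ℝ] ℂ)
      simp only [LinearMap.coe_mk, AddHom.coe_mk] at h
      rw [h]
      have e : ∀ g, star x ⬝ᵥ (((ρ g)ᴴ * ρ g) *ᵥ x) =
          ((∑ i, ‖(ρ g *ᵥ x) i‖ ^ 2 : ℝ) : ℂ) := by
        intro g
        rw [← Matrix.mulVec_mulVec, Matrix.dotProduct_mulVec, ← Matrix.star_mulVec]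
        simp only [dotProduct, Pi.star_apply, Complex.ofReal_sum]
        refine Finset.sum_congr rfl fun i _ => ?_
        rw [← Complex.normSq_eq_norm_sq, Complex.normSq_eq_conj_mul_self]; rfl
      simp_rw [e]
      rw [integral_complex_ofReal]
      have hc : Continuous fun g => (∑ i, ‖(ρ g *ᵥ x) i‖ ^ 2 : ℝ) := by fun_prop
      have : 0 < ∫ g, (∑ i, ‖(ρ g *ᵥ x) i‖ ^ 2 : ℝ) ∂(haarProb G) := by
        -- The integrand is continuous and nonnegative, and at the identity it equals the squared
        -- length of `x ≠ 0`.
        refine hc.integral_pos_of_hasCompactSupport_nonneg_nonzero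
          (HasCompactSupport.of_compactSpace _) (fun g => by positivity) (x := 1) ?_
        simp only [map_one, Matrix.one_mulVec]
        intro h0
        rw [Finset.sum_eq_zero_iff_of_nonneg (fun i _ => by positivity)] at h0
        exact hx (funext fun i => by simpa using h0 i (Finset.mem_univ i))
      exact_mod_cast this
  obtain ⟨S, hS, hSH⟩ := hpos.exists_conjTranspose_mul_self
  have hSd : IsUnit S.det := (Matrix.isUnit_iff_isUnit_det _).mp hS
  have hSh : IsUnit Sᴴ.det := by rw [Matrix.det_conjTranspose]; exact hSd.star
  refine ⟨S, hS, fun g => ?_⟩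
  rw [Matrix.mem_unitaryGroup_iff', Matrix.star_eq_conjTranspose, Matrix.conjTranspose_mul,
    Matrix.conjTranspose_mul, Matrix.conjTranspose_nonsing_inv]
  have h1 : Sᴴ⁻¹ * ((ρ g)ᴴ * Sᴴ) * (S * ρ g * S⁻¹) = Sᴴ⁻¹ * ((ρ g)ᴴ * (Sᴴ * S) * ρ g) * S⁻¹ := by
    simp only [Matrix.mul_assoc]
  rw [h1, hSH, hinv, ← hSH, ← Matrix.mul_assoc, Matrix.nonsing_inv_mul _ hSh, Matrix.one_mul,
    Matrix.mul_nonsing_inv _ hSd]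

end Unitary

end YangMills

namespace YangMills

/-! ### Schur orthogonality -/

section Schur

open scoped Matrix

variable {d : ℕ} {G : Type*} [TopologicalSpace G] [ChartedSpace (EuclideanSpace ℝ (Fin d)) G]
  [Group G]

theorem LieRep.continuous_mat (ρ : LieRep d G) : Continuous ρ.mat :=
  continuous_pi fun i => continuous_pi fun j => (ρ.smooth i j).continuous

theorem LieRep.continuous_mat_apply (ρ : LieRep d G) (i j : Fin ρ.dim) :
    Continuous fun g => ρ.mat g i j :=
  (ρ.smooth i j).continuous

theorem LieRep.continuous_character (ρ : LieRep d G) : Continuous ρ.character :=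
  ρ.continuous_mat.matrix_trace

theorem LieRep.toRepresentation_apply (ρ : LieRep d G) (g : G) :
    ρ.toRepresentation g = Matrix.toLin' (ρ.mat g) := rfl

/-- A matrix which intertwines two representations, as an intertwining map. -/
noncomputable def LieRep.intertwiner {ρ σ : LieRep d G} (M : Matrix (Fin ρ.dim) (Fin σ.dim) ℂ)
    (hM : ∀ k, ρ.mat k * M = M * σ.mat k) :
    Representation.IntertwiningMap σ.toRepresentation ρ.toRepresentation where
  toLinearMap := Matrix.toLin' M
  isIntertwining' := fun k => by
    rw [LieRep.toRepresentation_apply, LieRep.toRepresentation_apply, ← Matrix.toLin'_mul,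
      ← Matrix.toLin'_mul, hM]

/-- Schur's lemma: between inequivalent irreducible representations the space of intertwining maps
has only one element. -/
theorem LieRep.eq_zero_of_intertwines {ρ σ : LieRep d G} (hρ : ρ.toRepresentation.IsIrreducible)
    (hσ : σ.toRepresentation.IsIrreducible)
    (hne : IsEmpty (Representation.Equiv σ.toRepresentation ρ.toRepresentation))
    (M : Matrix (Fin ρ.dim) (Fin σ.dim) ℂ) (hM : ∀ k, ρ.mat k * M = M * σ.mat k) : M = 0 := by
  have h := Subsingleton.elim (LieRep.intertwiner M hM) 0
  have h2 : Matrix.toLin' M = 0 := congrArg Representation.IntertwiningMap.toLinearMap h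
  simpa using h2

/-- Schur's lemma over the algebraically closed field `ℂ`. -/
theorem LieRep.eq_smul_one_of_intertwines {ρ : LieRep d G}
    (hρ : ρ.toRepresentation.IsIrreducible)
    (M : Matrix (Fin ρ.dim) (Fin ρ.dim) ℂ) (hM : ∀ k, ρ.mat k * M = M * ρ.mat k) :
    ∃ c : ℂ, M = c • 1 := by
  obtain ⟨c, hc⟩ :=
    (Representation.IsIrreducible.algebraMap_intertwiningMap_bijective_of_isAlgClosed
      (ρ := ρ.toRepresentation)).2 (LieRep.intertwiner M hM)
  refine ⟨c, ?_⟩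
  have h2 : c • LinearMap.id = Matrix.toLin' M :=
    congrArg Representation.IntertwiningMap.toLinearMap hc
  apply Matrix.toLin'.injective
  rw [← h2]
  simp

theorem Irr.isIrreducible (l : Irr d G) : l.rep.toRepresentation.IsIrreducible :=
  (Quotient.out l).2

/-- Irreducibility includes two distinct subrepresentations, which a zero space does not have. -/
theorem Irr.dim_pos (l : Irr d G) : 0 < l.rep.dim := by
  rcases Nat.eq_zero_or_pos l.rep.dim with h | h
  · exfalso
    have hi := l.isIrreducible
    obtain ⟨a, b, hab⟩ := hi.exists_pair_ne
    apply hab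
    have : Subsingleton (Fin l.rep.dim → ℂ) := by
      rw [h]; infer_instance
    ext x
    rw [Subsingleton.elim x 0]
    constructor <;> intro _ <;> exact Submodule.zero_mem _
  · exact h

theorem LieRep.continuous_conj [IsTopologicalGroup G] (ρ σ : LieRep d G) (A : Matrix (Fin ρ.dim) (Fin σ.dim) ℂ) :
    Continuous fun g => ρ.mat g * A * σ.mat g⁻¹ := by
  have h1 := ρ.continuous_mat
  have h2 := σ.continuous_mat
  fun_prop

variable [IsTopologicalGroup G] [T2Space G] [CompactSpace G] [MeasurableSpace G] [BorelSpace G]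

/-- The average of a matrix over the group. -/
noncomputable def LieRep.average (ρ σ : LieRep d G) (A : Matrix (Fin ρ.dim) (Fin σ.dim) ℂ) :
    Matrix (Fin ρ.dim) (Fin σ.dim) ℂ :=
  fun i j => ∫ g, (ρ.mat g * A * σ.mat g⁻¹) i j ∂(haarProb G)

/-- The substitution `g ↦ k g` moves `ρ k` through the integral and leaves `σ k` on the other side.
-/
theorem LieRep.average_intertwines (ρ σ : LieRep d G) (A : Matrix (Fin ρ.dim) (Fin σ.dim) ℂ)
    (k : G) : ρ.mat k * ρ.average σ A = ρ.average σ A * σ.mat k := by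
  have hi : ∀ i j, Integrable (fun g => (ρ.mat g * A * σ.mat g⁻¹) i j) (haarProb G) :=
    fun i j => ((ρ.continuous_conj σ A).matrix_elem i j).integrable_haarProb
  ext i j
  rw [Matrix.mul_apply, Matrix.mul_apply]
  simp only [LieRep.average]
  simp_rw [← integral_const_mul, ← integral_mul_const]
  rw [← integral_finsetSum _ fun l _ => (hi l j).const_mul _,
    ← integral_finsetSum _ fun l _ => (hi i l).mul_const _]
  simp_rw [← Matrix.mul_apply]
  rw [← integral_mul_left_eq_self (fun g => (ρ.mat g * A * σ.mat g⁻¹ * σ.mat k) i j) k]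
  refine integral_congr_ae (Filter.Eventually.of_forall fun g => ?_)
  simp only [map_mul, mul_inv_rev, Matrix.mul_assoc]
  rw [← map_mul σ.mat k⁻¹ k, inv_mul_cancel, map_one, Matrix.mul_one]

theorem LieRep.trace_average (ρ : LieRep d G) (A : Matrix (Fin ρ.dim) (Fin ρ.dim) ℂ) :
    (ρ.average ρ A).trace = A.trace := by
  have hi : ∀ i j, Integrable (fun g => (ρ.mat g * A * ρ.mat g⁻¹) i j) (haarProb G) :=
    fun i j => ((ρ.continuous_conj ρ A).matrix_elem i j).integrable_haarProb
  have : (ρ.average ρ A).trace = ∫ g, (ρ.mat g * A * ρ.mat g⁻¹).trace ∂(haarProb G) := by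
    simp only [Matrix.trace, LieRep.average, Matrix.diag]
    rw [integral_finsetSum _ fun l _ => hi l l]
  rw [this]
  have e : ∀ g, (ρ.mat g * A * ρ.mat g⁻¹).trace = A.trace := fun g => by
    rw [Matrix.trace_mul_comm, ← Matrix.mul_assoc, ← map_mul, inv_mul_cancel, map_one,
      Matrix.one_mul]
  simp [e]

/-- The product of diagonal entries `ρ(g)ᵢᵢ σ(g⁻¹)ₖₖ` is the `(i, k)` entry of `ρ(g) Eᵢₖ σ(g⁻¹)`.
This expresses the inner product of characters through averages, which Schur's lemma determines. -/
theorem LieRep.integral_character_mul_inv (ρ σ : LieRep d G) :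
    ∫ g, ρ.character g * σ.character g⁻¹ ∂(haarProb G) =
      ∑ i, ∑ k, ρ.average σ (Matrix.single i k 1) i k := by
  have e : ∀ g, ρ.character g * σ.character g⁻¹ =
      ∑ i, ∑ k, (ρ.mat g * (Matrix.single i k 1 : Matrix (Fin ρ.dim) (Fin σ.dim) ℂ) * σ.mat g⁻¹) i k := fun g => by
    simp only [LieRep.character, Matrix.trace, Matrix.diag, Finset.sum_mul_sum]
    refine Finset.sum_congr rfl fun i _ => Finset.sum_congr rfl fun k _ => ?_
    simp [Matrix.mul_apply, Matrix.single_apply, Finset.sum_mul]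
    simp [ite_and]
  have hi : ∀ (A : Matrix (Fin ρ.dim) (Fin σ.dim) ℂ) i j, Integrable (fun g => (ρ.mat g * A * σ.mat g⁻¹) i j) (haarProb G) :=
    fun A i j => ((ρ.continuous_conj σ A).matrix_elem i j).integrable_haarProb
  simp_rw [e]
  rw [integral_finsetSum _ fun i _ => integrable_finsetSum _ fun k _ => hi _ _ _]
  refine Finset.sum_congr rfl fun i _ => ?_
  rw [integral_finsetSum _ fun k _ => hi _ _ _]
  rfl

/-- The characters of the irreducible representations are orthonormal. -/
theorem Irr.integral_character_mul_inv [DecidableEq (Irr d G)] (l m : Irr d G) :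
    ∫ g, l.rep.character g * m.rep.character g⁻¹ ∂(haarProb G) = if l = m then 1 else 0 := by
  rw [LieRep.integral_character_mul_inv]
  split_ifs with h
  · subst h
    have hn : (l.rep.dim : ℂ) ≠ 0 := by exact_mod_cast l.dim_pos.ne'
    -- The average is a scalar matrix. For `i = k` its trace is one, so the scalar is `1 / dim`; for
    -- `i ≠ k` the entry is off the diagonal.
    have key : ∀ i k, l.rep.average l.rep (Matrix.single i k 1) i k =
        if i = k then (l.rep.dim : ℂ)⁻¹ else 0 := by
      intro i k
      obtain ⟨c, hc⟩ := LieRep.eq_smul_one_of_intertwines l.isIrreducible _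
        (l.rep.average_intertwines l.rep (Matrix.single i k 1))
      have ht := l.rep.trace_average (Matrix.single i k 1)
      rw [hc, Matrix.trace_smul, Matrix.trace_one, Fintype.card_fin, smul_eq_mul] at ht
      rw [hc]
      split_ifs with hik
      · subst hik
        rw [Matrix.trace_single_eq_same] at ht
        simp only [Matrix.smul_apply, Matrix.one_apply_eq, smul_eq_mul, mul_one]
        exact eq_inv_of_mul_eq_one_left ht
      · simp [hik]
    simp only [key, Finset.sum_ite_eq, Finset.mem_univ, if_true]
    simp [hn]
  · refine Finset.sum_eq_zero fun i _ => Finset.sum_eq_zero fun k _ => ?_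
    have := LieRep.eq_zero_of_intertwines l.isIrreducible m.isIrreducible
      ⟨fun f => h (by
        rw [← Quotient.out_eq l, ← Quotient.out_eq m]
        exact Quotient.sound ⟨f.symm⟩)⟩ _ (l.rep.average_intertwines m.rep (Matrix.single i k 1))
    rw [this]; rfl

end Schur

end YangMills

namespace YangMills

/-! ### The chart at the identity of a Lie group -/

section Chart

open Filter Topology

variable (d : ℕ) (G : Type*) [TopologicalSpace G] [ChartedSpace (EuclideanSpace ℝ (Fin d)) G]
  [Group G]

/-- The origin of the chart at the identity. -/
noncomputable def chartOrigin : EuclideanSpace ℝ (Fin d) := extChartAt (𝓡 d) (1 : G) 1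

variable {d}

/-- The parametrization of a neighborhood of the identity by the chart at the identity. -/
noncomputable def param (u : EuclideanSpace ℝ (Fin d)) : G := (extChartAt (𝓡 d) (1 : G)).symm u

variable {G}

/-- A map `G × G → G`, written in the chart at the identity. -/
noncomputable def inChart (f : G → G → G)
    (p : EuclideanSpace ℝ (Fin d) × EuclideanSpace ℝ (Fin d)) : EuclideanSpace ℝ (Fin d) :=
  extChartAt (𝓡 d) (1 : G) (f (param G p.1) (param G p.2))

@[simp]
theorem param_chartOrigin : param G (chartOrigin d G) = 1 :=
  extChartAt_to_inv (I := 𝓡 d) (1 : G)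

theorem target_mem_nhds : (extChartAt (𝓡 d) (1 : G)).target ∈ 𝓝 (chartOrigin d G) :=
  extChartAt_target_mem_nhds (I := 𝓡 d) (1 : G)

theorem chart_param {u : EuclideanSpace ℝ (Fin d)}
    (hu : u ∈ (extChartAt (𝓡 d) (1 : G)).target) :
    extChartAt (𝓡 d) (1 : G) (param G u) = u :=
  (extChartAt (𝓡 d) (1 : G)).right_inv hu

variable [LieGroup (𝓡 d) ∞ G]

theorem contMDiffAt_param {u : EuclideanSpace ℝ (Fin d)}
    (hu : u ∈ (extChartAt (𝓡 d) (1 : G)).target) :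
    ContMDiffAt 𝓘(ℝ, EuclideanSpace ℝ (Fin d)) (𝓡 d) ∞ (param G) u :=
  (contMDiffOn_extChartAt_symm (1 : G)).contMDiffAt ((isOpen_extChartAt_target (1 : G)).mem_nhds hu)

theorem contMDiffAt_param_origin :
    ContMDiffAt 𝓘(ℝ, EuclideanSpace ℝ (Fin d)) (𝓡 d) ∞ (param G) (chartOrigin d G) :=
  contMDiffAt_param (mem_of_mem_nhds target_mem_nhds)

theorem continuousAt_param : ContinuousAt (param G) (chartOrigin d G) :=
  contMDiffAt_param_origin.continuousAt

section

variable {f : G → G → G}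
  (hf : ContMDiff ((𝓡 d).prod (𝓡 d)) (𝓡 d) ∞ (fun p : G × G => f p.1 p.2)) (h1 : f 1 1 = 1)

include hf h1

theorem contDiffAt_inChart :
    ContDiffAt ℝ ∞ (inChart f) (chartOrigin d G, chartOrigin d G) := by
  rw [← contMDiffAt_iff_contDiffAt]
  have hp : ContMDiffAt 𝓘(ℝ, EuclideanSpace ℝ (Fin d) × EuclideanSpace ℝ (Fin d))
      ((𝓡 d).prod (𝓡 d)) ∞ (fun p : EuclideanSpace ℝ (Fin d) × EuclideanSpace ℝ (Fin d) =>
        (param G p.1, param G p.2)) (chartOrigin d G, chartOrigin d G) := by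
    refine ContMDiffAt.prodMk ?_ ?_
    · exact contMDiffAt_param_origin.comp (chartOrigin d G, chartOrigin d G)
        (contDiff_fst.contMDiff.contMDiffAt)
    · exact contMDiffAt_param_origin.comp (chartOrigin d G, chartOrigin d G)
        (contDiff_snd.contMDiff.contMDiffAt)
  have h2 := (hf.contMDiffAt (x := (param G (chartOrigin d G), param G (chartOrigin d G)))).comp
    (chartOrigin d G, chartOrigin d G) hp
  have h3 : ContMDiffAt (𝓡 d) 𝓘(ℝ, EuclideanSpace ℝ (Fin d)) ∞ (extChartAt (𝓡 d) (1 : G))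
      (f (param G (chartOrigin d G)) (param G (chartOrigin d G))) := by
    rw [param_chartOrigin, h1]
    exact contMDiffAt_extChartAt
  exact h3.comp (chartOrigin d G, chartOrigin d G) h2

/-- By continuity and `f 1 1 = 1`, the values stay in the domain of the chart, where `param` inverts
it. -/
theorem eventually_param_inChart :
    ∀ᶠ p in 𝓝 (chartOrigin d G, chartOrigin d G),
      param G (inChart f p) = f (param G p.1) (param G p.2) := by
  have hp : ContinuousAt (param G) (chartOrigin d G) := continuousAt_param
  have h2 : Tendsto (fun p : EuclideanSpace ℝ (Fin d) × EuclideanSpace ℝ (Fin d) =>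
      (param G p.1, param G p.2)) (𝓝 (chartOrigin d G, chartOrigin d G))
      (𝓝 (param G (chartOrigin d G), param G (chartOrigin d G))) := by
    rw [nhds_prod_eq, nhds_prod_eq]
    exact hp.tendsto.prodMap hp.tendsto
  have hc : Tendsto (fun p : EuclideanSpace ℝ (Fin d) × EuclideanSpace ℝ (Fin d) =>
      f (param G p.1) (param G p.2)) (𝓝 (chartOrigin d G, chartOrigin d G))
      (𝓝 (f (param G (chartOrigin d G)) (param G (chartOrigin d G)))) :=
    (hf.continuous.tendsto (param G (chartOrigin d G), param G (chartOrigin d G))).comp h2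
  have hn : (extChartAt (𝓡 d) (1 : G)).source ∈
      𝓝 (f (param G (chartOrigin d G)) (param G (chartOrigin d G))) := by
    rw [param_chartOrigin, h1]
    exact extChartAt_source_mem_nhds (1 : G)
  filter_upwards [hc.eventually_mem hn] with p hp
  exact (extChartAt (𝓡 d) (1 : G)).left_inv hp

end

theorem contMDiff_mul' :
    ContMDiff ((𝓡 d).prod (𝓡 d)) (𝓡 d) ∞ (fun p : G × G => p.1 * p.2) :=
  contMDiff_mul (𝓡 d) ∞

theorem contMDiff_inv_mul :
    ContMDiff ((𝓡 d).prod (𝓡 d)) (𝓡 d) ∞ (fun p : G × G => p.1⁻¹ * p.2) :=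
  contMDiff_fst.inv.mul contMDiff_snd

theorem contMDiff_conj :
    ContMDiff ((𝓡 d).prod (𝓡 d)) (𝓡 d) ∞ (fun p : G × G => p.1 * p.2 * p.1⁻¹) :=
  (contMDiff_fst.mul contMDiff_snd).mul contMDiff_fst.inv

end Chart

end YangMills

namespace YangMills

/-! ### The adjoint representation -/

section Adjoint

open Filter Topology VectorField

variable {d : ℕ} {G : Type*} [TopologicalSpace G] [ChartedSpace (EuclideanSpace ℝ (Fin d)) G]
  [Group G]

local notation "𝔼" => EuclideanSpace ℝ (Fin d)

/-- The second derivative of the multiplication at the identity, in the chart at the identity. -/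
noncomputable def mulHess (d : ℕ) (G : Type*) [TopologicalSpace G]
    [ChartedSpace (EuclideanSpace ℝ (Fin d)) G] [Group G] :
    EuclideanSpace ℝ (Fin d) × EuclideanSpace ℝ (Fin d) →L[ℝ]
      EuclideanSpace ℝ (Fin d) × EuclideanSpace ℝ (Fin d) →L[ℝ] EuclideanSpace ℝ (Fin d) :=
  fderiv ℝ (fderiv ℝ (inChart (d := d) (fun a b : G => a * b)))
    (chartOrigin d G, chartOrigin d G)

theorem inChart_mul_right {u : 𝔼} (hu : u ∈ (extChartAt (𝓡 d) (1 : G)).target) :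
    inChart (fun a b : G => a * b) (u, chartOrigin d G) = u := by
  simp only [inChart, param_chartOrigin, mul_one]
  exact chart_param hu

theorem inChart_mul_left {u : 𝔼} (hu : u ∈ (extChartAt (𝓡 d) (1 : G)).target) :
    inChart (fun a b : G => a * b) (chartOrigin d G, u) = u := by
  simp only [inChart, param_chartOrigin, one_mul]
  exact chart_param hu

variable [LieGroup (𝓡 d) ∞ G]

theorem contDiffAt_inChart_mul :
    ContDiffAt ℝ 2 (inChart (d := d) (fun a b : G => a * b)) (chartOrigin d G, chartOrigin d G) :=
  (contDiffAt_inChart contMDiff_mul' (mul_one 1)).of_le (by exact ENat.LEInfty.out)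

theorem mulHess_symm (p q : 𝔼 × 𝔼) : mulHess d G p q = mulHess d G q p :=
  (contDiffAt_inChart_mul (d := d) (G := G)).isSymmSndFDerivAt (by simp) p q

theorem hasFDerivAt_fderiv_mul :
    HasFDerivAt (fderiv ℝ (inChart (d := d) (fun a b : G => a * b))) (mulHess d G)
      (chartOrigin d G, chartOrigin d G) := by
  have h : ContDiffAt ℝ 1 (fderiv ℝ (inChart (d := d) (fun a b : G => a * b)))
      (chartOrigin d G, chartOrigin d G) :=
    (contDiffAt_inChart_mul (d := d) (G := G)).fderiv_right (m := 1) (by norm_num)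
  exact (h.differentiableAt (by simp)).hasFDerivAt

theorem eventually_differentiableAt_mul :
    ∀ᶠ p in 𝓝 (chartOrigin d G, chartOrigin d G),
      DifferentiableAt ℝ (inChart (d := d) (fun a b : G => a * b)) p := by
  have := (contDiffAt_inChart_mul (d := d) (G := G)).eventually (by simp)
  filter_upwards [this] with p hp
  exact hp.differentiableAt (by simp)

/-- The tangent space at the identity is identified with the model space by this same chart, so in
these terms the derivative is the identity. -/
theorem hasMFDerivAt_param_origin :
    HasMFDerivAt 𝓘(ℝ, 𝔼) (𝓡 d) (param G) (chartOrigin d G)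
      (ContinuousLinearMap.id ℝ 𝔼) := by
  have h := (contMDiffAt_param_origin (d := d) (G := G)).mdifferentiableAt (by simp) |>.hasMFDerivAt
  have h2 := mfderivWithin_range_extChartAt_symm (I := 𝓡 d) (x := (1 : G))
  rw [modelWithCornersSelf_coe, Set.range_id, mfderivWithin_univ] at h2
  have h3 : mfderiv 𝓘(ℝ, 𝔼) (𝓡 d) (param G) (chartOrigin d G) = ContinuousLinearMap.id ℝ 𝔼 := h2
  rwa [h3] at h

/-- The invariant field at `g` is the derivative of left translation by `g` applied to `X`.
Differentiating `param (M(u, v)) = param u * param v` in `v` at the origin, where `M` is the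
multiplication in the chart, and cancelling the invertible derivative of `param` at `u` gives its
coordinates. -/
theorem eventually_mpullback_mulInvariantVectorField (X : 𝔼) :
    ∀ᶠ u in 𝓝 (chartOrigin d G),
      mpullbackWithin 𝓘(ℝ, 𝔼) (𝓡 d) (extChartAt (𝓡 d) (1 : G)).symm
        (mulInvariantVectorField (I := 𝓡 d) (G := G) X) (Set.range (𝓡 d)) u =
      fderiv ℝ (inChart (d := d) (fun a b : G => a * b)) (u, chartOrigin d G) (0, X) := by
  have ht : Tendsto (fun u : 𝔼 => (u, chartOrigin d G)) (𝓝 (chartOrigin d G))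
      (𝓝 (chartOrigin d G, chartOrigin d G)) :=
    (Continuous.tendsto (by fun_prop) (chartOrigin d G))
  have hc := eventually_param_inChart (d := d) (G := G) contMDiff_mul' (mul_one 1)
  rw [nhds_prod_eq] at hc
  filter_upwards [ht.eventually eventually_differentiableAt_mul, hc.curry,
    target_mem_nhds (d := d) (G := G)] with u hu huv hut
  have hinv := isInvertible_mfderivWithin_extChartAt_symm hut
  have hM : HasFDerivAt (fun v => inChart (d := d) (fun a b : G => a * b) (u, v))
      ((fderiv ℝ (inChart (d := d) (fun a b : G => a * b)) (u, chartOrigin d G)).comp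
        (ContinuousLinearMap.inr ℝ 𝔼 𝔼)) (chartOrigin d G) :=
    hu.hasFDerivAt.comp (chartOrigin d G) (hasFDerivAt_prodMk_right u (chartOrigin d G))
  have hpu : HasMFDerivAt 𝓘(ℝ, 𝔼) (𝓡 d) (param G)
      (inChart (d := d) (fun a b : G => a * b) (u, chartOrigin d G))
      (mfderiv 𝓘(ℝ, 𝔼) (𝓡 d) (param G) u) := by
    rw [inChart_mul_right hut]
    exact ((contMDiffAt_param hut).mdifferentiableAt (by simp)).hasMFDerivAt
  have h1 := hpu.comp (chartOrigin d G) hM.hasMFDerivAt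
  have hL : HasMFDerivAt (𝓡 d) (𝓡 d) (fun x => param G u * x) (param G (chartOrigin d G))
      (mfderiv (𝓡 d) (𝓡 d) (fun x => param G u * x) (1 : G)) := by
    rw [param_chartOrigin]
    exact ((contMDiff_mul_left (I := 𝓡 d) (n := ∞) (a := param G u)).mdifferentiableAt
      (by simp)).hasMFDerivAt
  have h2 := hL.comp (chartOrigin d G) hasMFDerivAt_param_origin
  have h3 := hasMFDerivAt_unique (h2.congr_of_eventuallyEq huv) h1
  have h4 := DFunLike.congr_fun h3 X
  rw [mpullbackWithin_apply]
  rw [modelWithCornersSelf_coe, Set.range_id, mfderivWithin_univ] at hinv ⊢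
  obtain ⟨e, he⟩ := hinv
  rw [← he, ContinuousLinearMap.inverse_equiv]
  refine (ContinuousLinearEquiv.symm_apply_eq e).2 ?_
  have h5 : ∀ w, e w = mfderiv 𝓘(ℝ, 𝔼) (𝓡 d) (param G) u w := fun w => DFunLike.congr_fun he w
  exact h4.trans (h5 _).symm

theorem hasFDerivAt_fderiv_mul_left (Z : 𝔼) :
    HasFDerivAt (fun u : 𝔼 =>
      fderiv ℝ (inChart (d := d) (fun a b : G => a * b)) (u, chartOrigin d G) (0, Z))
      (((mulHess d G).flip (0, Z)).comp (ContinuousLinearMap.inl ℝ 𝔼 𝔼)) (chartOrigin d G) := by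
  have h := HasFDerivAt.comp (f := fun u : 𝔼 => (u, chartOrigin d G)) (chartOrigin d G)
    (hasFDerivAt_fderiv_mul (d := d) (G := G))
    (hasFDerivAt_prodMk_left (chartOrigin d G) (chartOrigin d G))
  exact ((ContinuousLinearMap.apply ℝ 𝔼 ((0, Z) : 𝔼 × 𝔼)).hasFDerivAt.comp _ h)

/-- Multiplication by the identity fixes every point, so both partial derivatives of the
multiplication are the identity. -/
theorem fderiv_mul_origin_left (Z : 𝔼) :
    fderiv ℝ (inChart (d := d) (fun a b : G => a * b)) (chartOrigin d G, chartOrigin d G)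
      (Z, 0) = Z := by
  have hM := HasFDerivAt.comp (f := fun u : 𝔼 => (u, chartOrigin d G)) (chartOrigin d G)
    ((contDiffAt_inChart_mul (d := d) (G := G)).differentiableAt (by simp)).hasFDerivAt
    (hasFDerivAt_prodMk_left (chartOrigin d G) (chartOrigin d G))
  have hid : HasFDerivAt (fun v : 𝔼 => inChart (d := d) (fun a b : G => a * b)
      (v, chartOrigin d G)) (ContinuousLinearMap.id ℝ 𝔼) (chartOrigin d G) := by
    refine (hasFDerivAt_id _).congr_of_eventuallyEq ?_
    filter_upwards [target_mem_nhds (d := d) (G := G)] with v hv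
    exact inChart_mul_right hv
  exact DFunLike.congr_fun (hM.unique hid) Z

theorem fderiv_mul_origin_right (Z : 𝔼) :
    fderiv ℝ (inChart (d := d) (fun a b : G => a * b)) (chartOrigin d G, chartOrigin d G)
      (0, Z) = Z := by
  have hM := HasFDerivAt.comp (f := fun u : 𝔼 => (chartOrigin d G, u)) (chartOrigin d G)
    ((contDiffAt_inChart_mul (d := d) (G := G)).differentiableAt (by simp)).hasFDerivAt
    (hasFDerivAt_prodMk_right (chartOrigin d G) (chartOrigin d G))
  have hid : HasFDerivAt (fun v : 𝔼 => inChart (d := d) (fun a b : G => a * b)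
      (chartOrigin d G, v)) (ContinuousLinearMap.id ℝ 𝔼) (chartOrigin d G) := by
    refine (hasFDerivAt_id _).congr_of_eventuallyEq ?_
    filter_upwards [target_mem_nhds (d := d) (G := G)] with v hv
    exact inChart_mul_left hv
  exact DFunLike.congr_fun (hM.unique hid) Z

/-- The bracket is that of the invariant vector fields, which in the chart are `u ↦ ∂₂M(u, 0) X`,
with the chart origin written `0`. Differentiating such a field once more produces mixed second
derivatives of `M`. -/
theorem bracket_eq_mulHess (X Y : GroupLieAlgebra (𝓡 d) G) :
    (⁅X, Y⁆ : GroupLieAlgebra (𝓡 d) G) =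
      (mulHess d G (X, 0) (0, Y) - mulHess d G (Y, 0) (0, X) : 𝔼) := by
  have hb : (⁅X, Y⁆ : GroupLieAlgebra (𝓡 d) G) =
      (mfderiv (𝓡 d) 𝓘(ℝ, 𝔼) (extChartAt (𝓡 d) (1 : G)) 1).inverse
      (lieBracketWithin (E := 𝔼) ℝ
        (mpullbackWithin 𝓘(ℝ, 𝔼) (𝓡 d) (extChartAt (𝓡 d) (1 : G)).symm
          (mulInvariantVectorField (I := 𝓡 d) (G := G) X) (Set.range (𝓡 d)))
        (mpullbackWithin 𝓘(ℝ, 𝔼) (𝓡 d) (extChartAt (𝓡 d) (1 : G)).symm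
          (mulInvariantVectorField (I := 𝓡 d) (G := G) Y) (Set.range (𝓡 d)))
        ((extChartAt (𝓡 d) (1 : G)).symm ⁻¹' Set.univ ∩ Set.range (𝓡 d))
        (extChartAt (𝓡 d) (1 : G) 1)) := rfl
  have hi (w : 𝔼) : (mfderiv (𝓡 d) 𝓘(ℝ, 𝔼) (extChartAt (𝓡 d) (1 : G)) 1).inverse w = w := by
    have h : mfderiv (𝓡 d) 𝓘(ℝ, 𝔼) (extChartAt (𝓡 d) (1 : G)) 1 = ContinuousLinearMap.id ℝ 𝔼 :=
      mfderiv_extChartAt_self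
    refine (congrArg (fun L : 𝔼 →L[ℝ] 𝔼 => L.inverse w) h).trans ?_
    exact DFunLike.congr_fun ContinuousLinearMap.inverse_id w
  have hs : ((extChartAt (𝓡 d) (1 : G)).symm ⁻¹' Set.univ ∩ Set.range (𝓡 d)) = Set.univ := by
    simp [modelWithCornersSelf_coe]
  have gen (X Y : 𝔼) (V W : 𝔼 → 𝔼)
      (hV : V =ᶠ[𝓝 (chartOrigin d G)] fun u =>
        fderiv ℝ (inChart (d := d) (fun a b : G => a * b)) (u, chartOrigin d G) (0, X))
      (hW : W =ᶠ[𝓝 (chartOrigin d G)] fun u =>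
        fderiv ℝ (inChart (d := d) (fun a b : G => a * b)) (u, chartOrigin d G) (0, Y)) :
      lieBracketWithin ℝ V W ((extChartAt (𝓡 d) (1 : G)).symm ⁻¹' Set.univ ∩ Set.range (𝓡 d))
        (chartOrigin d G) = mulHess d G (X, 0) (0, Y) - mulHess d G (Y, 0) (0, X) := by
    rw [hs, lieBracketWithin_univ, hV.lieBracket_vectorField_eq hW, lieBracket_eq]
    beta_reduce
    rw [(hasFDerivAt_fderiv_mul_left (G := G) Y).fderiv,
      (hasFDerivAt_fderiv_mul_left (G := G) X).fderiv, fderiv_mul_origin_right,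
      fderiv_mul_origin_right]
    rfl
  exact hb.trans ((hi _).trans (gen X Y _ _ (eventually_mpullback_mulInvariantVectorField X)
    (eventually_mpullback_mulInvariantVectorField Y)))

/-! #### The adjoint representation in the chart at the identity -/

theorem contDiffAt_conj_param (g : G) :
    ContDiffAt ℝ ∞ (fun v : 𝔼 => extChartAt (𝓡 d) (1 : G) (g * param G v * g⁻¹))
      (chartOrigin d G) := by
  rw [← contMDiffAt_iff_contDiffAt]
  have h2 : ContMDiffAt 𝓘(ℝ, 𝔼) (𝓡 d) ∞ (fun v : 𝔼 => g * param G v * g⁻¹) (chartOrigin d G) :=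
    ((contMDiffAt_const (c := g)).mul contMDiffAt_param_origin).mul contMDiffAt_const
  refine ContMDiffAt.comp (chartOrigin d G) (g := extChartAt (𝓡 d) (1 : G)) ?_ h2
  rw [param_chartOrigin, mul_one, mul_inv_cancel]
  exact contMDiffAt_extChartAt

/-- The adjoint representation, in the chart at the identity. -/
noncomputable def adMap (g : G) : 𝔼 →L[ℝ] 𝔼 :=
  fderiv ℝ (fun v : 𝔼 => extChartAt (𝓡 d) (1 : G) (g * param G v * g⁻¹)) (chartOrigin d G)

theorem hasFDerivAt_adMap (g : G) :
    HasFDerivAt (fun v : 𝔼 => extChartAt (𝓡 d) (1 : G) (g * param G v * g⁻¹)) (adMap g)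
      (chartOrigin d G) :=
  ((contDiffAt_conj_param g).differentiableAt (by simp)).hasFDerivAt

theorem adMap_one : adMap (1 : G) = ContinuousLinearMap.id ℝ 𝔼 := by
  refine (hasFDerivAt_adMap (1 : G)).unique ((hasFDerivAt_id _).congr_of_eventuallyEq ?_)
  filter_upwards [target_mem_nhds (d := d) (G := G)] with v hv
  simpa using chart_param hv

/-- Conjugations compose, and the chain rule applies because conjugation by `h` keeps a neighborhood
of the identity inside the chart. -/
theorem adMap_mul (g h : G) : adMap (g * h) = (adMap g).comp (adMap h : 𝔼 →L[ℝ] 𝔼) := by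
  have h0 : extChartAt (𝓡 d) (1 : G) (h * param G (chartOrigin d G) * h⁻¹) = chartOrigin d G := by
    rw [param_chartOrigin, mul_one, mul_inv_cancel]; rfl
  have hg := hasFDerivAt_adMap (d := d) g
  rw [← h0] at hg
  refine (hasFDerivAt_adMap (g * h)).unique
    ((hg.comp (chartOrigin d G) (hasFDerivAt_adMap h)).congr_of_eventuallyEq ?_)
  have hc : ContinuousAt (fun v : 𝔼 => h * param G v * h⁻¹) (chartOrigin d G) :=
    ((contMDiffAt_const (I := 𝓘(ℝ, 𝔼)) (I' := 𝓡 d) (n := ∞) (c := h)).mul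
      contMDiffAt_param_origin).mul contMDiffAt_const |>.continuousAt
  have hn : (extChartAt (𝓡 d) (1 : G)).source ∈ 𝓝 (h * param G (chartOrigin d G) * h⁻¹) := by
    rw [param_chartOrigin, mul_one, mul_inv_cancel]
    exact extChartAt_source_mem_nhds (1 : G)
  filter_upwards [hc.eventually_mem hn] with v hv
  have : param G (extChartAt (𝓡 d) (1 : G) (h * param G v * h⁻¹)) = h * param G v * h⁻¹ :=
    (extChartAt (𝓡 d) (1 : G)).left_inv hv
  simp only [Function.comp, this]
  congr 1
  group

/-- Conjugation is jointly smooth, and taking the derivative in the second variable costs only one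
order. -/
theorem contDiffAt_adMap : ContDiffAt ℝ 1 (fun u : 𝔼 => (adMap (param G u) : 𝔼 →L[ℝ] 𝔼)) (chartOrigin d G) := by
  have h := (contDiffAt_inChart (d := d) (f := fun a b : G => a * b * a⁻¹) contMDiff_conj (by simp)).of_le
    (by exact ENat.LEInfty.out : (2 : ℕ∞ω) ≤ ∞)
  exact ContDiffAt.fderiv (f := fun u v : 𝔼 => inChart (fun a b : G => a * b * a⁻¹) (u, v))
    (g := fun _ : 𝔼 => chartOrigin d G) h contDiffAt_const (by norm_num)

/-- This is the derivative in `v` of `(u v u⁻¹) u = u v`. It ties the adjoint action to derivatives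
of the multiplication alone, without differentiating the inverse. -/
theorem eventually_adMap_relation :
    ∀ᶠ u in 𝓝 (chartOrigin d G), ∀ Y : 𝔼,
      fderiv ℝ (inChart (d := d) (fun a b : G => a * b)) (chartOrigin d G, u)
        (adMap (param G u) Y, 0) =
      fderiv ℝ (inChart (d := d) (fun a b : G => a * b)) (u, chartOrigin d G) (0, Y) := by
  have ht : Tendsto (fun u : 𝔼 => (u, chartOrigin d G)) (𝓝 (chartOrigin d G))
      (𝓝 (chartOrigin d G, chartOrigin d G)) :=
    (Continuous.tendsto (by fun_prop) (chartOrigin d G))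
  have ht' : Tendsto (fun u : 𝔼 => (chartOrigin d G, u)) (𝓝 (chartOrigin d G))
      (𝓝 (chartOrigin d G, chartOrigin d G)) :=
    (Continuous.tendsto (by fun_prop) (chartOrigin d G))
  have hc := eventually_param_inChart (d := d) (f := fun a b : G => a * b * a⁻¹) contMDiff_conj (by simp)
  rw [nhds_prod_eq] at hc
  filter_upwards [ht.eventually eventually_differentiableAt_mul,
    ht'.eventually eventually_differentiableAt_mul, hc.curry] with u hu hu' huv Y
  have h1 := HasFDerivAt.comp (f := fun v : 𝔼 => (u, v)) (chartOrigin d G) hu.hasFDerivAt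
    (hasFDerivAt_prodMk_right u (chartOrigin d G))
  have h0 : inChart (fun a b : G => a * b * a⁻¹) (u, chartOrigin d G) = chartOrigin d G := by
    simp [inChart]; rfl
  have h2 : HasFDerivAt (fun v : 𝔼 => (inChart (fun a b : G => a * b * a⁻¹) (u, v), u))
      ((adMap (param G u)).prod 0) (chartOrigin d G) :=
    (hasFDerivAt_adMap (param G u)).prodMk (hasFDerivAt_const u (chartOrigin d G))
  have h3 := HasFDerivAt.comp (f := fun v : 𝔼 => (inChart (fun a b : G => a * b * a⁻¹) (u, v), u))
    (chartOrigin d G) (g := inChart (d := d) (fun a b : G => a * b)) (by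
      rw [h0]; exact hu'.hasFDerivAt) h2
  refine DFunLike.congr_fun (h3.unique (h1.congr_of_eventuallyEq ?_)) Y
  filter_upwards [huv] with v hv
  simp only [Function.comp, inChart] at hv ⊢
  rw [hv]
  simp

/-- The derivative of the adjoint representation is the bracket of the Lie algebra. -/
theorem fderiv_adMap_apply (X Y : GroupLieAlgebra (𝓡 d) G) :
    (fderiv ℝ (fun u : 𝔼 => (adMap (param G u) : 𝔼 →L[ℝ] 𝔼)) (chartOrigin d G) X Y : 𝔼) =
      (⁅X, Y⁆ : GroupLieAlgebra (𝓡 d) G) := by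
  refine Eq.trans ?_ (bracket_eq_mulHess X Y).symm
  have gen (X Y : 𝔼) : fderiv ℝ (fun u : 𝔼 => (adMap (param G u) : 𝔼 →L[ℝ] 𝔼)) (chartOrigin d G) X Y =
      mulHess d G (X, 0) (0, Y) - mulHess d G (Y, 0) (0, X) := by
    have hA := ((contDiffAt_adMap (d := d) (G := G)).differentiableAt (by simp)).hasFDerivAt
    set δ := fderiv ℝ (fun u : 𝔼 => (adMap (param G u) : 𝔼 →L[ℝ] 𝔼)) (chartOrigin d G)
    have hB := HasFDerivAt.comp (f := fun u : 𝔼 => (chartOrigin d G, u)) (chartOrigin d G)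
      (hasFDerivAt_fderiv_mul (d := d) (G := G))
      (hasFDerivAt_prodMk_right (chartOrigin d G) (chartOrigin d G))
    have hAY : HasFDerivAt (fun u : 𝔼 => ((adMap (param G u) Y, 0) : 𝔼 × 𝔼))
        ((δ.flip Y).prod 0) (chartOrigin d G) :=
      ((ContinuousLinearMap.apply ℝ 𝔼 Y).hasFDerivAt.comp _ hA).prodMk
        (hasFDerivAt_const 0 (chartOrigin d G))
    -- Differentiating the relation in `u` along `X` gives `D²M((0, X), (Y, 0)) + δ X Y = D²M((X,
    -- 0), (0, Y))`. The symmetry of the second derivative turns this into the bracket formula.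
    have hl := hB.clm_apply hAY
    have hr := (hasFDerivAt_fderiv_mul_left (G := G) Y).congr_of_eventuallyEq
      (eventually_adMap_relation.mono fun u hu => hu Y)
    have h := DFunLike.congr_fun (hl.unique hr) X
    simp only [add_apply, ContinuousLinearMap.comp_apply,
      ContinuousLinearMap.prod_apply, ContinuousLinearMap.flip_apply,
      zero_apply, ContinuousLinearMap.inl_apply,
      ContinuousLinearMap.inr_apply, Function.comp, fderiv_mul_origin_left, param_chartOrigin,
      adMap_one, ContinuousLinearMap.id_apply] at h
    rw [mulHess_symm (0, X) (Y, 0)] at h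
    exact eq_sub_of_add_eq h
  exact gen X Y

end Adjoint

end YangMills

namespace YangMills

/-! ### Derivatives of unitary representations; the Killing form of a compact group -/

section Killing

open Filter Topology
open scoped Matrix ComplexOrder

variable {d : ℕ} {G : Type*} [TopologicalSpace G] [ChartedSpace (EuclideanSpace ℝ (Fin d)) G]
  [Group G]

local notation "𝔼" => EuclideanSpace ℝ (Fin d)

theorem _root_.HasFDerivAt.hasDerivAt_line {F : Type*} [NormedAddCommGroup F] [NormedSpace ℝ F]
    {f : 𝔼 → F} {f' : 𝔼 →L[ℝ] F} {c : 𝔼} (h : HasFDerivAt f f' c) (X : 𝔼) :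
    HasDerivAt (fun t : ℝ => f (c + t • X)) (f' X) 0 := by
  have h1 : HasDerivAt (fun t : ℝ => c + t • X) X 0 := by
    simpa using ((hasDerivAt_id (0 : ℝ)).smul_const X).const_add c
  have h2 : HasFDerivAt f f' (c + (0 : ℝ) • X) := by simpa using h
  exact h2.comp_hasDerivAt 0 h1

/-- Differentiate `Uᴴ U = 1` along a line through the chart origin, where `U = 1`. -/
theorem conjTranspose_deriv_of_unitary {n : ℕ} {U : G →* Matrix (Fin n) (Fin n) ℂ}
    (hU : ∀ g, U g ∈ Matrix.unitaryGroup (Fin n) ℂ) {D : Fin n → Fin n → 𝔼 →L[ℝ] ℂ}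
    (hD : ∀ i j, HasFDerivAt (fun u : 𝔼 => U (param G u) i j) (D i j) (chartOrigin d G)) (X : 𝔼) :
    (Matrix.of fun i j => D i j X)ᴴ = -(Matrix.of fun i j => D i j X) := by
  ext i j
  have h : HasDerivAt (fun t : ℝ => ∑ k, star (U (param G (chartOrigin d G + t • X)) k i) *
      U (param G (chartOrigin d G + t • X)) k j)
      (∑ k, (star (D k i X) * U (param G (chartOrigin d G + (0 : ℝ) • X)) k j +
        star (U (param G (chartOrigin d G + (0 : ℝ) • X)) k i) * D k j X)) 0 :=
    HasDerivAt.fun_sum fun k _ => ((hD k i).hasDerivAt_line X).star.mul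
      ((hD k j).hasDerivAt_line X)
  have hc : (fun t : ℝ => ∑ k, star (U (param G (chartOrigin d G + t • X)) k i) *
      U (param G (chartOrigin d G + t • X)) k j) = fun _ => (1 : Matrix (Fin n) (Fin n) ℂ) i j := by
    funext t
    have := Matrix.mem_unitaryGroup_iff'.1 (hU (param G (chartOrigin d G + t • X)))
    rw [← this, Matrix.mul_apply]
    rfl
  rw [hc] at h
  have h0 := h.unique (hasDerivAt_const (0 : ℝ) _)
  simp only [zero_smul, add_zero, param_chartOrigin, map_one, Matrix.one_apply] at h0
  rw [Finset.sum_add_distrib] at h0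
  simp at h0
  simp only [Matrix.conjTranspose_apply, Matrix.of_apply, Matrix.neg_apply]
  exact eq_neg_of_add_eq_zero_left h0

variable [IsTopologicalGroup G] [T2Space G] [CompactSpace G]

/-- A unitary model of a matrix representation of a compact group, with its derivative. -/
theorem exists_unitary_model {n : ℕ} {ρ : G →* Matrix (Fin n) (Fin n) ℂ} (hρ : Continuous ρ)
    {D : Fin n → Fin n → 𝔼 →L[ℝ] ℂ}
    (hD : ∀ i j, HasFDerivAt (fun u : 𝔼 => ρ (param G u) i j) (D i j) (chartOrigin d G)) :
    ∃ (U : G →* Matrix (Fin n) (Fin n) ℂ) (D' : Fin n → Fin n → 𝔼 →L[ℝ] ℂ),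
      Continuous U ∧
      (∀ g, U g ∈ Matrix.unitaryGroup (Fin n) ℂ) ∧ (∀ g, (U g).trace = (ρ g).trace) ∧
      (∀ i j, HasFDerivAt (fun u : 𝔼 => U (param G u) i j) (D' i j) (chartOrigin d G)) ∧
      (∀ X, ((Matrix.of fun i j => D i j X) * (Matrix.of fun i j => D i j X)).trace =
        -((∑ i, ∑ j, ‖D' i j X‖ ^ 2 : ℝ) : ℂ)) ∧
      ∀ X, (∑ i, ∑ j, ‖D' i j X‖ ^ 2) = 0 → ∀ i j, D i j X = 0 := by
  let _ : MeasurableSpace G := borel G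
  have : BorelSpace G := ⟨rfl⟩
  obtain ⟨S, hS, hu⟩ := exists_unitary_conj ρ hρ
  have hSd : IsUnit S.det := (Matrix.isUnit_iff_isUnit_det _).mp hS
  have hS1 : S⁻¹ * S = 1 := Matrix.nonsing_inv_mul _ hSd
  have hS2 : S * S⁻¹ = 1 := Matrix.mul_nonsing_inv _ hSd
  let U : G →* Matrix (Fin n) (Fin n) ℂ :=
    { toFun := fun g => S * ρ g * S⁻¹
      map_one' := by simp [hS2]
      map_mul' := fun a b => by
        have : S * ρ a * S⁻¹ * (S * ρ b * S⁻¹) = S * ρ a * (S⁻¹ * S) * ρ b * S⁻¹ := by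
          simp only [Matrix.mul_assoc]
        rw [this, hS1, Matrix.mul_one, map_mul]
        simp only [Matrix.mul_assoc] }
  let D' : Fin n → Fin n → 𝔼 →L[ℝ] ℂ := fun i j =>
    ∑ l, ∑ k, (S i k * S⁻¹ l j) • D k l
  have hD' : ∀ i j, HasFDerivAt (fun u : 𝔼 => U (param G u) i j) (D' i j) (chartOrigin d G) := by
    intro i j
    have h : HasFDerivAt (fun u : 𝔼 => ∑ l, ∑ k, (S i k * S⁻¹ l j) * ρ (param G u) k l)
        (D' i j) (chartOrigin d G) :=
      HasFDerivAt.fun_sum fun l _ => HasFDerivAt.fun_sum fun k _ =>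
        (hD k l).const_mul (S i k * S⁻¹ l j)
    refine h.congr_of_eventuallyEq (Eventually.of_forall fun u => ?_)
    change (S * ρ (param G u) * S⁻¹) i j = _
    simp only [Matrix.mul_apply, Finset.sum_mul]
    exact Finset.sum_congr rfl fun l _ => Finset.sum_congr rfl fun k _ => by ring
  have hconj : ∀ X, (Matrix.of fun i j => D' i j X) =
      S * (Matrix.of fun i j => D i j X) * S⁻¹ := by
    intro X
    ext i j
    simp only [D', Matrix.of_apply, Matrix.mul_apply, Finset.sum_mul]
    simp
    refine Finset.sum_congr rfl fun l _ => Finset.sum_congr rfl fun k _ => by ring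
  have hconj' : ∀ X, (Matrix.of fun i j => D i j X) =
      S⁻¹ * (Matrix.of fun i j => D' i j X) * S := by
    intro X
    rw [hconj]
    have : S⁻¹ * (S * (Matrix.of fun i j => D i j X) * S⁻¹) * S =
      (S⁻¹ * S) * (Matrix.of fun i j => D i j X) * (S⁻¹ * S) := by simp only [Matrix.mul_assoc]
    rw [this, hS1, Matrix.one_mul, Matrix.mul_one]
  refine ⟨U, D', ?_, hu, ?_, hD', ?_, ?_⟩
  · change Continuous fun g => S * ρ g * S⁻¹
    fun_prop
  · intro g
    change (S * ρ g * S⁻¹).trace = _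
    rw [Matrix.trace_mul_comm, ← Matrix.mul_assoc, hS1, Matrix.one_mul]
  · intro X
    have hsk := conjTranspose_deriv_of_unitary (U := U) hu hD' X
    have h1 : ((Matrix.of fun i j => D i j X) * (Matrix.of fun i j => D i j X)).trace =
        ((Matrix.of fun i j => D' i j X) * (Matrix.of fun i j => D' i j X)).trace := by
      rw [hconj]
      have : S * (Matrix.of fun i j => D i j X) * S⁻¹ * (S * (Matrix.of fun i j => D i j X) * S⁻¹)
        = S * (Matrix.of fun i j => D i j X) * (S⁻¹ * S) * (Matrix.of fun i j => D i j X) * S⁻¹ := by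
        simp only [Matrix.mul_assoc]
      rw [this, hS1, Matrix.mul_one, Matrix.mul_assoc S, Matrix.trace_mul_comm _ S⁻¹,
        ← Matrix.mul_assoc, hS1, Matrix.one_mul]
    rw [h1]
    -- Skewness turns the trace of the square into minus the squared Hilbert–Schmidt norm; the trace
    -- itself is unchanged by conjugation.
    have h2 : (Matrix.of fun i j => D' i j X) = -(Matrix.of fun i j => D' i j X)ᴴ := by
      rw [hsk, neg_neg]
    nth_rw 1 [h2]
    rw [Matrix.neg_mul, Matrix.trace_neg, neg_inj]
    simp only [Matrix.trace, Matrix.diag, Matrix.mul_apply, Matrix.conjTranspose_apply,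
      Matrix.of_apply, Complex.ofReal_sum]
    rw [Finset.sum_comm]
    refine Finset.sum_congr rfl fun i _ => Finset.sum_congr rfl fun j _ => ?_
    rw [← Complex.normSq_eq_norm_sq, Complex.normSq_eq_conj_mul_self]; rfl
  · intro X h0
    have hz : (Matrix.of fun i j => D' i j X) = 0 := by
      ext i j
      rw [Finset.sum_eq_zero_iff_of_nonneg (fun i _ => by positivity)] at h0
      have := h0 i (Finset.mem_univ i)
      rw [Finset.sum_eq_zero_iff_of_nonneg (fun i _ => by positivity)] at this
      simpa using this j (Finset.mem_univ j)
    have h2 := hconj' X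
    rw [hz, Matrix.mul_zero, Matrix.zero_mul] at h2
    intro i j
    exact congrFun (congrFun h2 i) j

end Killing

/-! ### Negative definiteness of the Killing form, from the adjoint representation -/

section Adjoint

open Filter Topology

variable {d : ℕ} {G : Type*} [TopologicalSpace G] [ChartedSpace (EuclideanSpace ℝ (Fin d)) G]
  [Group G] [LieGroup (𝓡 d) ∞ G]

local notation "𝔼" => EuclideanSpace ℝ (Fin d)

/-- For a homomorphism continuity at the identity is enough, and there the chart gives it. -/
theorem continuous_adMap [IsTopologicalGroup G] :
    Continuous fun g : G => (adMap g : 𝔼 →L[ℝ] 𝔼) := by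
  let A : G →* (𝔼 →L[ℝ] 𝔼) :=
    { toFun := fun g => adMap g
      map_one' := adMap_one
      map_mul' := adMap_mul }
  refine continuous_of_continuousAt_one A ?_
  have h1 : ContinuousAt (extChartAt (𝓡 d) (1 : G)) 1 := continuousAt_extChartAt (1 : G)
  have h2 : ContinuousAt (fun g : G => (adMap (param G (extChartAt (𝓡 d) (1 : G) g)) : 𝔼 →L[ℝ] 𝔼))
      1 := ContinuousAt.comp (f := extChartAt (𝓡 d) (1 : G))
        (g := fun u : 𝔼 => (adMap (param G u) : 𝔼 →L[ℝ] 𝔼))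
        (contDiffAt_adMap (d := d) (G := G)).continuousAt h1
  refine h2.congr ?_
  filter_upwards [extChartAt_source_mem_nhds (I := 𝓡 d) (1 : G)] with g hg
  change adMap ((extChartAt (𝓡 d) (1 : G)).symm (extChartAt (𝓡 d) (1 : G) g)) = adMap g
  rw [(extChartAt (𝓡 d) (1 : G)).left_inv hg]

/-- The matrix of a real linear endomorphism, as a complex matrix. -/
noncomputable def complexMatrix (A : 𝔼 →L[ℝ] 𝔼) : Matrix (Fin d) (Fin d) ℂ :=
  Matrix.of fun i j => ((A (EuclideanSpace.single j 1) i : ℝ) : ℂ)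

theorem complexMatrix_comp (A B : 𝔼 →L[ℝ] 𝔼) :
    complexMatrix (A.comp B) = complexMatrix A * complexMatrix B := by
  ext i j
  rw [Matrix.mul_apply]
  have h : B (EuclideanSpace.single j 1) = ∑ k, (B (EuclideanSpace.single j 1) k) •
      (EuclideanSpace.single k (1 : ℝ) : 𝔼) := by
    ext i
    simp [Pi.single_apply]
  simp only [complexMatrix, Matrix.of_apply, ContinuousLinearMap.comp_apply]
  conv_lhs => rw [h]
  simp [map_sum, mul_comm]

theorem trace_complexMatrix (A : 𝔼 →L[ℝ] 𝔼) :
    (complexMatrix A).trace = ((LinearMap.trace ℝ 𝔼 (A : 𝔼 →ₗ[ℝ] 𝔼) : ℝ) : ℂ) := by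
  rw [LinearMap.trace_eq_matrix_trace ℝ (EuclideanSpace.basisFun (Fin d) ℝ).toBasis]
  simp [Matrix.trace, complexMatrix, LinearMap.toMatrix_apply]

/-- The adjoint representation as a representation by complex matrices. -/
noncomputable def adMatrix (d : ℕ) (G : Type*) [TopologicalSpace G]
    [ChartedSpace (EuclideanSpace ℝ (Fin d)) G] [Group G] [LieGroup (𝓡 d) ∞ G] :
    G →* Matrix (Fin d) (Fin d) ℂ where
  toFun g := complexMatrix (adMap g)
  map_one' := by
    ext i j
    rw [adMap_one]
    simp only [complexMatrix, Matrix.of_apply, ContinuousLinearMap.id_apply, Matrix.one_apply]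
    by_cases h : i = j <;> simp [h]
  map_mul' := fun a b => by rw [adMap_mul, complexMatrix_comp]

variable [IsTopologicalGroup G] [T2Space G] [CompactSpace G]

/-- The Killing form of a compact Lie group is negative, and vanishes only on the center. -/
theorem killingForm_self (X : GroupLieAlgebra (𝓡 d) G) :
    killingForm ℝ (GroupLieAlgebra (𝓡 d) G) X X ≤ 0 ∧
      (killingForm ℝ (GroupLieAlgebra (𝓡 d) G) X X = 0 →
        ∀ Y : GroupLieAlgebra (𝓡 d) G, ⁅X, Y⁆ = 0) := by
  set δ := fderiv ℝ (fun u : 𝔼 => (adMap (param G u) : 𝔼 →L[ℝ] 𝔼)) (chartOrigin d G) with hδ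
  have hA : HasFDerivAt (fun u : 𝔼 => (adMap (param G u) : 𝔼 →L[ℝ] 𝔼)) δ (chartOrigin d G) :=
    ((contDiffAt_adMap (d := d) (G := G)).differentiableAt (by simp)).hasFDerivAt
  have had : ∀ X Y : GroupLieAlgebra (𝓡 d) G, ⁅X, Y⁆ = δ X Y := fun X Y =>
    (fderiv_adMap_apply X Y).symm
  let ev : Fin d → Fin d → (𝔼 →L[ℝ] 𝔼) →L[ℝ] ℂ := fun i j =>
    Complex.ofRealCLM.comp ((EuclideanSpace.proj (𝕜 := ℝ) i).comp
      (ContinuousLinearMap.apply ℝ 𝔼 (EuclideanSpace.single j 1)))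
  let D : Fin d → Fin d → 𝔼 →L[ℝ] ℂ := fun i j => (ev i j).comp δ
  have hD : ∀ i j, HasFDerivAt (fun u : 𝔼 => adMatrix d G (param G u) i j) (D i j)
      (chartOrigin d G) := fun i j => (ev i j).hasFDerivAt.comp _ hA
  have hc : Continuous (adMatrix d G) := by
    refine continuous_pi fun i => continuous_pi fun j => ?_
    exact (ev i j).continuous.comp (continuous_adMap (d := d) (G := G))
  obtain ⟨U, D', -, -, -, -, htr, hzero⟩ := exists_unitary_model hc hD
  have hDX : ∀ X : 𝔼, (Matrix.of fun i j => D i j X) = complexMatrix (δ X) := fun X => rfl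
  have hgen : ∀ X : 𝔼, LinearMap.trace ℝ 𝔼 ((δ X : 𝔼 →ₗ[ℝ] 𝔼) ∘ₗ (δ X : 𝔼 →ₗ[ℝ] 𝔼)) =
      -(∑ i, ∑ j, ‖D' i j X‖ ^ 2 : ℝ) := by
    intro X
    have h := htr X
    rw [hDX, ← complexMatrix_comp, trace_complexMatrix] at h
    exact_mod_cast h
  have hzero' : ∀ X : 𝔼, (∑ i, ∑ j, ‖D' i j X‖ ^ 2) = 0 → ∀ Y, δ X Y = 0 := by
    intro X h0 Y
    have h1 : ∀ j, δ X (EuclideanSpace.single j 1) = 0 := fun j => by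
      ext i
      exact Complex.ofReal_eq_zero.1 (hzero X h0 i j)
    have h2 : Y = ∑ k, (Y k) • (EuclideanSpace.single k (1 : ℝ) : 𝔼) := by
      ext i; simp [Pi.single_apply]
    rw [h2, map_sum]
    exact Finset.sum_eq_zero fun k _ => by rw [map_smul, h1, smul_zero]
  -- The Killing form is the trace of `(ad X)²`, and `ad X` is the derivative `δ X` of the adjoint
  -- representation.
  have hK : killingForm ℝ (GroupLieAlgebra (𝓡 d) G) X X = -(∑ i, ∑ j, ‖D' i j X‖ ^ 2 : ℝ) := by
    refine Eq.trans ?_ (hgen X)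
    rw [LieModule.traceForm_apply_apply]
    have : (LieModule.toEnd ℝ (GroupLieAlgebra (𝓡 d) G) (GroupLieAlgebra (𝓡 d) G)) X =
      (δ X : 𝔼 →ₗ[ℝ] 𝔼) := LinearMap.ext fun Y => had X Y
    rw [this]
    rfl
  rw [hK]
  refine ⟨neg_nonpos.2 (by positivity), fun h0 Y => ?_⟩
  rw [had]
  exact hzero' X (neg_eq_zero.1 h0) Y

/-- The Killing form of a compact Lie group with simple Lie algebra is negative definite. -/
theorem killingForm_self_neg [LieAlgebra.IsSimple ℝ (GroupLieAlgebra (𝓡 d) G)]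
    {X : GroupLieAlgebra (𝓡 d) G} (hX : X ≠ 0) :
    killingForm ℝ (GroupLieAlgebra (𝓡 d) G) X X < 0 := by
  obtain ⟨h1, h2⟩ := killingForm_self X
  refine lt_of_le_of_ne h1 fun h0 => ?_
  have hc : X ∈ LieAlgebra.center ℝ (GroupLieAlgebra (𝓡 d) G) := by
    rw [LieModule.mem_maxTrivSubmodule]
    intro Y
    rw [← lie_skew, h2 h0, neg_zero]
  -- The center is an ideal: if it is zero then `X = 0`, and if it is everything the algebra is
  -- abelian. Both are excluded.
  rcases LieAlgebra.IsSimple.eq_bot_or_eq_top (R := ℝ)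
    (LieAlgebra.center ℝ (GroupLieAlgebra (𝓡 d) G)) with h | h
  · rw [h] at hc
    exact hX ((LieSubmodule.mem_bot X).1 hc)
  · refine LieAlgebra.IsSimple.non_abelian (R := ℝ) (L := GroupLieAlgebra (𝓡 d) G) ⟨fun a b => ?_⟩
    have : b ∈ LieAlgebra.center ℝ (GroupLieAlgebra (𝓡 d) G) := by rw [h]; trivial
    exact (LieModule.mem_maxTrivSubmodule (R := ℝ) _ _ _).1 this a

end Adjoint

end YangMills

namespace YangMills

/-! ### The Casimir element in a unitary model -/

section Casimir

open Filter Topology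
open scoped Matrix ComplexOrder

variable {d : ℕ} {G : Type*} [TopologicalSpace G] [ChartedSpace (EuclideanSpace ℝ (Fin d)) G]
  [Group G]

local notation "𝔼" => EuclideanSpace ℝ (Fin d)

/-- The positive square root is self-adjoint, and a real self-adjoint matrix is symmetric. -/
theorem _root_.Matrix.PosDef.exists_transpose_mul_self {n : ℕ} {H : Matrix (Fin n) (Fin n) ℝ}
    (hH : H.PosDef) : ∃ S : Matrix (Fin n) (Fin n) ℝ, IsUnit S ∧ Sᵀ * S = H := by
  open scoped MatrixOrder Matrix.Norms.L2Operator in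
  have h0 : 0 ≤ H := hH.posSemidef.nonneg
  have h1 : CFC.sqrt H * CFC.sqrt H = H := CFC.sqrt_mul_sqrt_self H h0
  have h2 : (CFC.sqrt H)ᴴ = CFC.sqrt H := (CFC.sqrt_nonneg H).isSelfAdjoint
  have h3 : (CFC.sqrt H)ᵀ = CFC.sqrt H := by
    rw [← Matrix.conjTranspose_eq_transpose_of_trivial]; exact h2
  refine ⟨CFC.sqrt H, ?_, by rw [h3, h1]⟩
  have h4 := hH.isUnit
  rw [← h1] at h4
  rw [Matrix.isUnit_iff_isUnit_det] at h4 ⊢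
  rw [Matrix.det_mul] at h4
  exact isUnit_of_mul_isUnit_right h4

theorem dotProduct_gram_mulVec {n V : Type*} [Fintype n] [AddCommGroup V] [Module ℝ V]
    (B : V →ₗ[ℝ] V →ₗ[ℝ] ℝ) (b : n → V) {M : Matrix n n ℝ} (hM : ∀ i j, M i j = B (b i) (b j))
    (x : n → ℝ) : x ⬝ᵥ (M *ᵥ x) = B (∑ a, x a • b a) (∑ a, x a • b a) := by
  simp only [dotProduct, Matrix.mulVec, hM, map_sum, map_smul, LinearMap.sum_apply,
    LinearMap.smul_apply, smul_eq_mul, Finset.mul_sum]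
  rw [Finset.sum_comm]
  exact Finset.sum_congr rfl fun i _ => Finset.sum_congr rfl fun j _ => by ring

/-- The change of basis `Y_k = ∑ Q_{ka} X_a` diagonalizes the quadratic expression with coefficients
`Qᵀ Q`. It is used to write the Casimir trace as a sum of traces of squares. -/
theorem trace_sum_transpose_mul_self {m n l : Type*} [Fintype m] [Fintype n] [Fintype l]
    (Q : Matrix l m ℝ) (D : m → Matrix n n ℂ) :
    (∑ a, ∑ b, (((Qᵀ * Q) a b : ℝ) : ℂ) • (D a * D b)).trace =
      ∑ k, ((∑ a, ((Q k a : ℝ) : ℂ) • D a) * (∑ a, ((Q k a : ℝ) : ℂ) • D a)).trace := by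
  have h1 : ∀ a b, (((Qᵀ * Q) a b : ℝ) : ℂ) = ∑ k, (Q k a : ℂ) * (Q k b : ℂ) := fun a b => by
    simp [Matrix.mul_apply]
  simp only [h1, Matrix.trace_sum, Matrix.smul_mul, Matrix.mul_smul,
    Matrix.trace_smul, smul_eq_mul, Finset.sum_mul,
    Finset.mul_sum]
  rw [Finset.sum_congr rfl fun a _ => Finset.sum_comm, Finset.sum_comm]
  exact Finset.sum_congr rfl fun k _ => Finset.sum_congr rfl fun a _ =>
    Finset.sum_congr rfl fun b _ => by rw [Matrix.trace_mul_comm]; ring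

/-- The derivative at the identity of a matrix coefficient. -/
noncomputable def LieRep.chartDeriv (ρ : LieRep d G) (i j : Fin ρ.dim) : 𝔼 →L[ℝ] ℂ :=
  mfderiv (𝓡 d) 𝓘(ℝ, ℂ) (fun g => ρ.mat g i j) (1 : G)

theorem LieRep.hasFDerivAt_param [LieGroup (𝓡 d) ∞ G] (ρ : LieRep d G) (i j : Fin ρ.dim) :
    HasFDerivAt (fun u : 𝔼 => ρ.mat (param G u) i j) (ρ.chartDeriv i j) (chartOrigin d G) := by
  have h : HasMFDerivAt (𝓡 d) 𝓘(ℝ, ℂ) (fun g => ρ.mat g i j) (param G (chartOrigin d G))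
      (mfderiv (𝓡 d) 𝓘(ℝ, ℂ) (fun g => ρ.mat g i j) (1 : G)) := by
    rw [param_chartOrigin]
    exact ((ρ.smooth i j).mdifferentiableAt (by simp)).hasMFDerivAt
  have h2 := h.comp (chartOrigin d G) hasMFDerivAt_param_origin
  exact hasMFDerivAt_iff_hasFDerivAt.1 h2

variable [LieGroup (𝓡 d) ∞ G] [IsTopologicalGroup G] [T2Space G] [CompactSpace G]
  [LieAlgebra.IsSimple ℝ (GroupLieAlgebra (𝓡 d) G)]

/-- The quadratic form of a Gram matrix is the bilinear form at a combination of the basis, nonzero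
for nonzero coefficients by linear independence. -/
theorem posDef_neg_killingMatrix : (-killingMatrix d G).PosDef := by
  rw [Matrix.posDef_iff_dotProduct_mulVec]
  constructor
  · ext i j
    simp only [Matrix.conjTranspose_apply, Matrix.neg_apply, star_trivial, killingMatrix]
    rw [LieModule.traceForm_comm]
  · intro x hx
    set b := Module.finBasis ℝ (GroupLieAlgebra (𝓡 d) G)
    have h1 : (∑ a, x a • b a) ≠ 0 := by
      intro h0
      exact hx (funext fun a => Fintype.linearIndependent_iff.1 b.linearIndependent x h0 a)
    have h2 := killingForm_self_neg h1
    have h3 := dotProduct_gram_mulVec (killingForm ℝ (GroupLieAlgebra (𝓡 d) G)) b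
      (M := killingMatrix d G) (fun _ _ => rfl) x
    rw [star_trivial, Matrix.neg_mulVec, dotProduct_neg, h3]
    linarith

variable (d G) in
/-- The Casimir element is minus the sum of the squares of a suitable basis of the Lie algebra. -/
theorem exists_casimir_basis : ∃ (N : ℕ) (Y : Fin N → 𝔼) (s : Fin N → 𝔼 →L[ℝ] ℝ),
    (∀ X, X = ∑ k, s k X • Y k) ∧ ∀ ρ : LieRep d G, ρ.casimir.trace =
      -∑ k, ((Matrix.of fun i j => ρ.chartDeriv i j (Y k)) *
        (Matrix.of fun i j => ρ.chartDeriv i j (Y k))).trace := by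
  -- With `Qᵀ Q = (-K)⁻¹`, the vectors `∑ Q_{ka} b_a` are orthonormal for minus the Killing form;
  -- their coordinate functions come from `Q⁻¹`.
  obtain ⟨Q, hQ, hQK⟩ := (posDef_neg_killingMatrix (d := d) (G := G)).inv.exists_transpose_mul_self
  have hQd : IsUnit Q.det := (Matrix.isUnit_iff_isUnit_det _).mp hQ
  have hKinv : (killingMatrix d G)⁻¹ = -(Qᵀ * Q) := by
    rw [hQK]
    refine Matrix.inv_eq_right_inv ?_
    have h := Matrix.mul_nonsing_inv (-killingMatrix d G)
      ((Matrix.isUnit_iff_isUnit_det _).1 (posDef_neg_killingMatrix (d := d) (G := G)).isUnit)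
    rwa [Matrix.neg_mul, ← Matrix.mul_neg] at h
  let b : Module.Basis (Fin (Module.finrank ℝ (GroupLieAlgebra (𝓡 d) G))) ℝ 𝔼 :=
    Module.finBasis ℝ (GroupLieAlgebra (𝓡 d) G)
  refine ⟨_, fun k => ∑ a, Q k a • b a,
    fun k => LinearMap.toContinuousLinearMap (∑ a, Q⁻¹ a k • b.coord a), fun X => ?_, fun ρ => ?_⟩
  · have h1 : ∀ a, ∑ k, Q⁻¹ a k • ∑ c, Q k c • b c = b a := by
      intro a
      simp only [Finset.smul_sum, smul_smul]
      rw [Finset.sum_comm]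
      simp only [← Finset.sum_smul, ← Matrix.mul_apply, Matrix.nonsing_inv_mul _ hQd,
        Matrix.one_apply, ite_smul, one_smul, zero_smul, Finset.sum_ite_eq, Finset.mem_univ,
        if_true]
    conv_lhs => rw [← b.sum_repr X]
    simp only [LinearMap.coe_toContinuousLinearMap', LinearMap.sum_apply, LinearMap.smul_apply,
      Module.Basis.coord_apply, smul_eq_mul, Finset.sum_smul]
    rw [Finset.sum_comm]
    refine Finset.sum_congr rfl fun a _ => ?_
    conv_lhs => rw [← h1 a]
    rw [Finset.smul_sum]
    exact Finset.sum_congr rfl fun k _ => by rw [smul_smul, mul_comm]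
  · have hD : ∀ k, (Matrix.of fun i j => ρ.chartDeriv i j (∑ a, Q k a • b a)) =
        ∑ a, ((Q k a : ℝ) : ℂ) • ρ.deriv (Module.finBasis ℝ (GroupLieAlgebra (𝓡 d) G) a) := by
      intro k
      ext i j
      simp only [Matrix.of_apply, map_sum, map_smul, Matrix.sum_apply, Matrix.smul_apply]
      rfl
    have h2 := trace_sum_transpose_mul_self Q
      (fun a => ρ.deriv (Module.finBasis ℝ (GroupLieAlgebra (𝓡 d) G) a))
    simp only [hD]
    rw [← h2, LieRep.casimir, hKinv]
    simp only [Matrix.neg_apply, Complex.ofReal_neg, neg_smul, Finset.sum_neg_distrib,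
      Matrix.trace_neg]

variable (d G) in
/-- In a unitary model of a representation, the derivative at the identity is bounded by the
Casimir. -/
theorem exists_unitary_model_casimir : ∃ C : ℝ, 0 ≤ C ∧ ∀ ρ : LieRep d G, 0 ≤ ρ.casimir.trace.re ∧
    ∃ (U : G →* Matrix (Fin ρ.dim) (Fin ρ.dim) ℂ) (D : Fin ρ.dim → Fin ρ.dim → 𝔼 →L[ℝ] ℂ),
      Continuous U ∧ (∀ g, U g ∈ Matrix.unitaryGroup (Fin ρ.dim) ℂ) ∧
      (∀ g, (U g).trace = ρ.character g) ∧
      (∀ i j, HasFDerivAt (fun u : 𝔼 => U (param G u) i j) (D i j) (chartOrigin d G)) ∧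
      ∀ X, ∑ i, ∑ j, ‖D i j X‖ ^ 2 ≤ C * ‖X‖ ^ 2 * ρ.casimir.trace.re := by
  obtain ⟨N, Y, s, hs, hcas⟩ := exists_casimir_basis d G
  refine ⟨∑ k, ‖s k‖ ^ 2, by positivity, fun ρ => ?_⟩
  obtain ⟨U, D, hUc, hUu, hUt, hUD, htr, -⟩ :=
    exists_unitary_model ρ.continuous_mat ρ.hasFDerivAt_param
  -- The minus sign of the Casimir cancels that of the skew-Hermitian squares, so the trace is a sum
  -- of squared norms.
  have hc : ρ.casimir.trace.re = ∑ k, ∑ i, ∑ j, ‖D i j (Y k)‖ ^ 2 := by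
    rw [hcas]
    simp only [htr, Finset.sum_neg_distrib, neg_neg]
    rw [← Complex.ofReal_sum, Complex.ofReal_re]
  refine ⟨by rw [hc]; positivity, U, D, hUc, hUu, hUt, hUD, fun X => ?_⟩
  have h1 : ∀ i j, ‖D i j X‖ ^ 2 ≤ (∑ k, ‖s k‖ ^ 2) * ‖X‖ ^ 2 * ∑ k, ‖D i j (Y k)‖ ^ 2 := by
    intro i j
    -- Expand `X` in the basis `Y`; Cauchy–Schwarz then separates the coordinates of `X` from the
    -- derivatives along `Y`.
    have h2 : ‖D i j X‖ ≤ ∑ k, ‖s k X‖ * ‖D i j (Y k)‖ := by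
      conv_lhs => rw [hs X]
      rw [map_sum]
      refine (norm_sum_le _ _).trans (Finset.sum_le_sum fun k _ => ?_)
      rw [map_smul, norm_smul]
    have h3 : ∑ k, ‖s k X‖ ^ 2 ≤ (∑ k, ‖s k‖ ^ 2) * ‖X‖ ^ 2 := by
      rw [Finset.sum_mul]
      refine Finset.sum_le_sum fun k _ => ?_
      rw [← mul_pow]
      exact pow_le_pow_left₀ (norm_nonneg _) ((s k).le_opNorm X) 2
    calc ‖D i j X‖ ^ 2 ≤ (∑ k, ‖s k X‖ * ‖D i j (Y k)‖) ^ 2 :=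
          pow_le_pow_left₀ (norm_nonneg _) h2 2
      _ ≤ (∑ k, ‖s k X‖ ^ 2) * ∑ k, ‖D i j (Y k)‖ ^ 2 := Finset.sum_mul_sq_le_sq_mul_sq _ _ _
      _ ≤ _ := mul_le_mul_of_nonneg_right h3 (by positivity)
  rw [hc]
  calc ∑ i, ∑ j, ‖D i j X‖ ^ 2
      ≤ ∑ i, ∑ j, (∑ k, ‖s k‖ ^ 2) * ‖X‖ ^ 2 * ∑ k, ‖D i j (Y k)‖ ^ 2 :=
        Finset.sum_le_sum fun i _ => Finset.sum_le_sum fun j _ => h1 i j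
    _ = (∑ k, ‖s k‖ ^ 2) * ‖X‖ ^ 2 * ∑ k, ∑ i, ∑ j, ‖D i j (Y k)‖ ^ 2 := by
        simp only [← Finset.mul_sum]
        congr 1
        rw [Finset.sum_congr rfl fun i _ => Finset.sum_comm, Finset.sum_comm]

end Casimir

end YangMills

namespace YangMills

/-! ### Unitary representations are Lipschitz in the chart -/

section Lipschitz

open Filter Topology
open scoped Matrix

theorem ofReal_sum_norm_sq {m n : Type*} [Fintype m] [Fintype n] (M : Matrix m n ℂ) :
    ((∑ i, ∑ j, ‖M i j‖ ^ 2 : ℝ) : ℂ) = (Mᴴ * M).trace := by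
  simp only [Matrix.trace, Matrix.diag_apply, Matrix.mul_apply, Matrix.conjTranspose_apply]
  rw [Finset.sum_comm]
  push_cast
  refine Finset.sum_congr rfl fun i _ => Finset.sum_congr rfl fun j _ => ?_
  exact (Complex.conj_mul' _).symm

theorem sum_norm_sq_unitary_mul {n : Type*} [Fintype n] [DecidableEq n] {W : Matrix n n ℂ}
    (hW : W ∈ Matrix.unitaryGroup n ℂ) (M : Matrix n n ℂ) :
    ∑ i, ∑ j, ‖(W * M) i j‖ ^ 2 = ∑ i, ∑ j, ‖M i j‖ ^ 2 := by
  have h := Matrix.mem_unitaryGroup_iff'.1 hW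
  rw [Matrix.star_eq_conjTranspose] at h
  have h2 : (((∑ i, ∑ j, ‖(W * M) i j‖ ^ 2 : ℝ)) : ℂ) = ((∑ i, ∑ j, ‖M i j‖ ^ 2 : ℝ) : ℂ) := by
    rw [ofReal_sum_norm_sq, ofReal_sum_norm_sq, Matrix.conjTranspose_mul, Matrix.mul_assoc,
      ← Matrix.mul_assoc Wᴴ, h, Matrix.one_mul]
  exact_mod_cast h2

variable {d : ℕ} {G : Type*} [TopologicalSpace G] [ChartedSpace (EuclideanSpace ℝ (Fin d)) G]
  [Group G]

local notation "𝔼" => EuclideanSpace ℝ (Fin d)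

variable [LieGroup (𝓡 d) ∞ G]

variable (d G) in
/-- In the chart, left translations near the identity have uniformly bounded derivatives. -/
theorem exists_translation_bound : ∃ r > 0, ∃ L : ℝ, 0 ≤ L ∧
    ∀ u ∈ Metric.ball (chartOrigin d G) r, u ∈ (extChartAt (𝓡 d) (1 : G)).target ∧
      ∃ (ψ : 𝔼 → 𝔼) (ψ' : 𝔼 →L[ℝ] 𝔼), ψ u = chartOrigin d G ∧ HasFDerivAt ψ ψ' u ∧ ‖ψ'‖ ≤ L ∧
        ∀ᶠ v in 𝓝 u, param G v = param G u * param G (ψ v) := by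
  set c := chartOrigin d G
  -- The map `ψ` is `v ↦ u⁻¹ v` in the chart. Its derivative at `u` is a partial derivative of
  -- `inChart f` at the diagonal point `(u, u)`, bounded near the origin by continuity.
  set f : G → G → G := fun a b => a⁻¹ * b
  have h1 : f 1 1 = 1 := by simp [f]
  have hf : ContMDiff ((𝓡 d).prod (𝓡 d)) (𝓡 d) ∞ (fun p : G × G => f p.1 p.2) := contMDiff_inv_mul
  have hs := contDiffAt_inChart (f := f) hf h1
  have hd : ∀ᶠ p in 𝓝 (c, c), DifferentiableAt ℝ (inChart f) p := by
    have := (hs.of_le (m := 1) (by simp)).eventually (by simp)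
    exact this.mono fun p hp => hp.differentiableAt (by simp)
  have hb : ∀ᶠ p in 𝓝 (c, c), ‖fderiv ℝ (inChart f) p‖ ≤ ‖fderiv ℝ (inChart f) (c, c)‖ + 1 := by
    have hc : ContinuousAt (fun p => ‖fderiv ℝ (inChart f) p‖) (c, c) :=
      ((hs.fderiv_right (m := 0) (by simp)).continuousAt).norm
    exact (hc.eventually_lt continuousAt_const (lt_add_one _)).mono fun p hp => hp.le
  have he := (eventually_param_inChart (f := f) hf h1).eventually_nhds
  have hdiag : Tendsto (fun u : 𝔼 => (u, u)) (𝓝 c) (𝓝 (c, c)) :=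
    (continuous_id.prodMk continuous_id).tendsto c
  obtain ⟨r, hr, hball⟩ := Metric.eventually_nhds_iff_ball.1
    ((hdiag.eventually (hd.and (hb.and he))).and (target_mem_nhds (G := G)))
  refine ⟨r, hr, (‖fderiv ℝ (inChart f) (c, c)‖ + 1) * ‖ContinuousLinearMap.inr ℝ 𝔼 𝔼‖,
    by positivity, fun u hu => ?_⟩
  obtain ⟨⟨h2, h3, h4⟩, h5⟩ := hball u hu
  refine ⟨h5, fun v => inChart f (u, v), (fderiv ℝ (inChart f) (u, u)).comp
    (ContinuousLinearMap.inr ℝ 𝔼 𝔼), ?_, ?_, ?_, ?_⟩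
  · simp [inChart, f, c, chartOrigin]
  · exact h2.hasFDerivAt.comp u ((hasFDerivAt_const u u).prodMk (hasFDerivAt_id u))
  · exact (ContinuousLinearMap.opNorm_comp_le _ _).trans
      (mul_le_mul_of_nonneg_right h3 (norm_nonneg _))
  · have : Tendsto (fun v : 𝔼 => (u, v)) (𝓝 u) (𝓝 (u, u)) :=
      (continuous_const.prodMk continuous_id).tendsto u
    filter_upwards [this.eventually h4] with v hv
    rw [hv]
    simp [f]

variable (d G) in
-- Near `w` one has `U(v) = U(w) U(ψ v)`, and multiplication by the unitary `U(w)` preserves the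
-- Hilbert–Schmidt norm. So the derivative at every point of the ball is controlled by the one at
-- the identity, and the mean value inequality on the convex ball finishes. The numbers `r` and `L`
-- come from the group alone, hence serve all representations.
theorem exists_lipschitz : ∃ r > 0, ∃ L : ℝ, 0 ≤ L ∧
    Metric.ball (chartOrigin d G) r ⊆ (extChartAt (𝓡 d) (1 : G)).target ∧
    ∀ (n : ℕ) (U : G →* Matrix (Fin n) (Fin n) ℂ) (D : Fin n → Fin n → 𝔼 →L[ℝ] ℂ) (b : ℝ),
      (∀ g, U g ∈ Matrix.unitaryGroup (Fin n) ℂ) →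
      (∀ i j, HasFDerivAt (fun u : 𝔼 => U (param G u) i j) (D i j) (chartOrigin d G)) →
      0 ≤ b → (∀ X, ∑ i, ∑ j, ‖D i j X‖ ^ 2 ≤ (b * ‖X‖) ^ 2) →
      ∀ u ∈ Metric.ball (chartOrigin d G) r, ∀ v ∈ Metric.ball (chartOrigin d G) r,
        ∑ i, ∑ j, ‖U (param G u) i j - U (param G v) i j‖ ^ 2 ≤ (L * b * ‖u - v‖) ^ 2 := by
  obtain ⟨r, hr, L, hL, hball⟩ := exists_translation_bound d G
  refine ⟨r, hr, L, hL, fun u hu => (hball u hu).1, fun n U D b hU hD hb hDb u hu v hv => ?_⟩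
  -- In this Euclidean space the norm of a matrix is its Hilbert–Schmidt norm.
  let F : 𝔼 → EuclideanSpace ℂ (Fin n × Fin n) := fun u =>
    WithLp.toLp 2 fun p => U (param G u) p.1 p.2
  have key : ∀ w ∈ Metric.ball (chartOrigin d G) r,
      ∃ F' : 𝔼 →L[ℝ] EuclideanSpace ℂ (Fin n × Fin n), HasFDerivAt F F' w ∧ ‖F'‖ ≤ L * b := by
    intro w hw
    obtain ⟨-, ψ, ψ', h1, h2, h3, h4⟩ := hball w hw
    have hent : ∀ p : Fin n × Fin n, HasFDerivAt (fun v : 𝔼 => U (param G v) p.1 p.2)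
        (∑ k, U (param G w) p.1 k • (D k p.2).comp ψ') w := by
      intro p
      have h5 : HasFDerivAt (fun v : 𝔼 => ∑ k, U (param G w) p.1 k * U (param G (ψ v)) k p.2)
          (∑ k, U (param G w) p.1 k • (D k p.2).comp ψ') w := by
        refine HasFDerivAt.fun_sum fun k _ => HasFDerivAt.const_mul ?_ _
        have h6 := hD k p.2
        rw [← h1] at h6
        exact h6.comp w h2
      refine h5.congr_of_eventuallyEq ?_
      filter_upwards [h4] with v hv
      rw [hv, map_mul, Matrix.mul_apply]
    let F' : 𝔼 →L[ℝ] EuclideanSpace ℂ (Fin n × Fin n) :=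
      ((PiLp.continuousLinearEquiv 2 ℝ (fun _ : Fin n × Fin n => ℂ)).symm :
        ((Fin n × Fin n) → ℂ) →L[ℝ] EuclideanSpace ℂ (Fin n × Fin n)).comp
        (ContinuousLinearMap.pi fun p => ∑ k, U (param G w) p.1 k • (D k p.2).comp ψ')
    refine ⟨F', ?_, ?_⟩
    · exact (((PiLp.continuousLinearEquiv 2 ℝ (fun _ : Fin n × Fin n => ℂ)).symm :
        ((Fin n × Fin n) → ℂ) →L[ℝ] EuclideanSpace ℂ (Fin n × Fin n)).hasFDerivAt).comp w
        (hasFDerivAt_pi.2 hent)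
    · refine ContinuousLinearMap.opNorm_le_bound _ (by positivity) fun X => ?_
      refine le_of_sq_le_sq ?_ (by positivity)
      have h7 : ‖F' X‖ ^ 2 = ∑ i, ∑ j, ‖D i j (ψ' X)‖ ^ 2 := by
        rw [EuclideanSpace.norm_sq_eq, Fintype.sum_prod_type]
        refine Eq.trans ?_
          (sum_norm_sq_unitary_mul (hU (param G w)) (Matrix.of fun i j => D i j (ψ' X)))
        refine Finset.sum_congr rfl fun i _ => Finset.sum_congr rfl fun j _ => ?_
        rw [Matrix.mul_apply]
        simp [F']
      rw [h7]
      refine (hDb _).trans ?_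
      have h8 := ψ'.le_of_opNorm_le h3 X
      calc (b * ‖ψ' X‖) ^ 2 ≤ (b * (L * ‖X‖)) ^ 2 := by gcongr
        _ = _ := by ring
  choose! F' hF' hF'b using key
  have h9 := (convex_ball (chartOrigin d G) r).norm_image_sub_le_of_norm_hasFDerivWithin_le
    (f := F) (f' := F') (fun w hw => (hF' w hw).hasFDerivWithinAt) hF'b hv hu
  have h10 : ∑ i, ∑ j, ‖U (param G u) i j - U (param G v) i j‖ ^ 2 = ‖F u - F v‖ ^ 2 := by
    rw [EuclideanSpace.norm_sq_eq, Fintype.sum_prod_type]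
    rfl
  rw [h10]
  gcongr

end Lipschitz

end YangMills

namespace YangMills

/-! ### Counting irreducible representations by their Casimir value -/

section Counting

open Filter Topology
open scoped Matrix

/-- A cube of side `2 r` in dimension `d` is cut into `m ^ d` cells of small diameter. -/
theorem exists_cells {d : ℕ} (c : EuclideanSpace ℝ (Fin d)) {r : ℝ} (hr : 0 < r) {m : ℕ}
    (hm : 0 < m) : ∃ κ : EuclideanSpace ℝ (Fin d) → (Fin d → Fin m),
      ∀ u ∈ Metric.ball c r, ∀ v ∈ Metric.ball c r, κ u = κ v →
        ‖u - v‖ ^ 2 ≤ d * (2 * r / m) ^ 2 := by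
  have hm' : (0 : ℝ) < m := by exact_mod_cast hm
  -- Each coordinate of the cube around the ball is rescaled to `[0, m)`, and the integer part names
  -- the cell.
  let s : EuclideanSpace ℝ (Fin d) → Fin d → ℝ := fun u i => (u i - c i + r) * (m / (2 * r))
  have hs : ∀ u ∈ Metric.ball c r, ∀ i, 0 ≤ s u i ∧ s u i < m := by
    intro u hu i
    have h1 : |u i - c i| < r := by
      have h2 := PiLp.norm_apply_le (u - c) i
      rw [PiLp.sub_apply, Real.norm_eq_abs] at h2
      exact h2.trans_lt (by rwa [← dist_eq_norm])
    rw [abs_lt] at h1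
    have h3 : 0 < m / (2 * r) := by positivity
    refine ⟨mul_nonneg (by linarith) h3.le, ?_⟩
    calc s u i < (2 * r) * (m / (2 * r)) := mul_lt_mul_of_pos_right (by linarith) h3
      _ = m := by field_simp
  -- The remainder mod `m` only matters outside the ball; inside, the integer part is already below
  -- `m`.
  refine ⟨fun u i => ⟨⌊s u i⌋₊ % m, Nat.mod_lt _ hm⟩, fun u hu v hv huv => ?_⟩
  have h1 : ∀ i, |u i - v i| ≤ 2 * r / m := by
    intro i
    have h2 : ⌊s u i⌋₊ % m = ⌊s v i⌋₊ % m := congrArg Fin.val (congrFun huv i)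
    rw [Nat.mod_eq_of_lt ((Nat.floor_lt (hs u hu i).1).2 (hs u hu i).2),
      Nat.mod_eq_of_lt ((Nat.floor_lt (hs v hv i).1).2 (hs v hv i).2)] at h2
    have h3 := Nat.floor_le (hs u hu i).1
    have h4 := Nat.floor_le (hs v hv i).1
    have h5 := Nat.lt_floor_add_one (s u i)
    have h6 := Nat.lt_floor_add_one (s v i)
    rw [h2] at h3 h5
    have h7 : u i - v i = (s u i - s v i) * (2 * r / m) := by
      simp only [s]
      field_simp
      ring
    rw [h7, abs_mul, abs_of_pos (show 0 < 2 * r / (m : ℝ) by positivity)]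
    refine mul_le_of_le_one_left (by positivity) (abs_le.2 ⟨?_, ?_⟩) <;> linarith
  rw [EuclideanSpace.norm_sq_eq]
  calc ∑ i, ‖(u - v) i‖ ^ 2 ≤ ∑ _i : Fin d, (2 * r / m) ^ 2 :=
        Finset.sum_le_sum fun i _ => by
          rw [PiLp.sub_apply, Real.norm_eq_abs]
          exact pow_le_pow_left₀ (abs_nonneg _) (h1 i) 2
    _ = _ := by simp

/-- Expanding `(W - 1)ᴴ (W - 1)` with `Wᴴ W = 1`. This converts closeness to the identity into a
lower bound for the real part of a character. -/
theorem sum_norm_sq_unitary_sub_one {n : ℕ} {W : Matrix (Fin n) (Fin n) ℂ}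
    (hW : W ∈ Matrix.unitaryGroup (Fin n) ℂ) :
    ∑ i, ∑ j, ‖(W - 1) i j‖ ^ 2 = 2 * n - 2 * W.trace.re := by
  have h := Matrix.mem_unitaryGroup_iff'.1 hW
  rw [Matrix.star_eq_conjTranspose] at h
  have h2 := congrArg Complex.re (ofReal_sum_norm_sq (W - 1))
  rw [Complex.ofReal_re] at h2
  rw [h2, Matrix.conjTranspose_sub, Matrix.conjTranspose_one, Matrix.sub_mul, Matrix.mul_sub,
    Matrix.mul_sub, h]
  simp [Matrix.trace_sub, Matrix.trace_conjTranspose]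
  ring

variable {d : ℕ} {G : Type*} [TopologicalSpace G] [ChartedSpace (EuclideanSpace ℝ (Fin d)) G]
  [Group G] [LieGroup (𝓡 d) ∞ G] [IsTopologicalGroup G] [T2Space G] [CompactSpace G]
  [LieAlgebra.IsSimple ℝ (GroupLieAlgebra (𝓡 d) G)]

local notation "𝔼" => EuclideanSpace ℝ (Fin d)

omit [IsTopologicalGroup G] [T2Space G] [CompactSpace G]
  [LieAlgebra.IsSimple ℝ (GroupLieAlgebra (𝓡 d) G)] in
theorem Irr.c₂_mul_dim (l : Irr d G) : l.c₂ * l.rep.dim = l.rep.casimir.trace.re := by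
  have h : (l.rep.dim : ℝ) ≠ 0 := by exact_mod_cast l.dim_pos.ne'
  rw [Irr.c₂, Complex.div_natCast_re, div_mul_cancel₀ _ h]

theorem Irr.c₂_nonneg (l : Irr d G) : 0 ≤ l.c₂ := by
  obtain ⟨C, -, h⟩ := exists_unitary_model_casimir d G
  have h1 : (0 : ℝ) < l.rep.dim := by exact_mod_cast l.dim_pos
  exact nonneg_of_mul_nonneg_left (l.c₂_mul_dim ▸ (h l.rep).1) h1

/-- In a unitary model the inverse is the conjugate transpose, and characters do not see the change
of basis. -/
theorem LieRep.character_inv (ρ : LieRep d G) (g : G) :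
    ρ.character g⁻¹ = star (ρ.character g) := by
  obtain ⟨C, -, h⟩ := exists_unitary_model_casimir d G
  obtain ⟨-, U, D, -, hU, ht, -⟩ := h ρ
  rw [← ht, ← ht, ← Matrix.trace_conjTranspose]
  congr 1
  have h1 := Matrix.mem_unitaryGroup_iff.1 (hU g)
  have h2 : U g⁻¹ * U g = 1 := by rw [← map_mul, inv_mul_cancel, map_one]
  calc U g⁻¹ = U g⁻¹ * (U g * star (U g)) := by rw [h1, mul_one]
    _ = _ := by rw [← mul_assoc, h2, one_mul, Matrix.star_eq_conjTranspose]

theorem LieRep.norm_character_le (ρ : LieRep d G) (g : G) : ‖ρ.character g‖ ≤ ρ.dim := by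
  obtain ⟨C, -, h⟩ := exists_unitary_model_casimir d G
  obtain ⟨-, U, D, -, hU, ht, -⟩ := h ρ
  rw [← ht, Matrix.trace]
  refine (norm_sum_le _ _).trans ?_
  calc ∑ i, ‖(U g).diag i‖ ≤ ∑ _i : Fin ρ.dim, (1 : ℝ) :=
        Finset.sum_le_sum fun i _ => entry_norm_bound_of_unitary (hU g) i i
    _ = ρ.dim := by simp

/-! ### Volume estimates and the polynomial bound -/

variable [MeasurableSpace G] [BorelSpace G]

/-- Parseval for the orthonormal characters; the sum inside is a truncated character of the regular
representation. -/
theorem integral_norm_sq_sum_dim_mul_character (F : Finset (Irr d G)) :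
    ∫ g, ‖∑ l ∈ F, (l.rep.dim : ℂ) * l.rep.character g‖ ^ 2 ∂haarProb G =
      ∑ l ∈ F, (l.rep.dim : ℝ) ^ 2 := by
  classical
  have h1 : ∀ g, ((‖∑ l ∈ F, (l.rep.dim : ℂ) * l.rep.character g‖ ^ 2 : ℝ) : ℂ) = ∑ l ∈ F, ∑ m ∈ F,
      ((l.rep.dim : ℂ) * m.rep.dim) * (l.rep.character g * m.rep.character g⁻¹) := by
    intro g
    push_cast
    rw [← Complex.mul_conj']
    simp only [map_sum, map_mul, Finset.sum_mul_sum, LieRep.character_inv, Complex.conj_natCast]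
    refine Finset.sum_congr rfl fun l _ => Finset.sum_congr rfl fun m _ => ?_
    rw [starRingEnd_apply]
    ring
  have h2 : ∀ l m : Irr d G, Continuous fun g : G =>
      ((l.rep.dim : ℂ) * m.rep.dim) * (l.rep.character g * m.rep.character g⁻¹) := fun l m =>
    continuous_const.mul (l.rep.continuous_character.mul
      (m.rep.continuous_character.comp continuous_inv))
  have h3 : ((∫ g, ‖∑ l ∈ F, (l.rep.dim : ℂ) * l.rep.character g‖ ^ 2 ∂haarProb G : ℝ) : ℂ) = ((∑ l ∈ F, (l.rep.dim : ℝ) ^ 2 : ℝ) : ℂ) := by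
    rw [← integral_complex_ofReal]
    simp only [h1]
    rw [integral_finsetSum _ fun l _ => integrable_finsetSum _ fun m _ =>
      (h2 l m).integrable_haarProb]
    push_cast
    refine Finset.sum_congr rfl fun l hl => ?_
    rw [integral_finsetSum _ fun m _ => (h2 l m).integrable_haarProb]
    simp only [integral_const_mul, Irr.integral_character_mul_inv, mul_ite, mul_one, mul_zero,
      Finset.sum_ite_eq, hl, if_true]
    ring
  exact_mod_cast h3

/-- With `N = ∑ dim²`, the truncated sum `f` has real part at least `N / 2` on this set, while `∫
|f|² = N`. Chebyshev's inequality gives `(N / 2)² q ≤ N`. -/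
theorem sum_dim_sq_mul_measure_le (F : Finset (Irr d G)) :
    (∑ l ∈ F, (l.rep.dim : ℝ) ^ 2) * (haarProb G).real
      {g | ∀ l ∈ F, (l.rep.dim : ℝ) / 2 ≤ (l.rep.character g).re} ≤ 4 := by
  let f : G → ℂ := fun g => ∑ l ∈ F, (l.rep.dim : ℂ) * l.rep.character g
  have hf : Continuous f := continuous_finsetSum _ fun l _ =>
    continuous_const.mul l.rep.continuous_character
  have hint : ∫ g, ‖f g‖ ^ 2 ∂haarProb G = ∑ l ∈ F, (l.rep.dim : ℝ) ^ 2 :=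
    integral_norm_sq_sum_dim_mul_character F
  have hK : ∀ g, (∀ l ∈ F, (l.rep.dim : ℝ) / 2 ≤ (l.rep.character g).re) →
      (∑ l ∈ F, (l.rep.dim : ℝ) ^ 2) / 2 ≤ ‖f g‖ := by
    intro g hg
    refine le_trans ?_ ((le_abs_self _).trans (Complex.abs_re_le_norm (f g)))
    simp only [f, Complex.re_sum, Finset.sum_div]
    refine Finset.sum_le_sum fun l hl => ?_
    have h1 : ((l.rep.dim : ℂ) * l.rep.character g).re =
        l.rep.dim * (l.rep.character g).re := by simp
    rw [h1]
    calc (l.rep.dim : ℝ) ^ 2 / 2 = l.rep.dim * (l.rep.dim / 2) := by ring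
      _ ≤ _ := mul_le_mul_of_nonneg_left (hg l hl) (Nat.cast_nonneg _)
  have hN : 0 ≤ ∑ l ∈ F, (l.rep.dim : ℝ) ^ 2 := Finset.sum_nonneg fun l _ => sq_nonneg _
  clear_value f
  generalize ∑ l ∈ F, (l.rep.dim : ℝ) ^ 2 = N at *
  have hm := mul_meas_ge_le_integral_of_nonneg (μ := haarProb G) (f := fun g => ‖f g‖ ^ 2)
    (Eventually.of_forall fun g => sq_nonneg _)
    (hf.norm.pow 2).integrable_haarProb ((N / 2) ^ 2)
  rw [hint] at hm
  have h5 := measureReal_mono (μ := haarProb G)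
    (s₁ := {g | ∀ l ∈ F, (l.rep.dim : ℝ) / 2 ≤ (l.rep.character g).re})
    (s₂ := {g | (N / 2) ^ 2 ≤ ‖f g‖ ^ 2})
    (fun g hg => by
      rw [Set.mem_ofPred_eq]
      exact pow_le_pow_left₀ (div_nonneg hN zero_le_two) (hK g hg) 2)
  generalize (haarProb G).real
    {g | ∀ l ∈ F, (l.rep.dim : ℝ) / 2 ≤ (l.rep.character g).re} = q at *
  have h6 : (N / 2) ^ 2 * q ≤ N := (mul_le_mul_of_nonneg_left h5 (sq_nonneg _)).trans hm
  -- One factor `N` is cancelled, so `N = 0` is treated apart.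
  rcases hN.eq_or_lt with h0 | h0
  · rw [← h0]; norm_num
  · have h7 : N * (N * q) ≤ N * 4 := by linarith
    exact le_of_mul_le_mul_left h7 h0

variable (d G) in
-- A fixed neighborhood `V` of the identity is cut into `m ^ d` cells, so small that quotients of
-- elements of one cell lie in the set `K` in question. Hence `m ^ d` left translates of `K` cover
-- `V`.
theorem exists_measure_character_bound : ∃ A v : ℝ, 0 ≤ A ∧ 0 < v ∧ ∀ (Λ : ℝ) (m : ℕ), 0 ≤ Λ →
    0 < m → A * Λ ≤ (m : ℝ) ^ 2 → ∀ F : Finset (Irr d G), (∀ l ∈ F, l.c₂ ≤ Λ) →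
      v ≤ (m : ℝ) ^ d * (haarProb G).real
        {g | ∀ l ∈ F, (l.rep.dim : ℝ) / 2 ≤ (l.rep.character g).re} := by
  obtain ⟨C, hC, hmodel⟩ := exists_unitary_model_casimir d G
  obtain ⟨r, hr, L, hL, hsub, hlip⟩ := exists_lipschitz d G
  set c := chartOrigin d G
  let V : Set G := (extChartAt (𝓡 d) (1 : G)).source ∩
    extChartAt (𝓡 d) (1 : G) ⁻¹' Metric.ball c r
  have hV : V ∈ 𝓝 (1 : G) := inter_mem (extChartAt_source_mem_nhds (1 : G))
    ((continuousAt_extChartAt (1 : G)).preimage_mem_nhds (Metric.ball_mem_nhds _ hr))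
  have hVpos : 0 < (haarProb G).real V :=
    ENNReal.toReal_pos (MeasureTheory.Measure.measure_pos_of_mem_nhds (haarProb G) hV).ne' (measure_ne_top _ _)
  -- `A` collects the squared Lipschitz constant, the Casimir constant `C` and the squared diameter
  -- of a cell for `m = 1`; `v` is the volume of `V`.
  refine ⟨L ^ 2 * C * (d * (2 * r) ^ 2), _, by positivity, hVpos,
    fun Λ m hΛ hm hAm F hF => ?_⟩
  set K := {g : G | ∀ l ∈ F, (l.rep.dim : ℝ) / 2 ≤ (l.rep.character g).re}
  obtain ⟨κ, hκ⟩ := exists_cells c hr hm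
  have hm' : (0 : ℝ) < m := by exact_mod_cast hm
  have key : ∀ g ∈ V, ∀ g' ∈ V, κ (extChartAt (𝓡 d) (1 : G) g) = κ (extChartAt (𝓡 d) (1 : G) g') →
      g'⁻¹ * g ∈ K := by
    intro g hg g' hg' hgg l hl
    obtain ⟨-, U, D, -, hU, ht, hUD, hDb⟩ := hmodel l.rep
    have hd : (0 : ℝ) < l.rep.dim := by exact_mod_cast l.dim_pos
    set u := extChartAt (𝓡 d) (1 : G) g
    set v := extChartAt (𝓡 d) (1 : G) g'
    have hu : param G u = g := (extChartAt (𝓡 d) (1 : G)).left_inv hg.1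
    have hv : param G v = g' := (extChartAt (𝓡 d) (1 : G)).left_inv hg'.1
    have h1 := hlip _ U D (√(C * (Λ * l.rep.dim))) hU hUD (Real.sqrt_nonneg _) (fun X => by
      rw [mul_pow, Real.sq_sqrt (by positivity)]
      refine (hDb X).trans ?_
      rw [← Irr.c₂_mul_dim]
      calc C * ‖X‖ ^ 2 * (l.c₂ * l.rep.dim) ≤ C * ‖X‖ ^ 2 * (Λ * l.rep.dim) := by
            have := hF l hl
            gcongr
        _ = _ := by ring) u hg.2 v hg'.2
    rw [mul_pow, mul_pow, Real.sq_sqrt (by positivity), hu, hv] at h1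
    have h2 : ∑ i, ∑ j, ‖U g i j - U g' i j‖ ^ 2 = ∑ i, ∑ j, ‖(U (g'⁻¹ * g) - 1) i j‖ ^ 2 := by
      rw [← sum_norm_sq_unitary_mul (hU g') (U (g'⁻¹ * g) - 1), Matrix.mul_sub, ← map_mul,
        mul_inv_cancel_left, Matrix.mul_one]
      rfl
    rw [h2, sum_norm_sq_unitary_sub_one (hU _), ht] at h1
    have h3 := hκ u hg.2 v hg'.2 hgg
    -- Thus `2 dim - 2 Re χ ≤ dim`, which is the required `Re χ ≥ dim / 2`.
    have h4 : L ^ 2 * (C * (Λ * l.rep.dim)) * ‖u - v‖ ^ 2 ≤ l.rep.dim := by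
      calc L ^ 2 * (C * (Λ * l.rep.dim)) * ‖u - v‖ ^ 2
          ≤ L ^ 2 * (C * (Λ * l.rep.dim)) * (d * (2 * r / m) ^ 2) := by gcongr
        _ = (L ^ 2 * C * (d * (2 * r) ^ 2) * Λ) / (m : ℝ) ^ 2 * l.rep.dim := by
            field_simp
        _ ≤ 1 * l.rep.dim := by
            gcongr
            exact div_le_one_of_le₀ hAm (by positivity)
        _ = _ := one_mul _
    linarith
  have hcov : ∀ k : Fin d → Fin m, ∃ g' : G, ∀ g ∈ V, κ (extChartAt (𝓡 d) (1 : G) g) = k →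
      g'⁻¹ * g ∈ K := by
    intro k
    by_cases h : ∃ g' ∈ V, κ (extChartAt (𝓡 d) (1 : G) g') = k
    · obtain ⟨g', hg', hk⟩ := h
      exact ⟨g', fun g hg hgk => key g hg g' hg' (hgk.trans hk.symm)⟩
    -- For a cell that misses `V` any translate will do.
    · exact ⟨1, fun g hg hgk => absurd ⟨g, hg, hgk⟩ h⟩
  choose γ hγ using hcov
  have hVsub : V ⊆ ⋃ k : Fin d → Fin m, (fun g => (γ k)⁻¹ * g) ⁻¹' K := fun g hg =>
    Set.mem_iUnion.2 ⟨κ (extChartAt (𝓡 d) (1 : G) g), hγ _ g hg rfl⟩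
  calc (haarProb G).real V ≤ (haarProb G).real (⋃ k : Fin d → Fin m, (fun g => (γ k)⁻¹ * g) ⁻¹' K) :=
        measureReal_mono hVsub
    _ ≤ ∑ k : Fin d → Fin m, (haarProb G).real ((fun g => (γ k)⁻¹ * g) ⁻¹' K) :=
        measureReal_iUnion_fintype_le _
    _ = ∑ _k : Fin d → Fin m, (haarProb G).real K := by
        simp only [Measure.real, measure_preimage_mul]
    _ = _ := by simp

variable (d G) in
-- The upper bound `N q ≤ 4` and the lower bound `v ≤ m ^ d q` combine to `N v ≤ 4 m ^ d`.
theorem exists_sum_dim_sq_le : ∃ B : ℝ, 0 ≤ B ∧ ∀ (Λ : ℝ), 0 ≤ Λ → ∀ F : Finset (Irr d G),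
    (∀ l ∈ F, l.c₂ ≤ Λ) → ∑ l ∈ F, (l.rep.dim : ℝ) ^ 2 ≤ B * (Λ + 1) ^ d := by
  obtain ⟨A, v, hA, hv, h⟩ := exists_measure_character_bound d G
  refine ⟨4 * (A + 2) ^ d / v, by positivity, fun Λ hΛ F hF => ?_⟩
  -- Since `m ≥ 1` and `m ≥ A Λ`, also `m² ≥ A Λ`. A choice of order `√Λ` would halve the exponent,
  -- but any polynomial growth suffices.
  set m : ℕ := ⌈A * Λ⌉₊ + 1
  have hm1 : A * Λ ≤ m := by
    have := Nat.le_ceil (A * Λ)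
    simp only [m]; push_cast; linarith
  have hm2 : (m : ℝ) ≤ (A + 2) * (Λ + 1) := by
    have := Nat.ceil_lt_add_one (show 0 ≤ A * Λ by positivity)
    simp only [m]; push_cast; nlinarith
  have hm3 : (1 : ℝ) ≤ m := by simp [m]
  have h1 := h Λ m hΛ (Nat.succ_pos _) (hm1.trans (by nlinarith)) F hF
  have h2 := sum_dim_sq_mul_measure_le F
  set N : ℝ := ∑ l ∈ F, (l.rep.dim : ℝ) ^ 2
  set q := (haarProb G).real {g : G | ∀ l ∈ F, (l.rep.dim : ℝ) / 2 ≤ (l.rep.character g).re}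
  have hN : 0 ≤ N := by positivity
  have h3 : N * v ≤ 4 * (A + 2) ^ d * (Λ + 1) ^ d := by
    calc N * v ≤ N * ((m : ℝ) ^ d * q) := by gcongr
      _ = (m : ℝ) ^ d * (N * q) := by ring
      _ ≤ ((A + 2) * (Λ + 1)) ^ d * 4 := by gcongr
      _ = _ := by rw [mul_pow]; ring
  rw [div_mul_eq_mul_div, le_div_iff₀ hv]
  exact h3

/-- Grouping by the integer part `k` of `c₂`, a group contributes at most a polynomial in `k` times
`exp(-A k)`. -/
theorem summable_dim_sq_mul_exp {A : ℝ} (hA : 0 < A) :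
    Summable fun l : Irr d G => (l.rep.dim : ℝ) ^ 2 * Real.exp (-(l.c₂ * A)) := by
  classical
  obtain ⟨B, hB, h⟩ := exists_sum_dim_sq_le d G
  have hs : Summable fun k : ℕ => B * (((k : ℝ) + 2) ^ d * Real.exp (-A * k)) := by
    refine Summable.mul_left _ ?_
    -- The shift by two turns `(k + 2) ^ d` into a pure power, at the cost of the factor `exp(2 A)`.
    have h1 := (summable_nat_add_iff 2).2 (Real.summable_pow_mul_exp_neg_nat_mul d hA)
    refine (h1.mul_left (Real.exp (2 * A))).congr fun k => ?_
    push_cast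
    rw [mul_left_comm, ← Real.exp_add]
    congr 2
    ring
  refine summable_of_sum_le (c := ∑' k : ℕ, B * (((k : ℝ) + 2) ^ d * Real.exp (-A * k)))
    (fun l => by positivity) fun F => ?_
  rw [← Finset.sum_fiberwise_of_maps_to (t := F.image fun l => ⌊l.c₂⌋₊) (g := fun l => ⌊l.c₂⌋₊)
    (fun l hl => Finset.mem_image_of_mem _ hl)]
  refine le_trans (Finset.sum_le_sum fun k _ => ?_) (hs.sum_le_tsum _ fun k _ => by positivity)
  have h1 : ∀ l ∈ F.filter (fun l => ⌊l.c₂⌋₊ = k), (k : ℝ) ≤ l.c₂ ∧ l.c₂ ≤ k + 1 := by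
    intro l hl
    obtain ⟨-, rfl⟩ := Finset.mem_filter.1 hl
    exact ⟨Nat.floor_le l.c₂_nonneg, (Nat.lt_floor_add_one _).le⟩
  have h2 := h (k + 1) (by positivity) _ fun l hl => (h1 l hl).2
  calc ∑ l ∈ F.filter (fun l => ⌊l.c₂⌋₊ = k), (l.rep.dim : ℝ) ^ 2 * Real.exp (-(l.c₂ * A))
      ≤ ∑ l ∈ F.filter (fun l => ⌊l.c₂⌋₊ = k), (l.rep.dim : ℝ) ^ 2 * Real.exp (-A * k) := by
        refine Finset.sum_le_sum fun l hl => ?_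
        have := (h1 l hl).1
        gcongr
        nlinarith
    _ = (∑ l ∈ F.filter (fun l => ⌊l.c₂⌋₊ = k), (l.rep.dim : ℝ) ^ 2) * Real.exp (-A * k) := by
        rw [Finset.sum_mul]
    _ ≤ (B * ((k + 1 : ℝ) + 1) ^ d) * Real.exp (-A * k) := by gcongr
    _ = _ := by rw [add_assoc]; norm_num; ring

end Counting

end YangMills

namespace YangMills

/-! ### Absolute convergence -/

section Convergence

variable {d : ℕ} {G : Type*} [TopologicalSpace G] [ChartedSpace (EuclideanSpace ℝ (Fin d)) G]
  [Group G]

theorem CellSurface.continuous_regionHol [IsTopologicalGroup G] (S : CellSurface) (g : S.Bdry → G)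
    (r : S.Region) : Continuous fun h : S.Edge → G => S.regionHol g h r := by
  refine continuous_list_prod _ fun s _ => ?_
  rcases s with ⟨e, _ | _⟩ | b
  · exact (continuous_apply e).inv
  · exact continuous_apply e
  · exact continuous_const

variable [LieGroup (𝓡 d) ∞ G] [IsTopologicalGroup G]

theorem OpenGraph.continuous_wilson {S : CellSurface} (Γ : OpenGraph d G S) (y : Γ.LegIndex) :
    Continuous fun h : S.Edge → G => Γ.wilson h y := by
  unfold OpenGraph.wilson
  refine continuous_finsetSum _ fun x _ => continuous_const.mul
    (continuous_finsetProd _ fun e _ => ?_)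
  exact ((Γ.color e).continuous_mat_apply _ _).comp (continuous_apply e).inv

variable [T2Space G] [CompactSpace G] [LieAlgebra.IsSimple ℝ (GroupLieAlgebra (𝓡 d) G)]

/-- A character is bounded by the dimension, and since `dim ≥ 1` genus zero is the worst case. The
bound is uniform in `x`, as the Weierstrass test requires. -/
theorem norm_regionTerm_le (genus : ℕ) (A : ℝ) (x : G) (l : Irr d G) :
    ‖regionTerm genus A x l‖ ≤ (l.rep.dim : ℝ) ^ 2 * Real.exp (-(l.c₂ * A)) := by
  have h1 : (1 : ℝ) ≤ l.rep.dim := by exact_mod_cast l.dim_pos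
  have h2 : (l.rep.dim : ℝ) ^ (1 - 2 * (genus : ℤ)) ≤ l.rep.dim := by
    calc (l.rep.dim : ℝ) ^ (1 - 2 * (genus : ℤ)) ≤ (l.rep.dim : ℝ) ^ (1 : ℤ) :=
          zpow_le_zpow_right₀ h1 (by omega)
      _ = _ := zpow_one _
  have h3 := l.rep.norm_character_le x
  rw [regionTerm, norm_mul, norm_mul, norm_zpow, Complex.norm_natCast, Complex.norm_real,
    Real.norm_of_nonneg (Real.exp_pos _).le, sq]
  gcongr

variable [MeasurableSpace G] [BorelSpace G]

theorem summable_regionTerm (genus : ℕ) {A : ℝ} (hA : 0 < A) (x : G) :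
    Summable fun l : Irr d G => regionTerm genus A x l :=
  Summable.of_norm_bounded (summable_dim_sq_mul_exp hA) (norm_regionTerm_le genus A x)

theorem continuous_regionZ (genus : ℕ) {A : ℝ} (hA : 0 < A) :
    Continuous fun x : G => regionZ d genus A x :=
  continuous_tsum (fun l => (l.rep.continuous_character.mul continuous_const).mul continuous_const)
    (summable_dim_sq_mul_exp (d := d) (G := G) hA) fun l x => norm_regionTerm_le genus A x l

theorem OpenGraph.continuous_integrand {S : CellSurface} (Γ : OpenGraph d G S) (g : S.Bdry → G)
    (y : Γ.LegIndex) : Continuous (Γ.integrand g y) :=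
  (continuous_finsetProd _ fun r _ => (continuous_regionZ (S.genus r) (S.area_pos r)).comp
    (S.continuous_regionHol g r)).mul (Γ.continuous_wilson y)

theorem OpenGraph.integrable_integrand {S : CellSurface} (Γ : OpenGraph d G S) (g : S.Bdry → G)
    (y : Γ.LegIndex) : Integrable (Γ.integrand g y) (Measure.pi fun _ => haarProb G) := by
  -- Second countability makes the product σ-algebra on `S.Edge → G` the Borel one, so that
  -- continuous functions are measurable for it.
  have : SecondCountableTopology G :=
    ChartedSpace.secondCountable_of_sigmaCompact (EuclideanSpace ℝ (Fin d)) G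
  exact (Γ.continuous_integrand g y).integrable_of_hasCompactSupport
    (HasCompactSupport.of_compactSpace _)

theorem OpenGraph.converges {S : CellSurface} (Γ : OpenGraph d G S) : Γ.Converges :=
  ⟨fun r x => summable_regionTerm (S.genus r) (S.area_pos r) x, Γ.integrable_integrand⟩

end Convergence

end YangMills

namespace YangMills

/-! ### Invariant tensors -/

section Tensor

variable {d : ℕ} {G : Type*} [TopologicalSpace G] [ChartedSpace (EuclideanSpace ℝ (Fin d)) G]
  [Group G]

theorem LieRep.mat_cast {ρ σ : LieRep d G} (h : ρ = σ) (g : G) (i j : Fin ρ.dim) :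
    σ.mat g (Fin.cast (congrArg LieRep.dim h) i) (Fin.cast (congrArg LieRep.dim h) j) =
      ρ.mat g i j := by
  subst h; rfl

open Classical in
/-- The tensor `T`, with one index for each factor `R k`, is fixed by the group element `g`. -/
def TensorFixed {K : Type*} [Fintype K] (R : K → LieRep d G) (g : G)
    (T : (∀ k, Fin (R k).dim) → ℂ) : Prop :=
  ∀ x, ∑ y, (∏ k, (R k).mat g (x k) (y k)) * T y = T x

/-- The representing matrix of a tensor product is a product of entries, so the sum over all
multi-indices factors into the sums for the single tensors. The casts are present because `R (e ⟨i,
k⟩)` and `Q i k` are equal only by hypothesis. -/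
theorem TensorFixed.prod {ι K : Type*} [Fintype ι] [Fintype K]
    {L : ι → Type*} [∀ i, Fintype (L i)] (e : (Σ i, L i) ≃ K)
    {R : K → LieRep d G} {Q : ∀ i, L i → LieRep d G} (hR : ∀ i k, R (e ⟨i, k⟩) = Q i k) {g : G}
    {T : ∀ i, (∀ k, Fin (Q i k).dim) → ℂ} (hT : ∀ i, TensorFixed (Q i) g (T i))
    {S : (∀ k, Fin (R k).dim) → ℂ}
    (hS : ∀ x, S x = ∏ i, T i fun k => Fin.cast (congrArg LieRep.dim (hR i k)) (x (e ⟨i, k⟩))) :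
    TensorFixed R g S := by
  classical
  intro x
  let Φ : (∀ k, Fin (R k).dim) ≃ ∀ i, ∀ k, Fin (Q i k).dim :=
    (Equiv.piCongrLeft (fun k => Fin (R k).dim) e).symm.trans
      ((Equiv.piCurry fun i k => Fin (R (e ⟨i, k⟩)).dim).trans
        (Equiv.piCongrRight fun i => Equiv.piCongrRight fun k =>
          finCongr (congrArg LieRep.dim (hR i k))))
  have hΦ : ∀ x i k, Φ x i k = Fin.cast (congrArg LieRep.dim (hR i k)) (x (e ⟨i, k⟩)) :=
    fun _ _ _ => rfl
  have hS' : ∀ x, S x = ∏ i, T i (Φ x i) := hS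
  rw [hS' x, Fintype.sum_equiv Φ _ (fun z => ∏ i, (∏ k, (Q i k).mat g (Φ x i k) (z i k)) * T i (z i))]
  · rw [← Fintype.piFinset_univ]
    refine (Finset.prod_univ_sum (fun _ => Finset.univ) fun i (z : ∀ k, Fin (Q i k).dim) =>
      (∏ k, (Q i k).mat g (Φ x i k) (z k)) * T i z).symm.trans ?_
    exact Finset.prod_congr rfl fun i _ => hT i (Φ x i)
  · intro y
    rw [hS' y, Finset.prod_mul_distrib, ← Equiv.prod_comp e, Fintype.prod_sigma]
    refine congrArg (· * _) (Finset.prod_congr rfl fun i _ => Finset.prod_congr rfl fun k _ => ?_)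
    rw [hΦ, hΦ]
    exact (LieRep.mat_cast (hR i k) g _ _).symm

theorem sum_sum_mul_delta {n : ℕ} (a b : Fin n → ℂ) :
    ∑ i, ∑ j, a i * b j * (if i.val = j.val then 1 else 0) = ∑ i, a i * b i := by
  simp only [← Fin.ext_iff, mul_ite, mul_one, mul_zero, Finset.sum_ite_eq, Finset.mem_univ,
    if_true]

theorem one_apply_val {n : ℕ} (i j : Fin n) :
    (1 : Matrix (Fin n) (Fin n) ℂ) i j = if i.val = j.val then 1 else 0 := by
  simp only [Matrix.one_apply, Fin.ext_iff]

/-- Families over `Bool` as pairs. -/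
def piCondEquiv (A B : LieRep d G) :
    (∀ t : Bool, Fin (cond t A B).dim) ≃ Fin A.dim × Fin B.dim where
  toFun x := (x true, x false)
  invFun p := fun
    | true => p.1
    | false => p.2
  left_inv x := by funext t; cases t <;> rfl
  right_inv _ := rfl

variable [LieGroup (𝓡 d) ∞ G]

/-- The canonical vector in the tensor product of `V_μ` and its dual is invariant. -/
theorem TensorFixed.pair (μ : LieRep d G) (b : Bool) (g : G) :
    TensorFixed (fun t : Bool => cond t (μ.signed b) (μ.signed !b)) g
      (fun x => if (x true).val = (x false).val then 1 else 0) := by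
  classical
  intro x
  -- Contracting the matrices of `V_μ` and its dual with a delta multiplies the matrices of `g` and
  -- `g⁻¹`; both orders of the factors lead to this identity.
  have h1 : μ.mat g * μ.mat g⁻¹ = 1 := by rw [← map_mul, mul_inv_cancel, map_one]
  refine (@Fintype.sum_equiv _ _ _ (_) _ _ (piCondEquiv _ _) _ (fun z => (μ.signed b).mat g (x true) z.1 *
    (μ.signed !b).mat g (x false) z.2 * if z.1.val = z.2.val then 1 else 0)
    (fun y => congrArg₂ (· * ·) (Fintype.prod_bool fun t => (cond t (μ.signed b) (μ.signed !b)).mat g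
      (x t) (y t)) rfl)).trans ?_
  rw [Fintype.sum_prod_type]
  cases b
  · have h2 := congrFun (congrFun h1 (x false)) (x true)
    refine (sum_sum_mul_delta (fun i => μ.mat g⁻¹ i (x true)) (μ.mat g (x false))).trans
      ((Finset.sum_congr rfl fun i _ => mul_comm _ _).trans ?_)
    exact (Matrix.mul_apply.symm.trans h2).trans
      ((one_apply_val _ _).trans (if_congr eq_comm rfl rfl))
  · have h2 := congrFun (congrFun h1 (x true)) (x false)
    exact (sum_sum_mul_delta (μ.mat g (x true)) (fun j => μ.mat g⁻¹ j (x false))).trans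
      ((Matrix.mul_apply.symm.trans h2).trans (one_apply_val _ _))

end Tensor

end YangMills

namespace YangMills

/-! ### The glued graphs have invariant vertex vectors -/

section Invariance

section Merge

variable {d : ℕ} {G : Type*} [TopologicalSpace G] [ChartedSpace (EuclideanSpace ℝ (Fin d)) G]
  [Group G]

theorem TensorFixed.congr_fintype {K : Type*} {i j : Fintype K} {R : K → LieRep d G} {g : G}
    {T : (∀ k, Fin (R k).dim) → ℂ} (h : @TensorFixed _ _ _ _ _ _ i R g T) :
    @TensorFixed _ _ _ _ _ _ j R g T :=
  Subsingleton.elim i j ▸ h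

/-- The version for two families of tensors: vectors of the old vertices, and either those of a
second graph or the canonical vectors of the new line. -/
theorem TensorFixed.prod_sum {A B K : Type} [Fintype A] [Fintype B] [Fintype K]
    {L : A → Type} {L' : B → Type} [∀ a, Fintype (L a)]
    [∀ b, Fintype (L' b)] {f : (Σ a, L a) ⊕ (Σ b, L' b) → K}
    (hf : Function.Bijective f) {R : K → LieRep d G} {Q : ∀ a, L a → LieRep d G}
    {Q' : ∀ b, L' b → LieRep d G} (hR : ∀ a k, R (f (Sum.inl ⟨a, k⟩)) = Q a k)
    (hR' : ∀ b k, R (f (Sum.inr ⟨b, k⟩)) = Q' b k) {g : G}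
    {T : ∀ a, (∀ k, Fin (Q a k).dim) → ℂ} (hT : ∀ a, TensorFixed (Q a) g (T a))
    {T' : ∀ b, (∀ k, Fin (Q' b k).dim) → ℂ} (hT' : ∀ b, TensorFixed (Q' b) g (T' b))
    {S : (∀ k, Fin (R k).dim) → ℂ}
    (hS : ∀ x, S x =
      (∏ a, T a fun k => Fin.cast (congrArg LieRep.dim (hR a k)) (x (f (Sum.inl ⟨a, k⟩)))) *
        ∏ b, T' b fun k => Fin.cast (congrArg LieRep.dim (hR' b k)) (x (f (Sum.inr ⟨b, k⟩)))) :
    TensorFixed R g S := by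
  have inst : ∀ i : A ⊕ B, Fintype (Sum.elim L L' i) := by
    rintro (a | b)
    · exact inferInstanceAs (Fintype (L a))
    · exact inferInstanceAs (Fintype (L' b))
  let N : ∀ i : A ⊕ B, Sum.elim L L' i → LieRep d G := Sum.rec Q Q'
  let e : (Σ i : A ⊕ B, Sum.elim L L' i) ≃ K :=
    (Equiv.sumSigmaDistrib (Sum.elim L L')).trans (Equiv.ofBijective f hf)
  have hN : ∀ i k, R (e ⟨i, k⟩) = N i k := by
    rintro (a | b) k
    · exact hR a k
    · exact hR' b k
  let W : ∀ i, (∀ k, Fin (N i k).dim) → ℂ := Sum.rec T T'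
  refine TensorFixed.prod e hN (T := W) ?_ fun x => ?_
  · rintro (a | b)
    · exact (hT a).congr_fintype
    · exact (hT' b).congr_fintype
  · rw [hS, Fintype.prod_sum_type]
    rfl

/-- The half-edges at a vertex which arises by merging vertices. -/
def mergeFiber {H₁ H₂ H' V₁ V₂ V' : Type} {v₁ : H₁ → V₁} {v₂ : H₂ → V₂} {v' : H' → V'}
    {φ₁ : V₁ → V'} {φ₂ : V₂ → V'} (f : H₁ ⊕ H₂ ≃ H') (h₁ : ∀ k, v' (f (Sum.inl k)) = φ₁ (v₁ k))
    (h₂ : ∀ k, v' (f (Sum.inr k)) = φ₂ (v₂ k)) (v : V') :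
    (Σ u : {u // φ₁ u = v}, {k // v₁ k = u.1}) ⊕ (Σ u : {u // φ₂ u = v}, {k // v₂ k = u.1}) →
      {k // v' k = v}
  | Sum.inl ⟨u, k⟩ => ⟨f (Sum.inl k.1), (h₁ k.1).trans ((congrArg φ₁ k.2).trans u.2)⟩
  | Sum.inr ⟨u, k⟩ => ⟨f (Sum.inr k.1), (h₂ k.1).trans ((congrArg φ₂ k.2).trans u.2)⟩

/-- A half-edge determines the old vertex to which it belongs, so the half-edges at a merged vertex
are partitioned by the old vertices over it. -/
theorem mergeFiber_bijective {H₁ H₂ H' V₁ V₂ V' : Type} {v₁ : H₁ → V₁} {v₂ : H₂ → V₂}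
    {v' : H' → V'} {φ₁ : V₁ → V'} {φ₂ : V₂ → V'} (f : H₁ ⊕ H₂ ≃ H')
    (h₁ : ∀ k, v' (f (Sum.inl k)) = φ₁ (v₁ k)) (h₂ : ∀ k, v' (f (Sum.inr k)) = φ₂ (v₂ k))
    (v : V') : Function.Bijective (mergeFiber f h₁ h₂ v) := by
  constructor
  · rintro (⟨⟨u, hu⟩, k, hk⟩ | ⟨⟨u, hu⟩, k, hk⟩) (⟨⟨u', hu'⟩, k', hk'⟩ | ⟨⟨u', hu'⟩, k', hk'⟩) h
    all_goals
      have h0 := f.injective (congrArg Subtype.val h)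
      simp only [Sum.inl.injEq, Sum.inr.injEq, reduceCtorEq] at h0
    all_goals
      subst h0
      dsimp only at hk hk'
      subst hk
      subst hk'
      rfl
  · rintro ⟨k', hk'⟩
    obtain ⟨k | k, rfl⟩ := f.surjective k'
    · exact ⟨Sum.inl ⟨⟨v₁ k, (h₁ k).symm.trans hk'⟩, k, rfl⟩, rfl⟩
    · exact ⟨Sum.inr ⟨⟨v₂ k, (h₂ k).symm.trans hk'⟩, k, rfl⟩, rfl⟩

/-- The product of invariant vectors at the vertices which are merged into one is invariant. -/
theorem TensorFixed.merge {H₁ H₂ H' V₁ V₂ V' : Type} {v₁ : H₁ → V₁} {v₂ : H₂ → V₂}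
    {v' : H' → V'} {φ₁ : V₁ → V'} {φ₂ : V₂ → V'} (f : H₁ ⊕ H₂ ≃ H')
    (h₁ : ∀ k, v' (f (Sum.inl k)) = φ₁ (v₁ k)) (h₂ : ∀ k, v' (f (Sum.inr k)) = φ₂ (v₂ k))
    {v : V'} [Fintype {u // φ₁ u = v}] [Fintype {u // φ₂ u = v}] [Fintype {k // v' k = v}]
    [∀ u, Fintype {k // v₁ k = u}] [∀ u, Fintype {k // v₂ k = u}]
    {R : H' → LieRep d G} {Q₁ : H₁ → LieRep d G} {Q₂ : H₂ → LieRep d G}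
    (hR₁ : ∀ k, R (f (Sum.inl k)) = Q₁ k) (hR₂ : ∀ k, R (f (Sum.inr k)) = Q₂ k) {g : G}
    {T₁ : ∀ u, (∀ k : {k // v₁ k = u}, Fin (Q₁ k.1).dim) → ℂ}
    {T₂ : ∀ u, (∀ k : {k // v₂ k = u}, Fin (Q₂ k.1).dim) → ℂ}
    (hT₁ : ∀ u, TensorFixed (fun k : {k // v₁ k = u} => Q₁ k.1) g (T₁ u))
    (hT₂ : ∀ u, TensorFixed (fun k : {k // v₂ k = u} => Q₂ k.1) g (T₂ u))
    {S : (∀ k : {k // v' k = v}, Fin (R k.1).dim) → ℂ}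
    (hS : ∀ x, S x =
      (∏ u : {u // φ₁ u = v}, T₁ u.1 fun k => Fin.cast (congrArg LieRep.dim (hR₁ k.1))
        (x ⟨f (Sum.inl k.1), (h₁ k.1).trans ((congrArg φ₁ k.2).trans u.2)⟩)) *
      ∏ u : {u // φ₂ u = v}, T₂ u.1 fun k => Fin.cast (congrArg LieRep.dim (hR₂ k.1))
        (x ⟨f (Sum.inr k.1), (h₂ k.1).trans ((congrArg φ₂ k.2).trans u.2)⟩)) :
    TensorFixed (fun k : {k // v' k = v} => R k.1) g S :=
  TensorFixed.prod_sum (mergeFiber_bijective f h₁ h₂ v)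
    (Q := fun u (k : {k // v₁ k = u.1}) => Q₁ k.1) (Q' := fun u (k : {k // v₂ k = u.1}) => Q₂ k.1)
    (fun _ k => hR₁ k.1) (fun _ k => hR₂ k.1) (fun u => hT₁ u.1) (fun u => hT₂ u.1) hS

/-- The canonical vector in the tensor product of `V_μ` and its dual, with the two factors
labelled by the fiber of a projection. -/
theorem TensorFixed.pair_fiber [LieGroup (𝓡 d) ∞ G] {B : Type} (b : B)
    [Fintype {k : B × Bool // k.1 = b}] (μ : LieRep d G) (s : B → Bool) (g : G) :
    TensorFixed (fun k : {k : B × Bool // k.1 = b} =>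
      cond k.1.2 (μ.signed (s k.1.1)) (μ.signed !(s k.1.1))) g
      (fun x => if (x ⟨(b, true), rfl⟩).val = (x ⟨(b, false), rfl⟩).val then 1 else 0) := by
  let e : (Σ _ : Unit, Bool) ≃ {k : B × Bool // k.1 = b} :=
    { toFun := fun p => ⟨(b, p.2), rfl⟩
      invFun := fun k => ⟨(), k.1.2⟩
      left_inv := fun _ => rfl
      right_inv := by rintro ⟨⟨b', t⟩, rfl⟩; rfl }
  refine TensorFixed.prod e (Q := fun _ t => cond t (μ.signed (s b)) (μ.signed !(s b)))
    (fun _ _ => rfl) (fun _ => TensorFixed.pair μ (s b) g) fun x => ?_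
  rw [Fintype.prod_unique]
  rfl

end Merge

variable {d : ℕ} {G : Type*} [TopologicalSpace G] [ChartedSpace (EuclideanSpace ℝ (Fin d)) G]
  [Group G] [LieGroup (𝓡 d) ∞ G]

theorem OpenGraph.isInvariant_iff {S : CellSurface} (Γ : OpenGraph d G S) : Γ.IsInvariant ↔
    ∀ (v : S.Vertex) (g : G),
      TensorFixed (fun k : {k : Γ.Half // Γ.vertexOf k = v} => Γ.halfRep k.1) g (Γ.tensor v) := by
  refine forall₂_congr fun v g => forall_congr' fun x => Eq.congr ?_ rfl
  congr!

/-- The half-edges of a disjoint union. -/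
def unionHalf (E L E' L' : Type) :
    (E × Bool ⊕ L) ⊕ (E' × Bool ⊕ L') ≃ (E ⊕ E') × Bool ⊕ (L ⊕ L') where
  toFun
    | Sum.inl (Sum.inl p) => Sum.inl (Sum.inl p.1, p.2)
    | Sum.inl (Sum.inr l) => Sum.inr (Sum.inl l)
    | Sum.inr (Sum.inl p) => Sum.inl (Sum.inr p.1, p.2)
    | Sum.inr (Sum.inr l) => Sum.inr (Sum.inr l)
  invFun
    | Sum.inl (Sum.inl e, s) => Sum.inl (Sum.inl (e, s))
    | Sum.inl (Sum.inr e, s) => Sum.inr (Sum.inl (e, s))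
    | Sum.inr (Sum.inl l) => Sum.inl (Sum.inr l)
    | Sum.inr (Sum.inr l) => Sum.inr (Sum.inr l)
  left_inv := by rintro ((_ | _) | (_ | _)) <;> rfl
  right_inv := by rintro (⟨_ | _, _⟩ | _ | _) <;> rfl

/-- The half-edges after adding an edge with two outer ends. -/
def glueHalf (E L : Type) :
    (E × Bool ⊕ L) ⊕ (Bool × Bool) ≃ Option E × Bool ⊕ (L ⊕ Bool) where
  toFun
    | Sum.inl (Sum.inl p) => Sum.inl (some p.1, p.2)
    | Sum.inl (Sum.inr l) => Sum.inr (Sum.inl l)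
    | Sum.inr (b, true) => Sum.inl (none, b)
    | Sum.inr (b, false) => Sum.inr (Sum.inr b)
  invFun
    | Sum.inl (some e, s) => Sum.inl (Sum.inl (e, s))
    | Sum.inl (none, b) => Sum.inr (b, true)
    | Sum.inr (Sum.inl l) => Sum.inl (Sum.inr l)
    | Sum.inr (Sum.inr b) => Sum.inr (b, false)
  left_inv := by rintro ((_ | _) | ⟨_, _ | _⟩) <;> rfl
  right_inv := by rintro (⟨_ | _, _⟩ | _ | _) <;> rfl

open Classical in
/-- The half-edges after adding an edge which prolongs the outer edge `l₀`. -/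
noncomputable def transportHalf (E : Type) {L : Type} (l₀ : L) :
    (E × Bool ⊕ L) ⊕ (Unit × Bool) ≃ Option E × Bool ⊕ L where
  toFun
    | Sum.inl (Sum.inl p) => Sum.inl (some p.1, p.2)
    | Sum.inl (Sum.inr l) => if l = l₀ then Sum.inl (none, true) else Sum.inr l
    | Sum.inr (_, true) => Sum.inl (none, false)
    | Sum.inr (_, false) => Sum.inr l₀
  invFun
    | Sum.inl (some e, s) => Sum.inl (Sum.inl (e, s))
    | Sum.inl (none, true) => Sum.inl (Sum.inr l₀)
    | Sum.inl (none, false) => Sum.inr ((), true)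
    | Sum.inr l => if l = l₀ then Sum.inr ((), false) else Sum.inl (Sum.inr l)
  left_inv := by
    rintro ((_ | l) | ⟨_, _ | _⟩)
    · rfl
    · by_cases h : l = l₀ <;> simp [h]
    · simp
    · rfl
  right_inv := by
    rintro (⟨_ | _, _ | _⟩ | l)
    · rfl
    · simp
    · rfl
    · rfl
    · by_cases h : l = l₀ <;> simp [h]

namespace OpenGraph

variable {S T : CellSurface}

theorem IsInvariant.union {Γ : OpenGraph d G S} {Δ : OpenGraph d G T} (hΓ : Γ.IsInvariant)
    (hΔ : Δ.IsInvariant) : (Γ.union Δ).IsInvariant := by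
  classical
  rw [isInvariant_iff] at *
  intro v g
  refine TensorFixed.merge (v₁ := Γ.vertexOf) (v₂ := Δ.vertexOf) (v' := (Γ.union Δ).vertexOf)
    (φ₁ := S.inlVertex T) (φ₂ := S.inrVertex T) (R := (Γ.union Δ).halfRep) (Q₁ := Γ.halfRep)
    (Q₂ := Δ.halfRep) (T₁ := Γ.tensor) (T₂ := Δ.tensor)
    (unionHalf S.Edge Γ.Leg T.Edge Δ.Leg) ?_ ?_ ?_ ?_ (fun u => hΓ u g) (fun u => hΔ u g)
    fun x => ?_
  · rintro (_ | _) <;> rfl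
  · rintro (_ | _) <;> rfl
  · rintro (_ | _) <;> rfl
  · rintro (_ | _) <;> rfl
  · refine congrArg₂ (· * ·) (Finset.prod_congr ?_ fun u _ => congrArg (Γ.tensor u.1) ?_)
      (Finset.prod_congr ?_ fun u _ => congrArg (Δ.tensor u.1) ?_)
    · congr!
    · funext ⟨k, hk⟩
      rcases k with p | l <;> rfl
    · congr!
    · funext ⟨k, hk⟩
      rcases k with p | l <;> rfl

variable {e e' : S.Bdry}

/-- Each end of the new line is treated as an auxiliary vertex, labelled by `Bool`, with two
half-edges: the end itself and the outer edge continuing it. Gluing then merges old and auxiliary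
vertices. -/
theorem IsInvariant.glue {Γ : OpenGraph d G S} (hΓ : Γ.IsInvariant) (hne : e ≠ e')
    (μ : LieRep d G) : (Γ.glue hne μ).IsInvariant := by
  classical
  rw [isInvariant_iff] at *
  intro v g
  refine TensorFixed.merge (v₁ := Γ.vertexOf) (v₂ := Prod.fst) (v' := (Γ.glue hne μ).vertexOf)
    (φ₁ := S.glueVertex hne) (φ₂ := fun b : Bool => (S.glue hne).src (Sum.inl (none, b)))
    (R := (Γ.glue hne μ).halfRep) (Q₁ := Γ.halfRep)
    (Q₂ := fun k => cond k.2 (μ.signed k.1) (μ.signed !k.1)) (T₁ := Γ.tensor)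
    (T₂ := fun b x => if (x ⟨(b, true), rfl⟩).val = (x ⟨(b, false), rfl⟩).val then 1 else 0)
    (glueHalf S.Edge Γ.Leg) ?_ ?_ ?_ ?_ (fun u => hΓ u g)
    (fun b => TensorFixed.pair_fiber b μ id g) fun x => ?_
  · rintro (_ | _) <;> rfl
  · rintro ⟨_, _ | _⟩ <;> rfl
  · rintro (_ | _) <;> rfl
  · rintro ⟨_, _ | _⟩ <;> rfl
  · refine congrArg₂ (· * ·) (Finset.prod_congr ?_ fun u _ => congrArg (Γ.tensor u.1) ?_) ?_
    · congr!
    · funext ⟨k, hk⟩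
      rcases k with p | l <;> rfl
    · refine (Fintype.prod_dite _ _).trans ?_
      rw [Finset.prod_const_one, mul_one]
      rfl

/-- Comparing values in `ℕ` avoids the cast for `l₀`, whose place is taken by the beginning of the
new edge. -/
theorem transportIndex_val (Γ : Coloring d G S) (hne : e ≠ e') (l₀ : Γ.Leg)
    (hl₀ : Γ.legVertex l₀ = S.src (Sum.inr e')) (v : (S.glue hne).Vertex)
    (x : (transportColoring Γ hne l₀).VertexIndex v) (u : S.Vertex)
    (hu : S.glueVertex hne u = v) (k : {k : Γ.Half // Γ.vertexOf k = u})
    (j : {k : (transportColoring Γ hne l₀).Half // (transportColoring Γ hne l₀).vertexOf k = v})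
    (hj : j.1 = transportHalf S.Edge l₀ (Sum.inl k.1)) :
    (transportIndex Γ hne l₀ hl₀ v x u hu k).val = (x j).val := by
  obtain ⟨j, hj'⟩ := j
  obtain ⟨p | l, hk⟩ := k
  · obtain rfl := hj
    rfl
  · by_cases h : l = l₀
    · obtain rfl : j = Sum.inl (none, true) := hj.trans (if_pos h)
      exact congrArg Fin.val (dif_pos h)
    · obtain rfl : j = Sum.inr l := hj.trans (if_neg h)
      exact congrArg Fin.val (dif_neg h)

/-- Here only one auxiliary vertex appears, at the end of the new line; the beginning of the line
replaces the outer edge in the old vector. -/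
theorem IsInvariant.glueTransport {Γ : OpenGraph d G S} (hΓ : Γ.IsInvariant) (hne : e ≠ e')
    (l₀ : Γ.Leg) (hl₀ : Γ.legVertex l₀ = S.src (Sum.inr e')) :
    (Γ.glueTransport hne l₀ hl₀).IsInvariant := by
  classical
  rw [isInvariant_iff] at *
  intro v g
  refine TensorFixed.merge (v₁ := Γ.vertexOf) (v₂ := Prod.fst)
    (v' := (Γ.glueTransport hne l₀ hl₀).vertexOf)
    (φ₁ := S.glueVertex hne) (φ₂ := fun _ : Unit => (S.glue hne).src (Sum.inl (none, false)))
    (R := (Γ.glueTransport hne l₀ hl₀).halfRep) (Q₁ := Γ.halfRep)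
    (Q₂ := fun k => cond k.2 ((Γ.legRep l₀).signed false) ((Γ.legRep l₀).signed !false))
    (T₁ := Γ.tensor)
    (T₂ := fun b x => if (x ⟨(b, true), rfl⟩).val = (x ⟨(b, false), rfl⟩).val then 1 else 0)
    (transportHalf S.Edge l₀) ?_ ?_ ?_ ?_ (fun u => hΓ u g)
    (fun b => TensorFixed.pair_fiber b (Γ.legRep l₀) (fun _ => false) g) fun x => ?_
  · rintro (_ | l)
    · rfl
    · by_cases h : l = l₀
      · refine (congrArg (Γ.glueTransport hne l₀ hl₀).vertexOf (if_pos h)).trans ?_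
        refine (S.glueVertex_right hne).symm.trans (congrArg _ (hl₀.symm.trans ?_))
        rw [h]
        rfl
      · exact (congrArg (Γ.glueTransport hne l₀ hl₀).vertexOf (if_neg h)).trans (if_neg h)
  · rintro ⟨_, _ | _⟩
    · exact if_pos rfl
    · rfl
  · rintro (_ | l)
    · rfl
    · by_cases h : l = l₀
      · refine (congrArg (Γ.glueTransport hne l₀ hl₀).halfRep (if_pos h)).trans ?_
        rw [h]
        rfl
      · exact congrArg (Γ.glueTransport hne l₀ hl₀).halfRep (if_neg h)
  · rintro ⟨_, _ | _⟩ <;> rfl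
  · refine congrArg₂ (· * ·) (Finset.prod_congr ?_ fun u _ => congrArg (Γ.tensor u.1) ?_) ?_
    · congr!
    · funext k
      exact Fin.ext (transportIndex_val _ _ _ _ _ _ _ _ _ _ rfl)
    · refine Eq.trans ?_ ((Fintype.prod_dite (α := Unit)
        (p := fun _ => (S.glue hne).src (Sum.inl (none, false)) = v) (fun _ hv =>
          if (x ⟨Sum.inl (none, false), hv⟩).val = (x ⟨Sum.inr l₀, (if_pos rfl).trans hv⟩).val
            then (1 : ℂ) else 0) (fun _ _ => 1)).trans ?_)
      · rw [Fintype.prod_unique]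
        congr!
      · rw [Finset.prod_const_one, mul_one]
        rfl

end OpenGraph

end Invariance

end YangMills

namespace YangMills

/-! ### The Wilson graph functions of glued graphs -/

section WilsonGlue

theorem prod_prod_fiber {V W : Type} [Fintype V] [Fintype W] (f : V → W)
    [∀ w, Fintype {u // f u = w}] (F : V → ℂ) :
    ∏ w, ∏ u : {u // f u = w}, F u.1 = ∏ u, F u := by
  rw [← (Equiv.sigmaFiberEquiv f).prod_comp F, Fintype.prod_sigma]
  rfl

theorem prod_dite_eq_self {V : Type} [Fintype V] (i : V) [∀ j, Decidable (i = j)]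
    (f : ∀ j, i = j → ℂ) : ∏ j, (if h : i = j then f j h else 1) = f i rfl := by
  classical
  convert Fintype.prod_dite_eq i f

/-- Multi-indices over `Option E × Bool`. -/
def optionIndexEquiv {E : Type} (n : Option E × Bool → ℕ) :
    (∀ p, Fin (n p)) ≃
      (Fin (n (none, false)) × Fin (n (none, true))) × ∀ p : E × Bool, Fin (n (some p.1, p.2)) where
  toFun x := ((x (none, false), x (none, true)), fun p => x (some p.1, p.2))
  invFun z
    | (none, false) => z.1.1
    | (none, true) => z.1.2
    | (some e, s) => z.2 (e, s)
  left_inv x := by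
    funext ⟨e, s⟩
    rcases e with _ | e
    · cases s <;> rfl
    · rfl
  right_inv _ := rfl

/-- Multi-indices over `(E ⊕ E') × Bool`. -/
def sumIndexEquiv {E E' : Type} (n : (E ⊕ E') × Bool → ℕ) :
    (∀ p, Fin (n p)) ≃
      (∀ p : E × Bool, Fin (n (Sum.inl p.1, p.2))) × ∀ p : E' × Bool, Fin (n (Sum.inr p.1, p.2)) where
  toFun x := (fun p => x (Sum.inl p.1, p.2), fun p => x (Sum.inr p.1, p.2))
  invFun z
    | (Sum.inl e, s) => z.1 (e, s)
    | (Sum.inr e, s) => z.2 (e, s)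
  left_inv x := by
    funext ⟨e, s⟩
    rcases e with e | e <;> rfl
  right_inv _ := rfl

theorem sum_prod_mul_mul {X Y : Type} [Fintype X] [Fintype Y] (A B : X → ℂ) (A' B' : Y → ℂ) :
    ∑ z : X × Y, (A z.1 * A' z.2) * (B z.1 * B' z.2) =
      (∑ x, A x * B x) * ∑ x, A' x * B' x := by
  rw [Fintype.sum_prod_type, Fintype.sum_mul_sum]
  exact Finset.sum_congr rfl fun x _ => Finset.sum_congr rfl fun y _ => mul_mul_mul_comm _ _ _ _

/-- The delta at the end of the new line freezes one index, and the other remains summed: the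
contraction for a prolonged outer edge. With a second delta it yields `sum_mul_delta_delta`. -/
theorem sum_mul_delta_left {m : ℕ} {X : Type} [Fintype X] (M : Fin m → Fin m → ℂ)
    (A : Fin m → X → ℂ) (B : X → ℂ) (i : Fin m) :
    ∑ z : (Fin m × Fin m) × X, (A z.1.2 z.2 * if z.1.1.val = i.val then 1 else 0) *
      (M z.1.1 z.1.2 * B z.2) = ∑ b, M i b * ∑ x, A b x * B x := by
  rw [Fintype.sum_prod_type, Fintype.sum_prod_type, Finset.sum_eq_single i]
  · refine Finset.sum_congr rfl fun b _ => ?_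
    rw [Finset.mul_sum]
    refine Finset.sum_congr rfl fun x _ => ?_
    rw [if_pos rfl]
    ring
  · intro a _ ha
    refine Finset.sum_eq_zero fun b _ => Finset.sum_eq_zero fun x _ => ?_
    rw [if_neg (fun h => ha (Fin.ext h)), mul_zero, zero_mul]
  · exact fun h => absurd (Finset.mem_univ i) h

theorem sum_mul_delta_delta {m : ℕ} {X : Type} [Fintype X] (M : Fin m → Fin m → ℂ)
    (A : X → ℂ) (B : X → ℂ) (i j : Fin m) :
    ∑ z : (Fin m × Fin m) × X, (A z.2 * ((if z.1.2.val = j.val then 1 else 0) *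
      if z.1.1.val = i.val then 1 else 0)) * (M z.1.1 z.1.2 * B z.2) =
      M i j * ∑ x, A x * B x := by
  have h := sum_mul_delta_left M (fun b x => A x * if b.val = j.val then 1 else 0) B i
  simp only [mul_assoc] at h ⊢
  rw [h, Finset.sum_eq_single j]
  · simp
  · intro b _ hb
    have hb' : b.val ≠ j.val := fun h => hb (Fin.ext h)
    simp [hb']
  · exact fun h => absurd (Finset.mem_univ j) h

variable {d : ℕ} {G : Type*} [TopologicalSpace G] [ChartedSpace (EuclideanSpace ℝ (Fin d)) G]
  [Group G] [LieGroup (𝓡 d) ∞ G]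

namespace OpenGraph

variable {S T : CellSurface}

/-- Vertices, edges and multi-indices of a disjoint union split, so the contraction is a product of
two. -/
theorem union_wilson (Γ : OpenGraph d G S) (Δ : OpenGraph d G T) (h : S.Edge ⊕ T.Edge → G)
    (y : (Γ.union Δ).LegIndex) :
    (Γ.union Δ).wilson h y =
      Γ.wilson (fun e => h (Sum.inl e)) (fun l => y (Sum.inl l)) *
        Δ.wilson (fun e => h (Sum.inr e)) (fun l => y (Sum.inr l)) := by
  classical
  have hv : ∀ x, ∏ v, (Γ.union Δ).tensor v (fun k => (Γ.union Δ).joinIndex x y k.1) =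
      (∏ u, Γ.tensor u fun k => Γ.joinIndex (fun p => x (Sum.inl p.1, p.2))
        (fun l => y (Sum.inl l)) k.1) *
      ∏ u, Δ.tensor u fun k => Δ.joinIndex (fun p => x (Sum.inr p.1, p.2))
        (fun l => y (Sum.inr l)) k.1 := by
    intro x
    refine Finset.prod_mul_distrib.trans (congrArg₂ (· * ·) ?_ ?_)
    · refine Eq.trans ?_ (prod_prod_fiber (S.inlVertex T) _)
      refine Finset.prod_congr rfl fun v _ => Finset.prod_congr ?_ fun u _ =>
        congrArg (Γ.tensor u.1) ?_
      · congr!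
      · funext ⟨k, hk⟩
        rcases k with p | l <;> rfl
    · refine Eq.trans ?_ (prod_prod_fiber (S.inrVertex T) _)
      refine Finset.prod_congr rfl fun v _ => Finset.prod_congr ?_ fun u _ =>
        congrArg (Δ.tensor u.1) ?_
      · congr!
      · funext ⟨k, hk⟩
        rcases k with p | l <;> rfl
  refine Eq.trans ?_ (sum_prod_mul_mul
    (fun z => ∏ u, Γ.tensor u fun k => Γ.joinIndex z (fun l => y (Sum.inl l)) k.1)
    (fun z => ∏ e, (Γ.color e).mat (h (Sum.inl e))⁻¹ (z (e, false)) (z (e, true)))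
    (fun z => ∏ u, Δ.tensor u fun k => Δ.joinIndex z (fun l => y (Sum.inr l)) k.1)
    (fun z => ∏ e, (Δ.color e).mat (h (Sum.inr e))⁻¹ (z (e, false)) (z (e, true))))
  exact @Fintype.sum_equiv _ _ _ (_) (_) _ (sumIndexEquiv _) _ _ fun x =>
    congrArg₂ (· * ·) (hv x) (Fintype.prod_sum_type fun e =>
      ((Γ.union Δ).color e).mat (h e)⁻¹ (x (e, false)) (x (e, true)))

variable {e e' : S.Bdry}

/-- The two deltas replace the indices at the ends of the new line by those of the outer edges, so
its contraction is a single matrix entry. -/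
theorem glue_wilson (Γ : OpenGraph d G S) (hne : e ≠ e') (μ : LieRep d G)
    (h : Option S.Edge → G) (y : (Γ.glue hne μ).LegIndex) :
    (Γ.glue hne μ).wilson h y = μ.mat (h none)⁻¹ (y (Sum.inr false)) (y (Sum.inr true)) *
      Γ.wilson (fun e => h (some e)) (fun l => y (Sum.inl l)) := by
  classical
  have hv : ∀ x, ∏ v, (Γ.glue hne μ).tensor v (fun k => (Γ.glue hne μ).joinIndex x y k.1) =
      (∏ u, Γ.tensor u fun k => Γ.joinIndex (fun p => x (some p.1, p.2))
        (fun l => y (Sum.inl l)) k.1) *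
      ((if (x (none, true)).val = (y (Sum.inr true)).val then 1 else 0) *
        if (x (none, false)).val = (y (Sum.inr false)).val then 1 else 0) := by
    intro x
    refine Finset.prod_mul_distrib.trans (congrArg₂ (· * ·) ?_ ?_)
    · refine Eq.trans ?_ (prod_prod_fiber (S.glueVertex hne) _)
      refine Finset.prod_congr rfl fun v _ => Finset.prod_congr ?_ fun u _ =>
        congrArg (Γ.tensor u.1) ?_
      · congr!
      · funext ⟨k, hk⟩
        rcases k with p | l <;> rfl
    · refine Finset.prod_comm.trans ((Fintype.prod_bool _).trans (congrArg₂ (· * ·) ?_ ?_))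
      · exact prod_dite_eq_self ((S.glue hne).src (Sum.inl (none, true))) _
      · exact prod_dite_eq_self ((S.glue hne).src (Sum.inl (none, false))) _
  refine Eq.trans ?_ (sum_mul_delta_delta (μ.mat (h none)⁻¹)
    (fun z => ∏ u, Γ.tensor u fun k => Γ.joinIndex z (fun l => y (Sum.inl l)) k.1)
    (fun z => ∏ e, (Γ.color e).mat (h (some e))⁻¹ (z (e, false)) (z (e, true)))
    (y (Sum.inr false)) (y (Sum.inr true)))
  exact @Fintype.sum_equiv _ _ _ (_) (_) _ (optionIndexEquiv _) _ _ fun x =>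
    congrArg₂ (· * ·) (hv x) (Fintype.prod_option fun e =>
      ((Γ.glue hne μ).color e).mat (h e)⁻¹ (x (e, false)) (x (e, true)))

/-- The index at the beginning of the new line stands in the slot of `l₀` in the old vector and
stays summed: the line acts by its matrix on that slot. -/
theorem glueTransport_wilson (Γ : OpenGraph d G S) (hne : e ≠ e') (l₀ : Γ.Leg)
    (hl₀ : Γ.legVertex l₀ = S.src (Sum.inr e')) (h : Option S.Edge → G)
    (y : (Γ.glueTransport hne l₀ hl₀).LegIndex) :
    (Γ.glueTransport hne l₀ hl₀).wilson h y =
      ∑ j, (Γ.legRep l₀).mat (h none)⁻¹ (y l₀) j *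
        Γ.wilson (fun e => h (some e)) (@Function.update _ _ (Classical.decEq _) y l₀ j) := by
  classical
  have hv : ∀ x, ∏ v, (Γ.glueTransport hne l₀ hl₀).tensor v
      (fun k => (Γ.glueTransport hne l₀ hl₀).joinIndex x y k.1) =
      (∏ u, Γ.tensor u fun k => Γ.joinIndex (fun p => x (some p.1, p.2))
        (@Function.update _ _ (Classical.decEq _) y l₀ (x (none, true))) k.1) *
      if (x (none, false)).val = (y l₀).val then 1 else 0 := by
    intro x
    refine Finset.prod_mul_distrib.trans (congrArg₂ (· * ·) ?_ ?_)
    · refine Eq.trans ?_ (prod_prod_fiber (S.glueVertex hne) _)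
      refine Finset.prod_congr rfl fun v _ => Finset.prod_congr ?_ fun u _ =>
        congrArg (Γ.tensor u.1) ?_
      · congr!
      · funext ⟨k, hk⟩
        rcases k with p | l
        · rfl
        · refine Fin.ext ?_
          by_cases hl : l = l₀
          · subst hl
            refine (congrArg Fin.val (dif_pos rfl)).trans ?_
            exact (congrArg Fin.val (@Function.update_self _ _ (Classical.decEq _) l
              (x (none, true)) y)).symm
          · refine (congrArg Fin.val (dif_neg hl)).trans ?_
            exact (congrArg Fin.val (@Function.update_of_ne _ _ (Classical.decEq _) _ _ hl
              (x (none, true)) y)).symm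
    · exact prod_dite_eq_self ((S.glue hne).src (Sum.inl (none, false))) _
  refine Eq.trans ?_ (sum_mul_delta_left ((Γ.legRep l₀).mat (h none)⁻¹)
    (fun b z => ∏ u, Γ.tensor u fun k => Γ.joinIndex z
      (@Function.update _ _ (Classical.decEq _) y l₀ b) k.1)
    (fun z => ∏ e, (Γ.color e).mat (h (some e))⁻¹ (z (e, false)) (z (e, true))) (y l₀))
  exact @Fintype.sum_equiv _ _ _ (_) (_) _ (optionIndexEquiv _) _ _ fun x =>
    congrArg₂ (· * ·) (hv x) (Fintype.prod_option fun e =>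
      ((Γ.glueTransport hne l₀ hl₀).color e).mat (h e)⁻¹ (x (e, false)) (x (e, true)))

end OpenGraph

end WilsonGlue

end YangMills

namespace YangMills

/-! ### Gluing of partition functions -/

/-- The edge `none` runs along `e'` and against `e`, so the holonomy along `e` is `(h none)⁻¹`, the
argument of `cut`. -/
theorem CellSurface.regionHol_glue {G : Type*} [Group G] (S : CellSurface) {e e' : S.Bdry}
    (hne : e ≠ e') (g : (S.glue hne).Bdry → G) (h : Option S.Edge → G) (r : S.Region) :
    (S.glue hne).regionHol g h r =
      S.regionHol (S.cut hne g (h none)⁻¹) (fun a => h (some a)) r := by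
  have hs : ∀ s, (S.glue hne).sideHol g h (S.glueSide e e' s) =
      S.sideHol (S.cut hne g (h none)⁻¹) (fun a => h (some a)) s := by
    rintro (⟨a, _ | _⟩ | b)
    · rfl
    · rfl
    · by_cases h1 : b = e
      · subst h1
        rw [S.glueSide_left]
        have h2 : S.cut hne g (h none)⁻¹ b = (h none)⁻¹ := dif_pos rfl
        exact h2.symm
      · by_cases h2 : b = e'
        · subst h2
          rw [S.glueSide_right hne]
          refine Eq.trans ?_ ((dif_neg h1).trans (dif_pos rfl)).symm
          exact (inv_inv _).symm
        · have h3 : S.glueSide e e' (Sum.inr b) = Sum.inr ⟨b, h1, h2⟩ :=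
            (dif_neg h1).trans (dif_neg h2)
          rw [h3]
          exact ((dif_neg h1).trans (dif_neg h2)).symm
  refine congrArg List.prod ((List.map_map ..).trans ?_)
  exact List.map_congr_left fun s _ => hs s

theorem CellSurface.regionHol_union_left {G : Type*} [Group G] (S T : CellSurface)
    (g : S.Bdry ⊕ T.Bdry → G) (h : S.Edge ⊕ T.Edge → G) (r : S.Region) :
    (S.union T).regionHol g h (Sum.inl r) =
      S.regionHol (fun b => g (Sum.inl b)) (fun a => h (Sum.inl a)) r := by
  refine congrArg List.prod ((List.map_map ..).trans (List.map_congr_left ?_))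
  rintro (⟨a, _ | _⟩ | b) _ <;> rfl

theorem CellSurface.regionHol_union_right {G : Type*} [Group G] (S T : CellSurface)
    (g : S.Bdry ⊕ T.Bdry → G) (h : S.Edge ⊕ T.Edge → G) (r : T.Region) :
    (S.union T).regionHol g h (Sum.inr r) =
      T.regionHol (fun b => g (Sum.inr b)) (fun a => h (Sum.inr a)) r := by
  refine congrArg List.prod ((List.map_map ..).trans (List.map_congr_left ?_))
  rintro (⟨a, _ | _⟩ | b) _ <;> rfl

/-- Fubini on the product of the old edges and the new one, followed by inversion of the new
holonomy. Fubini also supplies the integrability of the inner integral. -/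
theorem integral_option {G : Type*} [TopologicalSpace G] [Group G] [IsTopologicalGroup G]
    [CompactSpace G] [MeasurableSpace G] [BorelSpace G] {E : Type} [Fintype E]
    {f : (Option E → G) → ℂ} (hf : Integrable f (Measure.pi fun _ => haarProb G))
    {φ : G → (E → G) → ℂ} (hφ : ∀ h, f h = φ (h none)⁻¹ fun a => h (some a)) :
    Integrable (fun k => ∫ h, φ k h ∂Measure.pi fun _ => haarProb G) (haarProb G) ∧
      ∫ k, ∫ h, φ k h ∂(Measure.pi fun _ => haarProb G) ∂haarProb G =
        ∫ h, f h ∂Measure.pi fun _ => haarProb G := by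
  let e := (MeasurableEquiv.piOptionEquivProd fun _ : Option E => G).symm
  have he : MeasurePreserving e
      ((Measure.pi fun _ : E => haarProb G).prod (haarProb G))
      (Measure.pi fun _ : Option E => haarProb G) :=
    ⟨e.measurable, Measure.pi_map_piOptionEquivProd fun _ : Option E => haarProb G⟩
  have h1 : ∀ p : (E → G) × G, f (e p) = φ p.2⁻¹ p.1 := fun p => hφ _
  have h2 : Integrable (fun p : (E → G) × G => φ p.2⁻¹ p.1)
      ((Measure.pi fun _ : E => haarProb G).prod (haarProb G)) :=
    ((he.integrable_comp_emb e.measurableEmbedding).2 hf).congr (ae_of_all _ h1)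
  constructor
  · have h3 := h2.integral_prod_right.comp_inv
    simpa only [inv_inv] using h3
  · rw [← integral_inv_eq_self (fun k => ∫ h, φ k h ∂(Measure.pi fun _ => haarProb G)),
      ← he.integral_comp e.measurableEmbedding f]
    simp only [h1]
    exact (integral_prod_symm _ h2).symm

theorem mul_mul_eq_of_eq_mul {a b z : ℂ} (m : ℂ) (h : z = a * b) : a * m * b = m * z := by
  rw [h]; ring

theorem mul_sum_eq_of_eq_mul {n : ℕ} {a : ℂ} {b z : Fin n → ℂ} (m : Fin n → ℂ)
    (h : ∀ j, z j = a * b j) : a * ∑ j, m j * b j = ∑ j, m j * z j := by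
  rw [Finset.mul_sum]
  exact Finset.sum_congr rfl fun j _ => by rw [h]; ring

section

variable {d : ℕ} {G : Type*} [TopologicalSpace G] [ChartedSpace (EuclideanSpace ℝ (Fin d)) G]
  [Group G] [LieGroup (𝓡 d) ∞ G]

namespace OpenGraph

variable {S T : CellSurface}

theorem union_integrand (Γ : OpenGraph d G S) (Δ : OpenGraph d G T) (g : S.Bdry ⊕ T.Bdry → G)
    (y : (Γ.union Δ).LegIndex) (h : S.Edge ⊕ T.Edge → G) :
    (Γ.union Δ).integrand g y h =
      Γ.integrand (fun b => g (Sum.inl b)) (fun l => y (Sum.inl l)) (fun a => h (Sum.inl a)) *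
        Δ.integrand (fun b => g (Sum.inr b)) (fun l => y (Sum.inr l))
          (fun a => h (Sum.inr a)) := by
  refine (congrArg₂ (· * ·) ((Fintype.prod_sum_type _).trans (congrArg₂ (· * ·)
    (Finset.prod_congr rfl fun r _ => ?_) (Finset.prod_congr rfl fun r _ => ?_)))
    (union_wilson Γ Δ h y)).trans (mul_mul_mul_comm _ _ _ _)
  · exact congrArg (regionZ d _ _) (S.regionHol_union_left T g h r)
  · exact congrArg (regionZ d _ _) (S.regionHol_union_right T g h r)

variable {e e' : S.Bdry}

theorem glue_integrand (Γ : OpenGraph d G S) (hne : e ≠ e') (μ : LieRep d G)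
    (g : (S.glue hne).Bdry → G) (y : (Γ.glue hne μ).LegIndex) (h : Option S.Edge → G) :
    (Γ.glue hne μ).integrand g y h = μ.mat (h none)⁻¹ (y (Sum.inr false)) (y (Sum.inr true)) *
      Γ.integrand (S.cut hne g (h none)⁻¹) (fun l => y (Sum.inl l)) (fun a => h (some a)) := by
  refine (congrArg₂ (· * ·) (Finset.prod_congr rfl fun r _ => ?_)
    (glue_wilson Γ hne μ h y)).trans (mul_left_comm _ _ _)
  exact congrArg (regionZ d _ _) (S.regionHol_glue hne g h r)

theorem glueTransport_integrand (Γ : OpenGraph d G S) (hne : e ≠ e') (l₀ : Γ.Leg)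
    (hl₀ : Γ.legVertex l₀ = S.src (Sum.inr e')) (g : (S.glue hne).Bdry → G)
    (y : (Γ.glueTransport hne l₀ hl₀).LegIndex) (h : Option S.Edge → G) :
    (Γ.glueTransport hne l₀ hl₀).integrand g y h =
      ∑ j, (Γ.legRep l₀).mat (h none)⁻¹ (y l₀) j *
        Γ.integrand (S.cut hne g (h none)⁻¹) (@Function.update _ _ (Classical.decEq _) y l₀ j)
          (fun a => h (some a)) := by
  refine (congrArg₂ (· * ·) (Finset.prod_congr rfl fun r _ => congrArg (regionZ d _ _)
    (S.regionHol_glue hne g h r)) (glueTransport_wilson Γ hne l₀ hl₀ h y)).trans ?_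
  exact (Finset.mul_sum _ _ _).trans (Finset.sum_congr rfl fun j _ => mul_left_comm _ _ _)

/-- The action on an outer edge of the second graph leaves the indices of the first untouched. -/
theorem update_inr_apply {Γ : OpenGraph d G S} {Δ : OpenGraph d G T}
    (x : (Γ.union Δ).LegIndex) (l₀ : Δ.Leg) (j : Fin (Δ.legRep l₀).dim) :
    (fun l => @Function.update _ _ (Classical.decEq _) x (Sum.inr l₀) j (Sum.inl l)) =
        (fun l => x (Sum.inl l)) ∧
      (fun l => @Function.update _ _ (Classical.decEq _) x (Sum.inr l₀) j (Sum.inr l)) =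
        @Function.update _ _ (Classical.decEq _) (fun l => x (Sum.inr l)) l₀ j := by
  constructor
  · funext l
    exact @Function.update_of_ne _ _ (Classical.decEq _) _ _ Sum.inl_ne_inr _ _
  · funext l
    by_cases h : l = l₀
    · subst h
      exact (@Function.update_self _ _ (Classical.decEq _) _ _ _).trans
        (@Function.update_self _ (fun l => Fin (Δ.legRep l).dim) (Classical.decEq _) _ _ _).symm
    · exact (@Function.update_of_ne _ _ (Classical.decEq _) _ _
        (fun h' => h (Sum.inr_injective h')) _ _).trans
        (@Function.update_of_ne _ (fun l => Fin (Δ.legRep l).dim) (Classical.decEq _) _ _ h _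
          (fun l => x (Sum.inr l))).symm

variable [IsTopologicalGroup G] [CompactSpace G] [MeasurableSpace G] [BorelSpace G]

/-- The holonomies of the two surfaces are independent variables, and an integral of a product in
separate variables factors. -/
theorem union_Z (Γ : OpenGraph d G S) (Δ : OpenGraph d G T) (g : S.Bdry ⊕ T.Bdry → G)
    (y : (Γ.union Δ).LegIndex) :
    (Γ.union Δ).Z g y = Γ.Z (fun b => g (Sum.inl b)) (fun l => y (Sum.inl l)) *
      Δ.Z (fun b => g (Sum.inr b)) (fun l => y (Sum.inr l)) := by
  have he := measurePreserving_sumPiEquivProdPi (fun _ : S.Edge ⊕ T.Edge => haarProb G)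
  refine Eq.trans ?_ (integral_prod_mul _ _)
  refine Eq.trans ?_ (he.integral_comp (MeasurableEquiv.measurableEmbedding _) _)
  exact integral_congr_ae (ae_of_all _ fun h => union_integrand Γ Δ g y h)

variable [T2Space G] [LieAlgebra.IsSimple ℝ (GroupLieAlgebra (𝓡 d) G)]

theorem integral_glue (Γ : OpenGraph d G S) (hne : e ≠ e') (μ : LieRep d G)
    (g : (S.glue hne).Bdry → G) (x : (Γ.glue hne μ).LegIndex) :
    Integrable (fun h => μ.mat h (x (Sum.inr false)) (x (Sum.inr true)) *
      Γ.Z (S.cut hne g h) (fun l => x (Sum.inl l))) (haarProb G) ∧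
    ∫ h, μ.mat h (x (Sum.inr false)) (x (Sum.inr true)) *
      Γ.Z (S.cut hne g h) (fun l => x (Sum.inl l)) ∂haarProb G = (Γ.glue hne μ).Z g x := by
  have h1 := integral_option (E := S.Edge) ((Γ.glue hne μ).integrable_integrand g x)
    (φ := fun k h => μ.mat k (x (Sum.inr false)) (x (Sum.inr true)) *
      Γ.integrand (S.cut hne g k) (fun l => x (Sum.inl l)) h)
    (Γ.glue_integrand hne μ g x)
  simp only [integral_const_mul] at h1
  exact h1

theorem integral_glueTransport (Γ : OpenGraph d G S) (hne : e ≠ e') (l₀ : Γ.Leg)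
    (hl₀ : Γ.legVertex l₀ = S.src (Sum.inr e')) (g : (S.glue hne).Bdry → G)
    (x : (Γ.glueTransport hne l₀ hl₀).LegIndex) :
    Integrable (fun h => ∑ j, (Γ.legRep l₀).mat h (x l₀) j *
      Γ.Z (S.cut hne g h) (@Function.update _ _ (Classical.decEq _) x l₀ j)) (haarProb G) ∧
    ∫ h, ∑ j, (Γ.legRep l₀).mat h (x l₀) j *
      Γ.Z (S.cut hne g h) (@Function.update _ _ (Classical.decEq _) x l₀ j) ∂haarProb G =
        (Γ.glueTransport hne l₀ hl₀).Z g x := by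
  have h1 := integral_option (E := S.Edge)
    ((Γ.glueTransport hne l₀ hl₀).integrable_integrand g x)
    (φ := fun k h => ∑ j, (Γ.legRep l₀).mat k (x l₀) j *
      Γ.integrand (S.cut hne g k) (@Function.update _ _ (Classical.decEq _) x l₀ j) h)
    (Γ.glueTransport_integrand hne l₀ hl₀ g x)
  -- The sum over `j` is finite and every term integrable, so it leaves the inner integral.
  have h2 : ∀ k, ∫ h, ∑ j, (Γ.legRep l₀).mat k (x l₀) j * Γ.integrand (S.cut hne g k)
        (@Function.update _ _ (Classical.decEq _) x l₀ j) h ∂(Measure.pi fun _ => haarProb G) =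
      ∑ j, (Γ.legRep l₀).mat k (x l₀) j *
        Γ.Z (S.cut hne g k) (@Function.update _ _ (Classical.decEq _) x l₀ j) := fun k =>
    (integral_finsetSum _ fun j _ => (Γ.integrable_integrand _ _).const_mul _).trans
      (Finset.sum_congr rfl fun j _ => integral_const_mul _ _)
  simp only [h2] at h1
  exact h1

/-- Gluing two surfaces is gluing two intervals of their disjoint union, whose partition function is
a product. -/
theorem integral_union_glue (Γ : OpenGraph d G S) (Δ : OpenGraph d G T) (b : S.Bdry) (c : T.Bdry)
    (μ : LieRep d G) (hne : (Sum.inl b : (S.union T).Bdry) ≠ Sum.inr c)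
    (g : ((S.union T).glue hne).Bdry → G) (x : ((Γ.union Δ).glue hne μ).LegIndex) :
    Integrable (fun h => Γ.Z (fun b => (S.union T).cut hne g h (Sum.inl b))
        (fun l => x (Sum.inl (Sum.inl l))) * μ.mat h (x (Sum.inr false)) (x (Sum.inr true)) *
      Δ.Z (fun b => (S.union T).cut hne g h (Sum.inr b)) (fun l => x (Sum.inl (Sum.inr l))))
      (haarProb G) ∧
    ∫ h, Γ.Z (fun b => (S.union T).cut hne g h (Sum.inl b)) (fun l => x (Sum.inl (Sum.inl l))) *
      μ.mat h (x (Sum.inr false)) (x (Sum.inr true)) *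
      Δ.Z (fun b => (S.union T).cut hne g h (Sum.inr b)) (fun l => x (Sum.inl (Sum.inr l)))
        ∂haarProb G = ((Γ.union Δ).glue hne μ).Z g x := by
  obtain ⟨h1, h2⟩ := (Γ.union Δ).integral_glue hne μ g x
  have key : ∀ h, Γ.Z (fun b => (S.union T).cut hne g h (Sum.inl b))
        (fun l => x (Sum.inl (Sum.inl l))) * μ.mat h (x (Sum.inr false)) (x (Sum.inr true)) *
      Δ.Z (fun b => (S.union T).cut hne g h (Sum.inr b)) (fun l => x (Sum.inl (Sum.inr l))) =
      μ.mat h (x (Sum.inr false)) (x (Sum.inr true)) *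
        (Γ.union Δ).Z ((S.union T).cut hne g h) (fun l => x (Sum.inl l)) := fun h =>
    mul_mul_eq_of_eq_mul _ (Γ.union_Z Δ _ _)
  exact ⟨h1.congr (ae_of_all _ fun h => (key h).symm),
    (integral_congr_ae (ae_of_all _ key)).trans h2⟩

theorem integral_union_glueTransport (Γ : OpenGraph d G S) (Δ : OpenGraph d G T) (b : S.Bdry)
    (c : T.Bdry) (hne : (Sum.inl b : (S.union T).Bdry) ≠ Sum.inr c) (l₀ : Δ.Leg)
    (hl₀ : (Γ.union Δ).legVertex (Sum.inr l₀) = (S.union T).src (Sum.inr (Sum.inr c)))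
    (g : ((S.union T).glue hne).Bdry → G)
    (x : ((Γ.union Δ).glueTransport hne (Sum.inr l₀) hl₀).LegIndex) :
    Integrable (fun h => Γ.Z (fun b => (S.union T).cut hne g h (Sum.inl b))
        (fun l => x (Sum.inl l)) *
      ∑ j : Fin (Δ.legRep l₀).dim, (Δ.legRep l₀).mat h (x (Sum.inr l₀)) j *
        Δ.Z (fun b => (S.union T).cut hne g h (Sum.inr b))
          (@Function.update _ _ (Classical.decEq _) (fun l => x (Sum.inr l)) l₀ j))
      (haarProb G) ∧
    ∫ h, Γ.Z (fun b => (S.union T).cut hne g h (Sum.inl b)) (fun l => x (Sum.inl l)) *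
      ∑ j : Fin (Δ.legRep l₀).dim, (Δ.legRep l₀).mat h (x (Sum.inr l₀)) j *
        Δ.Z (fun b => (S.union T).cut hne g h (Sum.inr b))
          (@Function.update _ _ (Classical.decEq _) (fun l => x (Sum.inr l)) l₀ j)
        ∂haarProb G = ((Γ.union Δ).glueTransport hne (Sum.inr l₀) hl₀).Z g x := by
  obtain ⟨h1, h2⟩ := (Γ.union Δ).integral_glueTransport hne (Sum.inr l₀) hl₀ g x
  have hj : ∀ h (j : Fin (Δ.legRep l₀).dim), (Γ.union Δ).Z ((S.union T).cut hne g h)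
      (@Function.update _ _ (Classical.decEq _) x (Sum.inr l₀) j) =
      Γ.Z (fun b => (S.union T).cut hne g h (Sum.inl b)) (fun l => x (Sum.inl l)) *
        Δ.Z (fun b => (S.union T).cut hne g h (Sum.inr b))
          (@Function.update _ _ (Classical.decEq _) (fun l => x (Sum.inr l)) l₀ j) := by
    intro h j
    obtain ⟨h3, h4⟩ := update_inr_apply x l₀ j
    exact (Γ.union_Z Δ _ _).trans
      (congrArg₂ (· * ·) (congrArg (Γ.Z _) h3) (congrArg (Δ.Z _) h4))
  have key : ∀ h, Γ.Z (fun b => (S.union T).cut hne g h (Sum.inl b)) (fun l => x (Sum.inl l)) *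
      ∑ j : Fin (Δ.legRep l₀).dim, (Δ.legRep l₀).mat h (x (Sum.inr l₀)) j *
        Δ.Z (fun b => (S.union T).cut hne g h (Sum.inr b))
          (@Function.update _ _ (Classical.decEq _) (fun l => x (Sum.inr l)) l₀ j) =
      ∑ j : Fin (Δ.legRep l₀).dim, (Δ.legRep l₀).mat h (x (Sum.inr l₀)) j *
        (Γ.union Δ).Z ((S.union T).cut hne g h)
          (@Function.update _ _ (Classical.decEq _) x (Sum.inr l₀) j) := fun h =>
    mul_sum_eq_of_eq_mul _ (hj h)
  exact ⟨h1.congr (ae_of_all _ fun h => (key h).symm),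
    (integral_congr_ae (ae_of_all _ key)).trans h2⟩

end OpenGraph

end

end YangMills


theorem mainTheorem7 {d : ℕ} {G : Type*} [TopologicalSpace G]
    [ChartedSpace (EuclideanSpace ℝ (Fin d)) G] [Group G] [LieGroup (𝓡 d) ∞ G]
    [IsTopologicalGroup G] [T2Space G] [CompactSpace G] [ConnectedSpace G]
    [LieAlgebra.IsSimple ℝ (GroupLieAlgebra (𝓡 d) G)]
    [MeasurableSpace G] [BorelSpace G] :
    -- all partition functions are given by absolutely convergent sums and integrals
    (∀ (S : CellSurface) (Γ : OpenGraph d G S), Γ.Converges) ∧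
    -- gluing two surfaces along boundary intervals, with a new Wilson line colored by `V_μ`
    (∀ (S₁ S₂ : CellSurface) (Γ₁ : OpenGraph d G S₁) (Γ₂ : OpenGraph d G S₂),
      Γ₁.IsInvariant → Γ₂.IsInvariant →
      ∀ (e₁ : S₁.Bdry) (e₂ : S₂.Bdry) (μ : LieRep d G),
      let hne : (Sum.inl e₁ : (S₁.union S₂).Bdry) ≠ Sum.inr e₂ := Sum.inl_ne_inr
      ((Γ₁.union Γ₂).glue hne μ).IsInvariant ∧
      ∀ (g : ((S₁.union S₂).glue hne).Bdry → G) (x : ((Γ₁.union Γ₂).glue hne μ).LegIndex),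
        let F : G → ℂ := fun h =>
          Γ₁.Z (fun b => (S₁.union S₂).cut hne g h (Sum.inl b)) (fun l => x (Sum.inl (Sum.inl l)))
            * μ.mat h (x (Sum.inr false)) (x (Sum.inr true))
            * Γ₂.Z (fun b => (S₁.union S₂).cut hne g h (Sum.inr b))
                (fun l => x (Sum.inl (Sum.inr l)))
        Integrable F (haarProb G) ∧
          ∫ h, F h ∂(haarProb G) = ((Γ₁.union Γ₂).glue hne μ).Z g x) ∧
    -- gluing two intervals (in particular two neighboring ones) of the boundary of one surface
    (∀ (S : CellSurface) (Γ : OpenGraph d G S), Γ.IsInvariant →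
      ∀ (e e' : S.Bdry) (hne : e ≠ e') (μ : LieRep d G),
      (Γ.glue hne μ).IsInvariant ∧
      ∀ (g : (S.glue hne).Bdry → G) (x : (Γ.glue hne μ).LegIndex),
        let F : G → ℂ := fun h =>
          μ.mat h (x (Sum.inr false)) (x (Sum.inr true))
            * Γ.Z (S.cut hne g h) (fun l => x (Sum.inl l))
        Integrable F (haarProb G) ∧ ∫ h, F h ∂(haarProb G) = (Γ.glue hne μ).Z g x) ∧
    -- gluing two surfaces when `π_μ(h)` acts on the value of an outer edge colored by `V_μ` at an
    -- end of the glued interval: this outer edge is prolonged along the glued interval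
    (∀ (S₁ S₂ : CellSurface) (Γ₁ : OpenGraph d G S₁) (Γ₂ : OpenGraph d G S₂),
      Γ₁.IsInvariant → Γ₂.IsInvariant →
      ∀ (e₁ : S₁.Bdry) (e₂ : S₂.Bdry) (l₀ : Γ₂.Leg)
        (h₀ : Γ₂.legVertex l₀ = S₂.src (Sum.inr e₂)),
      let hne : (Sum.inl e₁ : (S₁.union S₂).Bdry) ≠ Sum.inr e₂ := Sum.inl_ne_inr
      let hl₀ := Γ₁.union_legVertex_right Γ₂ h₀
      ((Γ₁.union Γ₂).glueTransport hne (Sum.inr l₀) hl₀).IsInvariant ∧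
      ∀ (g : ((S₁.union S₂).glue hne).Bdry → G)
        (x : ((Γ₁.union Γ₂).glueTransport hne (Sum.inr l₀) hl₀).LegIndex),
        let F : G → ℂ := fun h =>
          Γ₁.Z (fun b => (S₁.union S₂).cut hne g h (Sum.inl b)) (fun l => x (Sum.inl l))
            * ∑ j : Fin (Γ₂.legRep l₀).dim, (Γ₂.legRep l₀).mat h (x (Sum.inr l₀)) j
              * Γ₂.Z (fun b => (S₁.union S₂).cut hne g h (Sum.inr b))
                  (@Function.update _ _ (Classical.decEq _) (fun l => x (Sum.inr l)) l₀ j)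
        Integrable F (haarProb G) ∧
          ∫ h, F h ∂(haarProb G) = ((Γ₁.union Γ₂).glueTransport hne (Sum.inr l₀) hl₀).Z g x) ∧
    -- the same for two intervals (in particular two neighboring ones) of one surface
    (∀ (S : CellSurface) (Γ : OpenGraph d G S), Γ.IsInvariant →
      ∀ (e e' : S.Bdry) (hne : e ≠ e') (l₀ : Γ.Leg)
        (hl₀ : Γ.legVertex l₀ = S.src (Sum.inr e')),
      (Γ.glueTransport hne l₀ hl₀).IsInvariant ∧
      ∀ (g : (S.glue hne).Bdry → G) (x : (Γ.glueTransport hne l₀ hl₀).LegIndex),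
        let F : G → ℂ := fun h =>
          ∑ j : Fin (Γ.legRep l₀).dim, (Γ.legRep l₀).mat h (x l₀) j
            * Γ.Z (S.cut hne g h) (@Function.update _ _ (Classical.decEq _) x l₀ j)
        Integrable F (haarProb G) ∧
          ∫ h, F h ∂(haarProb G) = (Γ.glueTransport hne l₀ hl₀).Z g x) := by
  exact ⟨fun S Γ => Γ.converges,
    fun S₁ S₂ Γ₁ Γ₂ h₁ h₂ e₁ e₂ μ => ⟨(h₁.union h₂).glue _ μ,
      Γ₁.integral_union_glue Γ₂ e₁ e₂ μ Sum.inl_ne_inr⟩,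
    fun S Γ hΓ e e' hne μ => ⟨hΓ.glue hne μ, Γ.integral_glue hne μ⟩,
    fun S₁ S₂ Γ₁ Γ₂ h₁ h₂ e₁ e₂ l₀ h₀ => ⟨(h₁.union h₂).glueTransport _ _ _,
      Γ₁.integral_union_glueTransport Γ₂ e₁ e₂ Sum.inl_ne_inr l₀
        (Γ₁.union_legVertex_right Γ₂ h₀)⟩,
    fun S Γ hΓ e e' hne l₀ hl₀ => ⟨hΓ.glueTransport hne l₀ hl₀,
      Γ.integral_glueTransport hne l₀ hl₀⟩⟩
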